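/- **Conventions.** All polytopes are nonempty. A polytope $P\subset\mathbb{R}^n_{\ge 0}$ is *anti-blocking* if $q\in P$ and $0\le p\le q$ (componentwise) imply $p\in P$. For $J\subseteq[n]$ put $P|_J=\{x\in P: x_j=0 \text{ for } j\notin J\}$ and $J^c=[n]\setminus J$. For $P,Q\subseteq\mathbb{R}^n$ put $P\boxminus Q=\operatorname{conv}\bigl(P\times\{1\}\cup(-Q)\times\{-1\}\bigr)\subseteq\mathbb{R}^{n+1}$, the Cayley sum of $P$ and $-Q$; if $P$ and $Q$ lie in complementary coordinate subspaces it is called a *join* and written $P*Q$. $V(P)$ denotes the vertex set of $P$. A *subdivision* of a polytope $P$ is a finite collection of polytopes (cells) of dimension $\dim P$ with union $P$, such that the intersection of any two distinct cells is a (possibly empty) face of both. It is *regular* if there is a weight $\omega:V(P)\to\mathbb{R}$ such that its cells are exactly the sets of dimension $\dim P$ of the form $\operatorname{conv}\{v\in V(P):\omega(v)+c(v)\text{ is minimal}\}$, $c$ a linear form; more generally, it is regular with respect to a finite set $A$ with $\operatorname{conv}A=P$ if the same holds with $A$ in place of $V(P)$. A *triangulation* is a subdivision into simplices whose vertices are vertices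 of $P$; it is *flag* if every minimal non-face has exactly two vertices, and *unimodular* with respect to an (affine) lattice $L$ if every cell is a full-dimensional simplex with vertices in $L$ of minimal volume among all such simplices. A *mixed subdivision* of $P_1-P_2$ is a subdivision with cells $Q_1-Q_2$, where $Q_j$ is the convex hull of a subset of $V(P_j)$. It is *exact* if $\dim(Q_1-Q_2)=\dim Q_1+\dim Q_2$ for all cells. It is *regular* if there are weights $\omega_j:V(P_j)\to\mathbb{R}$ such that the pairs $(Q_1,Q_2)$ are exactly the pairs with $\dim(Q_1-Q_2)=\dim(P_1-P_2)$, $Q_1=\operatorname{conv}\{v\in V(P_1):\omega_1(v)+c(v)\text{ minimal}\}$ and $Q_2=\operatorname{conv}\{w\in V(P_2):\omega_2(w)-c(w)\text{ minimal}\}$ for some linear form $c$. **Theorem.** Let $P_1,P_2\subset\mathbb{R}^n$ be full-dimensional anti-blocking polytopes. (A) The polytopes $P_1|_J-P_2|_{J^c}$, $J\subseteq[n]$, are the cells of a regular exact mixed subdivision of $P_1-P_2$, and the joins $P_1|_J*P_2|_{J^c}$, $J\subseteq[n]$, are the cells of a regular subdivision of $P_1\boxminus P_2$. (B) Let $\mathcal{S}_1,\mathcal{S}_2$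 be subdivisions of $P_1,P_2$, and let $\mathcal{S}_i|_J=\{T\cap P_i|_J:T\in\mathcal{S}_i\}$. Let $\mathcal{S}$ be the set of those members of $\bigcup_{J\subseteq[n]}\{F_1*F_2:F_1\in\mathcal{S}_1|_J,\ F_2\in\mathcal{S}_2|_{J^c}\}$ that have dimension $n+1$. Then $\mathcal{S}$ is a subdivision of $P_1\boxminus P_2$, and every member of this union is a face of a cell of $\mathcal{S}$. Moreover: (i) If $\mathcal{S}_1$ and $\mathcal{S}_2$ are regular, then so is $\mathcal{S}$. More generally, if $\mathcal{S}_i$ is regular with respect to a finite set $A_i$ with $\operatorname{conv}A_i=P_i$ for $i=1,2$, then $\mathcal{S}$ is regular with respect to $A_1\times\{1\}\cup(-A_2)\times\{-1\}$. (ii) If $\mathcal{S}_1$ and $\mathcal{S}_2$ are triangulations, then so is $\mathcal{S}$. If they are unimodular triangulations with respect to a full-rank lattice $\Lambda\subset\mathbb{R}^n$ that is the direct sum of its intersections with the coordinate axes (such as $\mathbb{Z}^n$ or $2\mathbb{Z}^n$), then $\mathcal{S}$ is a unimodular triangulation with respect to the affine lattice $\Lambda\times(2\mathbb{Z}+1)$.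 (iii) If $\mathcal{S}_1$ and $\mathcal{S}_2$ are flag triangulations, then so is $\mathcal{S}$. -/

import Mathlib

open scoped Pointwise

noncomputable section

namespace AntiBlockingCayley

/-- A (nonempty) polytope: the convex hull of a nonempty finite set. -/
def IsPolytope {E : Type*} [AddCommGroup E] [Module ℝ E] (P : Set E) : Prop :=
  ∃ s : Set E, s.Finite ∧ s.Nonempty ∧ P = convexHull ℝ s

/-- The dimension of (the affine hull of) a set. -/
def polyDim {E : Type*} [AddCommGroup E] [Module ℝ E] (P : Set E) : ℕ :=
  Module.finrank ℝ (vectorSpan ℝ P)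

/-- The vertex set of a polytope. -/
def vertices {E : Type*} [AddCommGroup E] [Module ℝ E] (P : Set E) : Set E :=
  P.extremePoints ℝ

/-- Full-dimensional anti-blocking polytopes in `ℝⁿ`. -/
structure IsFullDimAntiBlocking {n : ℕ} (P : Set (Fin n → ℝ)) : Prop where
  isPolytope : IsPolytope P
  fullDim : polyDim P = n
  nonneg : ∀ q ∈ P, 0 ≤ q
  down : ∀ q ∈ P, ∀ p : Fin n → ℝ, 0 ≤ p → p ≤ q → p ∈ P

/-- The face `P|_J` of points of `P` whose coordinates outside `J` vanish. -/
def coordFace {n : ℕ} (P : Set (Fin n → ℝ)) (J : Finset (Fin n)) : Set (Fin n → ℝ) :=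
  {x | x ∈ P ∧ ∀ j, j ∉ J → x j = 0}

/-- `conv (P × {1} ∪ (-Q) × {-1})`, the Cayley sum of `P` and `-Q`. If `P` and `Q` lie in
complementary coordinate subspaces this is the join `P * Q`. -/
def cayleyDiff {n : ℕ} (P Q : Set (Fin n → ℝ)) : Set ((Fin n → ℝ) × ℝ) :=
  convexHull ℝ ((P ×ˢ {(1 : ℝ)}) ∪ ((-Q) ×ˢ {(-1 : ℝ)}))

/-- A subdivision of a polytope `P`, given by its maximal cells. Faces are exposed faces; with
Mathlib's conventions the empty set and the polytope itself are faces. -/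
structure IsSubdivision {E : Type*} [AddCommGroup E] [Module ℝ E] [TopologicalSpace E]
    (P : Set E) (S : Set (Set E)) : Prop where
  finite : S.Finite
  isPolytope : ∀ Q ∈ S, IsPolytope Q
  dim_eq : ∀ Q ∈ S, polyDim Q = polyDim P
  cover : ⋃₀ S = P
  face_left : ∀ Q ∈ S, ∀ R ∈ S, Q ≠ R → IsExposed ℝ Q (Q ∩ R)
  face_right : ∀ Q ∈ S, ∀ R ∈ S, Q ≠ R → IsExposed ℝ R (Q ∩ R)

/-- The convex hull of the points of `A` at which the weight `ω` plus the linear form `c` is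
minimal: the projection of a lower face of the polytope `conv {(a, ω a) : a ∈ A}`. -/
def lowerCell {E : Type*} [AddCommGroup E] [Module ℝ E]
    (A : Set E) (ω : E → ℝ) (c : E →ₗ[ℝ] ℝ) : Set E :=
  convexHull ℝ {a | a ∈ A ∧ ∀ b ∈ A, ω a + c a ≤ ω b + c b}

/-- `S` is the set of maximal cells of the regular subdivision of `conv A` that is induced by some
weights on the finite point set `A`. For regular subdivisions of a polytope, in the strict sense,
`A` is its vertex set. -/
def IsRegularSubdivision {E : Type*} [AddCommGroup E] [Module ℝ E]
    (A : Set E) (S : Set (Set E)) : Prop :=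
  ∃ ω : E → ℝ, S = {Q | polyDim Q = polyDim (convexHull ℝ A) ∧
    ∃ c : E →ₗ[ℝ] ℝ, Q = lowerCell A ω c}

/-- `Q` is the convex hull of some of the vertices of `P`. -/
def IsVertexInduced {E : Type*} [AddCommGroup E] [Module ℝ E] (P Q : Set E) : Prop :=
  ∃ s : Set E, s ⊆ vertices P ∧ Q = convexHull ℝ s

/-- A mixed subdivision of `P₁ - P₂`, given by the pairs `(Q₁, Q₂)` with `Q₁ - Q₂` a cell. -/
def IsMixedSubdivision {E : Type*} [AddCommGroup E] [Module ℝ E] [TopologicalSpace E]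
    (P₁ P₂ : Set E) (M : Set (Set E × Set E)) : Prop :=
  IsSubdivision (P₁ - P₂) ((fun p : Set E × Set E => p.1 - p.2) '' M) ∧
    ∀ p ∈ M, IsVertexInduced P₁ p.1 ∧ IsVertexInduced P₂ p.2

/-- Exactness of a mixed subdivision. -/
def IsExactMixed {E : Type*} [AddCommGroup E] [Module ℝ E] (M : Set (Set E × Set E)) : Prop :=
  ∀ p ∈ M, polyDim (p.1 - p.2) = polyDim p.1 + polyDim p.2

/-- `M` is the mixed subdivision of `P₁ - P₂` induced by weights on the vertices of `P₁` and of
`P₂`: its cells are the projections of the lower faces of the Minkowski sum of the lifted polytopes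
`conv {(v, ω₁ v)}` and `conv {(-w, ω₂ w)}`, so `w` is tested against `-c` when `v` is against `c`. -/
def IsRegularMixed {E : Type*} [AddCommGroup E] [Module ℝ E]
    (P₁ P₂ : Set E) (M : Set (Set E × Set E)) : Prop :=
  ∃ ω₁ ω₂ : E → ℝ, M = {p | polyDim (p.1 - p.2) = polyDim (P₁ - P₂) ∧
    ∃ c : E →ₗ[ℝ] ℝ, p.1 = lowerCell (vertices P₁) ω₁ c ∧ p.2 = lowerCell (vertices P₂) ω₂ (-c)}

/-- A simplex: the convex hull of a nonempty finite affinely independent set. -/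
def IsSimplex {E : Type*} [AddCommGroup E] [Module ℝ E] (T : Set E) : Prop :=
  ∃ s : Set E, s.Finite ∧ s.Nonempty ∧ AffineIndependent ℝ ((↑) : s → E) ∧ T = convexHull ℝ s

/-- A triangulation: a subdivision into simplices without new vertices. -/
structure IsTriangulation {E : Type*} [AddCommGroup E] [Module ℝ E] [TopologicalSpace E]
    (P : Set E) (S : Set (Set E)) : Prop extends IsSubdivision P S where
  isSimplex : ∀ T ∈ S, IsSimplex T
  no_new_vertices : ∀ T ∈ S, vertices T ⊆ vertices P

/-- A full-dimensional simplex with vertices in `L`. -/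
def IsFullSimplexIn {E : Type*} [AddCommGroup E] [Module ℝ E] (L T : Set E) : Prop :=
  IsSimplex T ∧ polyDim T = Module.finrank ℝ E ∧ vertices T ⊆ L

/-- A unimodular simplex with respect to the (affine) lattice `L`: a full-dimensional simplex with
vertices in `L`, of minimal volume among all of these. -/
def IsUnimodularSimplex {E : Type*} [AddCommGroup E] [Module ℝ E] [MeasureTheory.MeasureSpace E]
    (L T : Set E) : Prop :=
  IsFullSimplexIn L T ∧
    ∀ T', IsFullSimplexIn L T' → MeasureTheory.volume T ≤ MeasureTheory.volume T'

/-- A unimodular triangulation with respect to the (affine) lattice `L`. -/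
def IsUnimodularTriangulation {E : Type*} [AddCommGroup E] [Module ℝ E] [TopologicalSpace E]
    [MeasureTheory.MeasureSpace E] (L : Set E) (P : Set E) (S : Set (Set E)) : Prop :=
  IsTriangulation P S ∧ ∀ T ∈ S, IsUnimodularSimplex L T

/-- `σ` is the vertex set of a face of the simplicial complex with maximal cells `S`. -/
def IsFaceOf {E : Type*} [AddCommGroup E] [Module ℝ E] (S : Set (Set E)) (σ : Finset E) : Prop :=
  ∃ T ∈ S, (σ : Set E) ⊆ vertices T

/-- A flag triangulation: every minimal non-face has dimension one, that is, two vertices. -/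
def IsFlagTriangulation {E : Type*} [AddCommGroup E] [Module ℝ E] [TopologicalSpace E]
    (P : Set E) (S : Set (Set E)) : Prop :=
  IsTriangulation P S ∧
    ∀ σ : Finset E, (∀ v ∈ σ, ∃ T ∈ S, v ∈ vertices T) → ¬ IsFaceOf S σ →
      (∀ τ : Finset E, τ ⊂ σ → IsFaceOf S τ) → σ.card = 2

/-- The restriction `S|_J = {T ∩ P|_J : T ∈ S}` of a subdivision `S` of `P`. -/
def restrictCells {n : ℕ} (P : Set (Fin n → ℝ)) (S : Set (Set (Fin n → ℝ))) (J : Finset (Fin n)) :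
    Set (Set (Fin n → ℝ)) :=
  {Q | ∃ T ∈ S, Q = T ∩ coordFace P J}

/-- The collection of all joins `F₁ * F₂` with `F₁ ∈ S₁|_J` and `F₂ ∈ S₂|_{Jᶜ}`, over all `J`. As
`S₁`, `S₂` consist of maximal cells, `F₁` and `F₂` may be empty or of lower dimension. -/
def joinCells {n : ℕ} (P₁ P₂ : Set (Fin n → ℝ)) (S₁ S₂ : Set (Set (Fin n → ℝ))) :
    Set (Set ((Fin n → ℝ) × ℝ)) :=
  {Q | ∃ J : Finset (Fin n), ∃ F₁ ∈ restrictCells P₁ S₁ J, ∃ F₂ ∈ restrictCells P₂ S₂ Jᶜ,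
    Q = cayleyDiff F₁ F₂}

/-- The maximal cells of the glued subdivision: the members of `joinCells` of dimension `n + 1`. -/
def gluedCells {n : ℕ} (P₁ P₂ : Set (Fin n → ℝ)) (S₁ S₂ : Set (Set (Fin n → ℝ))) :
    Set (Set ((Fin n → ℝ) × ℝ)) :=
  {Q | Q ∈ joinCells P₁ P₂ S₁ S₂ ∧ polyDim Q = n + 1}

/-- The affine lattice `Λ × (2ℤ + 1)`. -/
def oddLift {n : ℕ} (Λ : Submodule ℤ (Fin n → ℝ)) : Set ((Fin n → ℝ) × ℝ) :=
  {x | x.1 ∈ Λ ∧ ∃ k : ℤ, x.2 = 2 * (k : ℝ) + 1}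

/-- `Λ` is the direct sum of its intersections with the coordinate axes. -/
def IsCoordinateLattice {n : ℕ} (Λ : Submodule ℤ (Fin n → ℝ)) : Prop :=
  ∀ x ∈ Λ, ∀ i, Pi.single i (x i) ∈ Λ

end AntiBlockingCayley

end

open AntiBlockingCayley

/-! For nonnegative u and v, the positive part of u - v is at most u and the negative part at most
v. Hence, for anti-blocking P₁ and P₂, a point (x, t) lies in the Cayley sum iff x⁺ lies in the (1 +
t)/2-dilate of P₁ and x⁻ in the (1 - t)/2-dilate of P₂ (`IsFullDimAntiBlocking.mem_cayleyDiff`). A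
join of nonnegative factors in complementary coordinate subspaces obeys the same criterion, because
the decomposition x = u - v is unique there (`JoinPair.mem_cayleyDiff`). Comparing the two gives the
geometry. Taking for J the positive coordinates of x shows that the joins cover. Since the criterion
does not mention J, joins over different J intersect factor by factor (`JoinPair.cayleyDiff_inter`),
and exposed faces of the factors join to exposed faces (`JoinPair.isExposed`). Members of lower
dimension have measure zero and can be dropped from the cover.

For regularity, a large multiple of the coordinate sum is added to both weights, which penalizes
every coordinate used on the wrong side (`exists_cayleyDiff_eq_lowerCell`). The lower cells found in
this way cover, and two lower cells with full-dimensional overlap coincide, so there are no others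
(`isRegularSubdivision_of_cover`). The canonical joins are the case of trivial subdivisions. The
mixed subdivision uses the same criterion without dilation, with the coordinate sum as weight on
both sides.

Simplices in complementary coordinate subspaces join to simplices. For flagness, pairwise adjacent
vertices form a face in each factor and have disjoint supports across the factors, so the supports
on the first side make up a suitable J. For unimodularity, minimal volume is traded for generation
of the lattice by edges, through integer determinants (`IsUnimodularSimplex.le_vectorSpan`,
`isUnimodularSimplex_of_generates`). Generation passes to coordinate faces, and one edge of height 2
accounts for the last coordinate. -/

namespace AntiBlockingCayley

/-! ### Convex hulls, spans and lower cells -/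

section General

variable {E : Type*} [AddCommGroup E] [Module ℝ E]

/-- A face of a convex hull is the convex hull of the generators in it. -/
theorem convexHull_sep_eq (s : Set E) (l : E →ₗ[ℝ] ℝ) (c : ℝ) (h : ∀ x ∈ s, l x ≤ c) :
    {x | x ∈ convexHull ℝ s ∧ l x = c} = convexHull ℝ {x | x ∈ s ∧ l x = c} := by
  apply Set.Subset.antisymm
  · rintro x ⟨hx, hxc⟩
    -- The inequality is carried along with the implication so that the set is convex: at a proper
    -- convex combination, equality forces equality at both ends.
    have key : convexHull ℝ s ⊆
        {x | l x ≤ c ∧ (l x = c → x ∈ convexHull ℝ {x | x ∈ s ∧ l x = c})} := by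
      refine convexHull_min (fun x hx => ⟨h x hx, fun hxc => subset_convexHull ℝ _ ⟨hx, hxc⟩⟩) ?_
      intro x hx y hy a b ha hb hab
      have hlin : l (a • x + b • y) = a * l x + b * l y := by simp
      have h1 : a * l x ≤ a * c := mul_le_mul_of_nonneg_left hx.1 ha
      have h2 : b * l y ≤ b * c := mul_le_mul_of_nonneg_left hy.1 hb
      have h3 : a * c + b * c = c := by rw [← add_mul, hab, one_mul]
      refine ⟨by rw [hlin]; linarith, fun he => ?_⟩
      rw [hlin] at he
      rcases ha.eq_or_lt with rfl | ha'
      · have hb1 : b = 1 := by linarith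
        subst hb1
        simpa using hy.2 (by linarith)
      rcases hb.eq_or_lt with rfl | hb'
      · have ha1 : a = 1 := by linarith
        subst ha1
        simpa using hx.2 (by linarith)
      have e1 : l x = c := mul_left_cancel₀ ha'.ne' (by linarith)
      have e2 : l y = c := mul_left_cancel₀ hb'.ne' (by linarith)
      exact (convex_convexHull ℝ _) (hx.2 e1) (hy.2 e2) ha hb hab
    exact (key hx).2 hxc
  · refine convexHull_min (fun x hx => ⟨subset_convexHull ℝ _ hx.1, hx.2⟩) ?_
    intro x hx y hy a b ha hb hab
    refine ⟨(convex_convexHull ℝ s) hx.1 hy.1 ha hb hab, ?_⟩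
    have : l (a • x + b • y) = a * l x + b * l y := by simp
    rw [this, hx.2, hy.2, ← add_mul, hab, one_mul]

theorem vectorSpan_convexHull_eq (s : Set E) : vectorSpan ℝ (convexHull ℝ s) = vectorSpan ℝ s := by
  rw [← direction_affineSpan, affineSpan_convexHull, direction_affineSpan]

theorem vectorSpan_eq_top_iff_polyDim [FiniteDimensional ℝ E] (s : Set E) :
    vectorSpan ℝ s = ⊤ ↔ polyDim s = Module.finrank ℝ E := by
  constructor
  · intro h
    rw [polyDim, h, finrank_top]
  · exact Submodule.eq_top_of_finrank_eq

theorem IsPolytope.convex {P : Set E} (hP : IsPolytope P) : Convex ℝ P := by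
  obtain ⟨s, -, -, rfl⟩ := hP
  exact convex_convexHull ℝ s

theorem IsPolytope.nonempty {P : Set E} (hP : IsPolytope P) : P.Nonempty := by
  obtain ⟨s, -, hs, rfl⟩ := hP
  exact hs.convexHull

theorem IsPolytope.sub {P Q : Set E} (hP : IsPolytope P) (hQ : IsPolytope Q) :
    IsPolytope (P - Q) := by
  obtain ⟨s, hs, hs', rfl⟩ := hP
  obtain ⟨t, ht, ht', rfl⟩ := hQ
  exact ⟨s - t, hs.sub ht, hs'.sub ht', (convexHull_sub s t).symm⟩

theorem convex_lowerCell (A : Set E) (ω : E → ℝ) (c : E →ₗ[ℝ] ℝ) : Convex ℝ (lowerCell A ω c) :=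
  convex_convexHull ℝ _

theorem lowerCell_subset (A : Set E) (ω : E → ℝ) (c : E →ₗ[ℝ] ℝ) :
    lowerCell A ω c ⊆ convexHull ℝ A :=
  convexHull_mono fun _ hx => hx.1

/-- A linear functional that is constant on a full-dimensional set vanishes. -/
theorem linearMap_eq_zero_of_const {K : Set E} (hK : vectorSpan ℝ K = ⊤) (l : E →ₗ[ℝ] ℝ)
    (c : ℝ) (h : ∀ x ∈ K, l x = c) : l = 0 := by
  have : vectorSpan ℝ K ≤ LinearMap.ker l := by
    rw [vectorSpan_def, Submodule.span_le]
    rintro _ ⟨x, hx, y, hy, rfl⟩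
    simp [h x hx, h y hy]
  rw [hK, top_le_iff] at this
  exact LinearMap.ker_eq_top.mp this

end General

/-! ### Exposed faces as equality sets of valid inequalities -/

section Exposed

variable {E : Type*} [AddCommGroup E] [Module ℝ E] [TopologicalSpace E]

theorem isExposed_of_le {A B : Set E} (l : StrongDual ℝ E) (c : ℝ) (h : ∀ x ∈ A, l x ≤ c)
    (hB : ∀ x, x ∈ B ↔ x ∈ A ∧ l x = c) : IsExposed ℝ A B := by
  rintro ⟨b, hb⟩
  refine ⟨l, ?_⟩
  ext x
  rw [hB]
  refine and_congr_right fun hx => ⟨fun hxc y hy => hxc ▸ h y hy, fun hxy => ?_⟩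
  obtain ⟨hbA, hbc⟩ := (hB b).1 hb
  exact le_antisymm (h x hx) (hbc ▸ hxy b hbA)

/-- The zero functional with level 1 presents the empty face, so later arguments need no case split
on emptiness. -/
theorem IsExposed.exists_le {A B : Set E} (hB : IsExposed ℝ A B) :
    ∃ (l : StrongDual ℝ E) (c : ℝ), (∀ x ∈ A, l x ≤ c) ∧ ∀ x, x ∈ B ↔ x ∈ A ∧ l x = c := by
  rcases B.eq_empty_or_nonempty with rfl | ⟨b, hb⟩
  · exact ⟨0, 1, by simp, by simp⟩
  · obtain ⟨l, rfl⟩ := hB ⟨b, hb⟩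
    refine ⟨l, l b, fun x hx => hb.2 x hx, fun x => and_congr_right fun hx => ?_⟩
    exact ⟨fun h => le_antisymm (hb.2 x hx) (h b hb.1), fun h y hy => h ▸ hb.2 y hy⟩

theorem IsExposed.inter_of_subset {A B C : Set E} (hB : IsExposed ℝ A B) (hCA : C ⊆ A) :
    IsExposed ℝ C (C ∩ B) := by
  obtain ⟨l, c, h1, h2⟩ := hB.exists_le
  refine isExposed_of_le l c (fun x hx => h1 x (hCA hx)) fun x => ?_
  rw [Set.mem_inter_iff, h2]
  exact and_congr_right fun hx => ⟨fun h => h.2, fun h => ⟨hCA hx, h⟩⟩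

/-- An exposed face that contains the barycentre of a polytope's generators is everything. -/
theorem IsPolytope.exists_mem_of_face {F : Set E} (hF : IsPolytope F) :
    ∃ z ∈ F, ∀ B, IsExposed ℝ F B → z ∈ B → F ⊆ B := by
  obtain ⟨s, hs, hne, rfl⟩ := hF
  lift s to Finset E using hs
  have hne' : s.Nonempty := by simpa using hne
  have hcard : (0 : ℝ) < s.card := by exact_mod_cast hne'.card_pos
  refine ⟨s.centerMass (fun _ => (1 : ℝ)) id, ?_, fun B hB hz => ?_⟩
  · exact s.centerMass_id_mem_convexHull (by simp) (by simpa using hne')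
  · obtain ⟨l, c, h1, h2⟩ := hB.exists_le
    have hzc := ((h2 _).1 hz).2
    have hsum : ∑ x ∈ s, l x = s.card * c := by
      rw [Finset.centerMass] at hzc
      simp only [Finset.sum_const, nsmul_eq_mul, mul_one, one_smul, id, map_smul, map_sum,
        smul_eq_mul] at hzc
      rw [← hzc]
      field_simp
    -- The values are bounded by `c` and their mean is `c`, so none of them is smaller.
    have hall : ∀ x ∈ s, l x = c := by
      have h3 : ∀ x ∈ s, l x ≤ c := fun x hx => h1 x (subset_convexHull ℝ _ hx)
      refine (Finset.sum_eq_sum_iff_of_le h3).1 ?_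
      simp [hsum]
    intro x hx
    refine (h2 x).2 ⟨hx, ?_⟩
    have : convexHull ℝ (s : Set E) ⊆ {x | l x = c} := by
      refine convexHull_min (fun x hx => hall x hx) ?_
      exact convex_hyperplane (l : E →ₗ[ℝ] ℝ).isLinear c
    exact this hx

end Exposed

/-! ### Polytopes and finite covers of full-dimensional convex sets -/

section Normed

variable {E : Type*} [NormedAddCommGroup E] [NormedSpace ℝ E]

theorem IsPolytope.isCompact {P : Set E} (hP : IsPolytope P) : IsCompact P := by
  obtain ⟨s, hs, -, rfl⟩ := hP
  exact hs.isCompact_convexHull ℝ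

theorem IsPolytope.vertices_finite {P : Set E} (hP : IsPolytope P) : (vertices P).Finite := by
  obtain ⟨s, hs, -, rfl⟩ := hP
  exact hs.subset extremePoints_convexHull_subset

theorem IsPolytope.convexHull_vertices {P : Set E} (hP : IsPolytope P) :
    convexHull ℝ (vertices P) = P := by
  have h := closure_convexHull_extremePoints hP.isCompact hP.convex
  have hc : IsClosed (convexHull ℝ (P.extremePoints ℝ)) := hP.vertices_finite.isClosed_convexHull ℝ
  rwa [hc.closure_eq] at h

variable [FiniteDimensional ℝ E]

theorem interior_nonempty_of_vectorSpan_eq_top {K : Set E} (hK : Convex ℝ K) (hne : K.Nonempty)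
    (h : vectorSpan ℝ K = ⊤) : (interior K).Nonempty :=
  hK.interior_nonempty_iff_affineSpan_eq_top.2
    ((AffineSubspace.affineSpan_eq_top_iff_vectorSpan_eq_top_of_nonempty ℝ E E hne).2 h)

/-- If finitely many sets cover a full-dimensional convex set, one of them meets it in a
full-dimensional set. -/
theorem exists_vectorSpan_inter_eq_top {K : Set E} (hint : (interior K).Nonempty)
    {S : Set (Set E)} (hS : S.Finite) (hcov : K ⊆ ⋃₀ S) :
    ∃ Q ∈ S, (K ∩ Q).Nonempty ∧ vectorSpan ℝ (K ∩ Q) = ⊤ := by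
  by_contra! hcon
  let _ : MeasurableSpace E := borel E
  have : BorelSpace E := ⟨rfl⟩
  let μ : MeasureTheory.Measure E := MeasureTheory.Measure.addHaar
  have hpos : 0 < μ K :=
    lt_of_lt_of_le (isOpen_interior.measure_pos μ hint) (MeasureTheory.measure_mono interior_subset)
  -- A piece that does not span lies in a proper affine subspace, which is null; finitely many such
  -- pieces cannot cover an open set.
  have hz : ∀ Q ∈ S, μ (K ∩ Q) = 0 := by
    intro Q hQ
    rcases (K ∩ Q).eq_empty_or_nonempty with h | h
    · simp [h]
    refine MeasureTheory.measure_mono_null (subset_affineSpan ℝ (K ∩ Q))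
      (MeasureTheory.Measure.addHaar_affineSubspace _ _ fun ht => hcon Q hQ h ?_)
    exact (AffineSubspace.affineSpan_eq_top_iff_vectorSpan_eq_top_of_nonempty ℝ E E h).1 ht
  have : μ (⋃ Q ∈ S, K ∩ Q) = 0 := (MeasureTheory.measure_biUnion_null_iff hS.countable).2 hz
  refine hpos.ne' (MeasureTheory.measure_mono_null (fun x hx => ?_) this)
  obtain ⟨Q, hQ, hxQ⟩ := hcov hx
  exact Set.mem_biUnion hQ ⟨hx, hxQ⟩

/-- The full-dimensional members of a finite closed cover of a full-dimensional convex set cover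
it. -/
theorem subset_sUnion_fullDim {K : Set E} (hK : Convex ℝ K) (hint : (interior K).Nonempty)
    {S : Set (Set E)} (hS : S.Finite) (hclosed : ∀ Q ∈ S, IsClosed Q) (hcov : K ⊆ ⋃₀ S) :
    K ⊆ ⋃₀ {Q | Q ∈ S ∧ vectorSpan ℝ Q = ⊤} := by
  intro x hx
  by_contra hcon
  set S' := {Q | Q ∈ S ∧ vectorSpan ℝ Q = ⊤}
  have hcl : IsClosed (⋃₀ S') := by
    rw [Set.sUnion_eq_biUnion]
    exact (hS.subset fun Q hQ => hQ.1).isClosed_biUnion fun Q hQ => hclosed Q hQ.1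
  have hxcl : x ∈ closure (interior K) := by
    rw [hK.closure_interior_eq_closure_of_nonempty_interior hint]
    exact subset_closure hx
  obtain ⟨y, hyU, hy⟩ := mem_closure_iff.1 hxcl _ hcl.isOpen_compl hcon
  -- The part of `K` missed by the full-dimensional members contains an open set, on which some
  -- member of the cover must again be full-dimensional.
  have hint' : (interior (K ∩ (⋃₀ S')ᶜ)).Nonempty := by
    refine ⟨y, ?_⟩
    rw [interior_inter, hcl.isOpen_compl.interior_eq]
    exact ⟨hy, hyU⟩
  obtain ⟨Q, hQ, ⟨z, hz, hzQ⟩, hQt⟩ :=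
    exists_vectorSpan_inter_eq_top hint' hS (Set.inter_subset_left.trans hcov)
  exact hz.2 ⟨Q, ⟨hQ, top_le_iff.1 (hQt ▸ vectorSpan_mono ℝ Set.inter_subset_right)⟩, hzQ⟩

end Normed

/-! ### Membership in Cayley sums and joins through positive and negative parts -/

variable {n : ℕ}

/-- `u` lies in the dilate `a • F`, where `0 • F` is read as `{0}` even if `F` is empty. -/
def ScaledMem (a : ℝ) (F : Set (Fin n → ℝ)) (u : Fin n → ℝ) : Prop :=
  (a = 0 ∧ u = 0) ∨ (0 < a ∧ ∃ f ∈ F, u = a • f)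

theorem ScaledMem.mono {a : ℝ} {F G : Set (Fin n → ℝ)} {u : Fin n → ℝ} (h : ScaledMem a F u)
    (hFG : F ⊆ G) : ScaledMem a G u := by
  rcases h with h | ⟨h, f, hf, rfl⟩
  exacts [Or.inl h, Or.inr ⟨h, f, hFG hf, rfl⟩]

theorem ScaledMem.smul {a θ : ℝ} {F : Set (Fin n → ℝ)} {u : Fin n → ℝ} (h : ScaledMem a F u)
    (hθ : 0 ≤ θ) : ScaledMem (θ * a) F (θ • u) := by
  rcases hθ.eq_or_lt with rfl | hθ
  · exact Or.inl ⟨by simp, by simp⟩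
  rcases h with ⟨rfl, rfl⟩ | ⟨h, f, hf, rfl⟩
  · exact Or.inl ⟨by simp, by simp⟩
  · exact Or.inr ⟨mul_pos hθ h, f, hf, by rw [smul_smul]⟩

theorem ScaledMem.add {a b : ℝ} {F : Set (Fin n → ℝ)} {u v : Fin n → ℝ} (hF : Convex ℝ F)
    (hu : ScaledMem a F u) (hv : ScaledMem b F v) : ScaledMem (a + b) F (u + v) := by
  rcases hu with ⟨rfl, rfl⟩ | ⟨ha, f, hf, rfl⟩
  · simpa using hv
  rcases hv with ⟨rfl, rfl⟩ | ⟨hb, g, hg, rfl⟩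
  · rw [add_zero, add_zero]
    exact Or.inr ⟨ha, f, hf, rfl⟩
  have hab : 0 < a + b := add_pos ha hb
  refine Or.inr ⟨hab, (a / (a + b)) • f + (b / (a + b)) • g,
    hF hf hg (by positivity) (by positivity) (by field_simp), ?_⟩
  rw [smul_add, smul_smul, smul_smul, mul_div_cancel₀ _ hab.ne', mul_div_cancel₀ _ hab.ne']

/-- For positive `a` the witness is determined by `u`, so the two witnesses agree. -/
theorem scaledMem_inter {a : ℝ} {F G : Set (Fin n → ℝ)} {u : Fin n → ℝ} :
    ScaledMem a (F ∩ G) u ↔ ScaledMem a F u ∧ ScaledMem a G u := by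
  constructor
  · exact fun h => ⟨h.mono Set.inter_subset_left, h.mono Set.inter_subset_right⟩
  · rintro ⟨h | ⟨ha, f, hf, rfl⟩, h'⟩
    · exact Or.inl h
    rcases h' with ⟨rfl, -⟩ | ⟨-, g, hg, hfg⟩
    · exact absurd ha (lt_irrefl 0)
    have : f = g := smul_right_injective _ ha.ne' hfg
    exact Or.inr ⟨ha, f, ⟨hf, this ▸ hg⟩, rfl⟩

theorem ScaledMem.apply_nonneg {a : ℝ} {F : Set (Fin n → ℝ)} {u : Fin n → ℝ} (h : ScaledMem a F u)
    (hF : ∀ x ∈ F, 0 ≤ x) : 0 ≤ u := by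
  rcases h with ⟨-, rfl⟩ | ⟨ha, f, hf, rfl⟩
  exacts [le_rfl, smul_nonneg ha.le (hF f hf)]

theorem ScaledMem.apply_eq_zero {a : ℝ} {F : Set (Fin n → ℝ)} {u : Fin n → ℝ}
    (h : ScaledMem a F u) {j : Fin n} (hF : ∀ x ∈ F, x j = 0) : u j = 0 := by
  rcases h with ⟨-, rfl⟩ | ⟨ha, f, hf, rfl⟩
  · rfl
  · simp [hF f hf]

theorem cayleyDiff_mono {P Q P' Q' : Set (Fin n → ℝ)} (h : P ⊆ P') (h' : Q ⊆ Q') :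
    cayleyDiff P Q ⊆ cayleyDiff P' Q' :=
  convexHull_mono (Set.union_subset_union (Set.prod_mono_left h)
    (Set.prod_mono_left (Set.neg_subset_neg.2 h')))

theorem convex_cayleyDiff (P Q : Set (Fin n → ℝ)) : Convex ℝ (cayleyDiff P Q) :=
  convex_convexHull ℝ _

theorem cayleyDiff_convexHull (s t : Set (Fin n → ℝ)) :
    cayleyDiff (convexHull ℝ s) (convexHull ℝ t) =
      convexHull ℝ ((s ×ˢ {(1 : ℝ)}) ∪ ((-t) ×ˢ {(-1 : ℝ)})) := by
  have h1 : convexHull ℝ s ×ˢ {(1 : ℝ)} = convexHull ℝ (s ×ˢ {(1 : ℝ)}) := by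
    rw [convexHull_prod, convexHull_singleton]
  have h2 : (-convexHull ℝ t) ×ˢ {(-1 : ℝ)} = convexHull ℝ ((-t) ×ˢ {(-1 : ℝ)}) := by
    rw [convexHull_prod, convexHull_singleton, convexHull_neg]
  rw [cayleyDiff, h1, h2, convexHull_convexHull_union_left, convexHull_convexHull_union_right]

theorem cayleyDiff_isPolytope {P Q : Set (Fin n → ℝ)} (hP : IsPolytope P) (hQ : IsPolytope Q) :
    IsPolytope (cayleyDiff P Q) := by
  obtain ⟨s, hs, hs', rfl⟩ := hP
  obtain ⟨t, ht, ht', rfl⟩ := hQ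
  exact ⟨_, (hs.prod (Set.finite_singleton _)).union (ht.neg.prod (Set.finite_singleton _)),
    (hs'.prod (Set.singleton_nonempty _)).inl, cayleyDiff_convexHull s t⟩

/-- A convex combination is sorted by the levels 1 and -1, with total weights `a` and `b`. An empty
summand just forces its weight to be zero. -/
theorem mem_cayleyDiff {P Q : Set (Fin n → ℝ)} (hP : Convex ℝ P) (hQ : Convex ℝ Q)
    {z : (Fin n → ℝ) × ℝ} :
    z ∈ cayleyDiff P Q ↔
      ∃ a b u v, a + b = 1 ∧ ScaledMem a P u ∧ ScaledMem b Q v ∧ z = (u - v, a - b) := by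
  constructor
  · intro hz
    refine convexHull_min (t := {z | ∃ a b u v, a + b = 1 ∧ ScaledMem a P u ∧ ScaledMem b Q v ∧
      z = (u - v, a - b)}) ?_ ?_ hz
    · rintro ⟨x, t⟩ (⟨hx, ht⟩ | ⟨hx, ht⟩)
      · obtain rfl : t = 1 := ht
        exact ⟨1, 0, x, 0, by simp, Or.inr ⟨one_pos, x, hx, by simp⟩, Or.inl ⟨rfl, rfl⟩, by simp⟩
      · obtain rfl : t = -1 := ht
        exact ⟨0, 1, 0, -x, by simp, Or.inl ⟨rfl, rfl⟩, Or.inr ⟨one_pos, -x, hx, by simp⟩, by simp⟩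
    · rintro _ ⟨a, b, u, v, hab, hu, hv, rfl⟩ _ ⟨a', b', u', v', hab', hu', hv', rfl⟩ θ η hθ hη hθη
      refine ⟨θ * a + η * a', θ * b + η * b', θ • u + η • u', θ • v + η • v', ?_,
        (hu.smul hθ).add hP (hu'.smul hη), (hv.smul hθ).add hQ (hv'.smul hη), ?_⟩
      · calc θ * a + η * a' + (θ * b + η * b') = θ * (a + b) + η * (a' + b') := by ring
          _ = 1 := by rw [hab, hab', mul_one, mul_one, hθη]
      · ext i
        · simp; ring
        · simp; ring
  · rintro ⟨a, b, u, v, hab, hu, hv, rfl⟩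
    have hl : ∀ f ∈ P, (f, (1 : ℝ)) ∈ cayleyDiff P Q :=
      fun f hf => subset_convexHull ℝ _ (Or.inl ⟨hf, rfl⟩)
    have hr : ∀ g ∈ Q, (-g, (-1 : ℝ)) ∈ cayleyDiff P Q :=
      fun g hg => subset_convexHull ℝ _ (Or.inr ⟨by simpa using hg, rfl⟩)
    rcases hu with ⟨rfl, rfl⟩ | ⟨ha, f, hf, rfl⟩
    · obtain rfl : b = 1 := by linarith
      rcases hv with ⟨h, -⟩ | ⟨-, g, hg, rfl⟩
      · norm_num at h
      · simpa using hr g hg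
    rcases hv with ⟨rfl, rfl⟩ | ⟨hb, g, hg, rfl⟩
    · obtain rfl : a = 1 := by linarith
      simpa using hl f hf
    · have := convex_cayleyDiff P Q (hl f hf) (hr g hg) ha.le hb.le hab
      convert this using 1
      ext i
      · simp; ring
      · simp; ring

/-- `F₁` and `F₂` are nonnegative and lie in the coordinate subspaces of `J` and of its
complement. -/
structure JoinPair (J : Finset (Fin n)) (F₁ F₂ : Set (Fin n → ℝ)) : Prop where
  nonneg_left : ∀ x ∈ F₁, 0 ≤ x
  nonneg_right : ∀ x ∈ F₂, 0 ≤ x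
  supp_left : ∀ x ∈ F₁, ∀ j, j ∉ J → x j = 0
  supp_right : ∀ x ∈ F₂, ∀ j, j ∈ J → x j = 0

theorem posPart_negPart_sub {u v : Fin n → ℝ} (hu : 0 ≤ u) (hv : 0 ≤ v)
    (h : ∀ j, u j = 0 ∨ v j = 0) : (u - v)⁺ = u ∧ (u - v)⁻ = v := by
  constructor
  · ext j
    rw [Pi.posPart_apply, Pi.sub_apply]
    rcases h j with h | h
    · rw [h, zero_sub, posPart_of_nonpos (by simpa using hv j)]
    · rw [h, sub_zero, posPart_of_nonneg (hu j)]
  · ext j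
    rw [Pi.negPart_apply, Pi.sub_apply]
    rcases h j with h | h
    · rw [h, zero_sub, negPart_of_nonpos (by simpa using hv j), neg_neg]
    · rw [h, sub_zero, negPart_of_nonneg (hu j)]

theorem mem_cayleyDiff_of_parts {P Q : Set (Fin n → ℝ)} (hP : Convex ℝ P) (hQ : Convex ℝ Q)
    {z : (Fin n → ℝ) × ℝ} (h1 : ScaledMem ((1 + z.2) / 2) P z.1⁺)
    (h2 : ScaledMem ((1 - z.2) / 2) Q z.1⁻) : z ∈ cayleyDiff P Q := by
  refine (mem_cayleyDiff hP hQ).2 ⟨_, _, _, _, by ring, h1, h2, ?_⟩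
  rw [posPart_sub_negPart]
  ext i
  · rfl
  · simp; ring

/-- The last coordinate determines both weights, and disjoint supports identify the summands as
positive and negative part. The resulting criterion is free of `J`, so that joins over different `J`
can be compared. -/
theorem JoinPair.mem_cayleyDiff {J : Finset (Fin n)} {F₁ F₂ : Set (Fin n → ℝ)}
    (h : JoinPair J F₁ F₂) (h₁ : Convex ℝ F₁) (h₂ : Convex ℝ F₂) {z : (Fin n → ℝ) × ℝ} :
    z ∈ cayleyDiff F₁ F₂ ↔
      ScaledMem ((1 + z.2) / 2) F₁ z.1⁺ ∧ ScaledMem ((1 - z.2) / 2) F₂ z.1⁻ := by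
  refine ⟨fun hz => ?_, fun hz => mem_cayleyDiff_of_parts h₁ h₂ hz.1 hz.2⟩
  obtain ⟨a, b, u, v, hab, hu, hv, rfl⟩ := (AntiBlockingCayley.mem_cayleyDiff h₁ h₂).1 hz
  have hp := posPart_negPart_sub (hu.apply_nonneg h.nonneg_left) (hv.apply_nonneg h.nonneg_right)
    fun j => by
      by_cases hj : j ∈ J
      · exact Or.inr (hv.apply_eq_zero fun x hx => h.supp_right x hx j hj)
      · exact Or.inl (hu.apply_eq_zero fun x hx => h.supp_left x hx j hj)
  simp only [hp.1, hp.2]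
  rw [show (1 + (a - b)) / 2 = a by linarith, show (1 - (a - b)) / 2 = b by linarith]
  exact ⟨hu, hv⟩

theorem JoinPair.inter {J : Finset (Fin n)} {F₁ F₂ G₁ G₂ : Set (Fin n → ℝ)}
    (h : JoinPair J F₁ F₂) : JoinPair J (F₁ ∩ G₁) (F₂ ∩ G₂) :=
  ⟨fun x hx => h.1 x hx.1, fun x hx => h.2 x hx.1, fun x hx => h.3 x hx.1, fun x hx => h.4 x hx.1⟩

/-- Joins over different coordinate subspaces intersect in the joins of the intersections. -/
theorem JoinPair.cayleyDiff_inter {J K : Finset (Fin n)} {F₁ F₂ G₁ G₂ : Set (Fin n → ℝ)}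
    (hF : JoinPair J F₁ F₂) (hG : JoinPair K G₁ G₂) (hF₁ : Convex ℝ F₁) (hF₂ : Convex ℝ F₂)
    (hG₁ : Convex ℝ G₁) (hG₂ : Convex ℝ G₂) :
    cayleyDiff F₁ F₂ ∩ cayleyDiff G₁ G₂ = cayleyDiff (F₁ ∩ G₁) (F₂ ∩ G₂) := by
  ext z
  rw [Set.mem_inter_iff, hF.mem_cayleyDiff hF₁ hF₂, hG.mem_cayleyDiff hG₁ hG₂,
    hF.inter.mem_cayleyDiff (hF₁.inter hG₁) (hF₂.inter hG₂), scaledMem_inter,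
    scaledMem_inter]
  tauto

/-! ### Coordinate projections; faces and vertices of joins -/

/-- The coordinate projection onto `ℝᴶ`. -/
noncomputable def coordProj (J : Finset (Fin n)) : (Fin n → ℝ) →L[ℝ] (Fin n → ℝ) :=
  ContinuousLinearMap.pi fun j =>
    if j ∈ J then ContinuousLinearMap.proj (R := ℝ) (φ := fun _ : Fin n => ℝ) j else 0

theorem coordProj_apply (J : Finset (Fin n)) (x : Fin n → ℝ) (j : Fin n) :
    coordProj J x j = if j ∈ J then x j else 0 := by
  by_cases h : j ∈ J <;> simp [coordProj, h]

theorem coordProj_eq_self {J : Finset (Fin n)} {x : Fin n → ℝ} (h : ∀ j, j ∉ J → x j = 0) :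
    coordProj J x = x := by
  ext j
  rw [coordProj_apply]
  split_ifs with hj
  exacts [rfl, (h j hj).symm]

theorem coordProj_eq_zero {J : Finset (Fin n)} {x : Fin n → ℝ} (h : ∀ j, j ∈ J → x j = 0) :
    coordProj J x = 0 := by
  ext j
  rw [coordProj_apply]
  split_ifs with hj
  exacts [h j hj, rfl]

theorem coordProj_add_compl (J : Finset (Fin n)) (x : Fin n → ℝ) :
    coordProj J x + coordProj Jᶜ x = x := by
  ext j
  by_cases h : j ∈ J <;> simp [coordProj_apply, h]

/-- The join of exposed faces is an exposed face of the join. -/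
theorem JoinPair.isExposed {J : Finset (Fin n)} {F₁ F₂ G₁ G₂ : Set (Fin n → ℝ)}
    (h : JoinPair J F₁ F₂) (h₁ : IsExposed ℝ F₁ G₁) (h₂ : IsExposed ℝ F₂ G₂) :
    IsExposed ℝ (cayleyDiff F₁ F₂) (cayleyDiff G₁ G₂) := by
  obtain ⟨l₁, c₁, hl₁, hG₁⟩ := h₁.exists_le
  obtain ⟨l₂, c₂, hl₂, hG₂⟩ := h₂.exists_le
  -- The projections let each functional see only its own factor. The slope in the last coordinate
  -- moves the bounds `c₁` and `c₂` to their common mean.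
  let Φ : StrongDual ℝ ((Fin n → ℝ) × ℝ) :=
    ((l₁.comp (coordProj J)) - (l₂.comp (coordProj Jᶜ))).comp (ContinuousLinearMap.fst ℝ _ ℝ) +
      ((c₂ - c₁) / 2) • ContinuousLinearMap.snd ℝ _ ℝ
  have hΦ₁ : ∀ x ∈ F₁, Φ (x, 1) = l₁ x + (c₂ - c₁) / 2 := by
    intro x hx
    have e1 : coordProj J x = x := coordProj_eq_self (h.supp_left x hx)
    have e2 : coordProj Jᶜ x = 0 :=
      coordProj_eq_zero fun j hj => h.supp_left x hx j (Finset.mem_compl.1 hj)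
    simp [Φ, e1, e2]
  have hΦ₂ : ∀ x ∈ F₂, Φ (-x, -1) = l₂ x - (c₂ - c₁) / 2 := by
    intro x hx
    have e1 : coordProj J x = 0 := coordProj_eq_zero (h.supp_right x hx)
    have e2 : coordProj Jᶜ x = x :=
      coordProj_eq_self fun j hj => h.supp_right x hx j (by simpa using hj)
    simp [Φ, e1, e2]
    ring
  have hle : ∀ z ∈ (F₁ ×ˢ {(1 : ℝ)}) ∪ ((-F₂) ×ˢ {(-1 : ℝ)}), Φ z ≤ (c₁ + c₂) / 2 := by
    rintro ⟨x, t⟩ (⟨hx, ht⟩ | ⟨hx, ht⟩)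
    · obtain rfl : t = 1 := ht
      rw [hΦ₁ x hx]
      linarith [hl₁ x hx]
    · obtain rfl : t = -1 := ht
      have := hΦ₂ (-x) hx
      rw [neg_neg] at this
      rw [this]
      linarith [hl₂ (-x) hx]
  have hset : {z | z ∈ (F₁ ×ˢ {(1 : ℝ)}) ∪ ((-F₂) ×ˢ {(-1 : ℝ)}) ∧
      (Φ : ((Fin n → ℝ) × ℝ) →ₗ[ℝ] ℝ) z = (c₁ + c₂) / 2} =
      (G₁ ×ˢ {(1 : ℝ)}) ∪ ((-G₂) ×ˢ {(-1 : ℝ)}) := by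
    ext ⟨x, t⟩
    simp only [Set.mem_ofPred_eq, Set.mem_union, Set.mem_prod, Set.mem_singleton_iff, Set.mem_neg,
      hG₁, hG₂, ContinuousLinearMap.coe_coe]
    constructor
    · rintro ⟨⟨hx, rfl⟩ | ⟨hx, rfl⟩, he⟩
      · rw [hΦ₁ x hx] at he
        exact Or.inl ⟨⟨hx, by linarith⟩, rfl⟩
      · have := hΦ₂ (-x) hx
        rw [neg_neg] at this
        rw [this] at he
        exact Or.inr ⟨⟨hx, by linarith⟩, rfl⟩
    · rintro (⟨⟨hx, he⟩, rfl⟩ | ⟨⟨hx, he⟩, rfl⟩)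
      · exact ⟨Or.inl ⟨hx, rfl⟩, by rw [hΦ₁ x hx]; linarith⟩
      · have := hΦ₂ (-x) hx
        rw [neg_neg] at this
        exact ⟨Or.inr ⟨hx, rfl⟩, by rw [this]; linarith⟩
  have hsep := convexHull_sep_eq _ (Φ : ((Fin n → ℝ) × ℝ) →ₗ[ℝ] ℝ) _ hle
  rw [hset] at hsep
  refine isExposed_of_le Φ ((c₁ + c₂) / 2) (fun z hz => ?_) fun z => ?_
  · exact convexHull_min hle (convex_halfSpace_le (Φ : ((Fin n → ℝ) × ℝ) →ₗ[ℝ] ℝ).isLinear _) hz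
  · rw [cayleyDiff, cayleyDiff, ← hsep]
    rfl

theorem vertices_neg (P : Set (Fin n → ℝ)) : vertices (-P) = -vertices P := by
  have := image_extremePoints (𝕜 := ℝ) (LinearEquiv.neg ℝ (M := Fin n → ℝ)) P
  have h : ∀ s : Set (Fin n → ℝ), (LinearEquiv.neg ℝ (M := Fin n → ℝ)) '' s = -s := fun s => by
    rw [← Set.image_neg_eq_neg]; rfl
  rw [h, h] at this
  exact this.symm

/-- An extreme point of the hull is a generator and stays extreme in its level. Conversely, both
levels are exposed faces, cut out by the last coordinate and its negative, and extreme points of a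
face are extreme in the whole. -/
theorem vertices_cayleyDiff {P Q : Set (Fin n → ℝ)} (hP : Convex ℝ P) (hQ : Convex ℝ Q) :
    vertices (cayleyDiff P Q) =
      (vertices P ×ˢ {(1 : ℝ)}) ∪ ((-vertices Q) ×ˢ {(-1 : ℝ)}) := by
  have e1 : (P ×ˢ {(1 : ℝ)}).extremePoints ℝ = vertices P ×ˢ {(1 : ℝ)} := by
    rw [extremePoints_prod, extremePoints_singleton]; rfl
  have e2 : ((-Q) ×ˢ {(-1 : ℝ)}).extremePoints ℝ = (-vertices Q) ×ˢ {(-1 : ℝ)} := by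
    rw [extremePoints_prod, extremePoints_singleton, ← vertices_neg]; rfl
  have hP1 : Convex ℝ (P ×ˢ {(1 : ℝ)}) := hP.prod (convex_singleton 1)
  have hQ1 : Convex ℝ ((-Q) ×ˢ {(-1 : ℝ)}) := hQ.neg.prod (convex_singleton (-1))
  apply Set.Subset.antisymm
  · intro z hz
    rcases extremePoints_convexHull_subset hz with h | h
    · left
      rw [← e1]
      exact inter_extremePoints_subset_extremePoints_of_subset
        (Set.subset_union_left.trans (subset_convexHull ℝ _)) ⟨h, hz⟩
    · right
      rw [← e2]
      exact inter_extremePoints_subset_extremePoints_of_subset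
        (Set.subset_union_right.trans (subset_convexHull ℝ _)) ⟨h, hz⟩
  · have key : ∀ (ε : ℝ) (F : Set ((Fin n → ℝ) × ℝ)), Convex ℝ F →
        (∀ z ∈ (P ×ˢ {(1 : ℝ)}) ∪ ((-Q) ×ˢ {(-1 : ℝ)}), ε * z.2 ≤ 1) →
        {z | z ∈ (P ×ˢ {(1 : ℝ)}) ∪ ((-Q) ×ˢ {(-1 : ℝ)}) ∧ ε * z.2 = 1} = F →
        IsExposed ℝ (cayleyDiff P Q) F := by
      intro ε F hF hle hset
      let Φ : StrongDual ℝ ((Fin n → ℝ) × ℝ) := ε • ContinuousLinearMap.snd ℝ _ ℝ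
      have hsep := convexHull_sep_eq _ (Φ : ((Fin n → ℝ) × ℝ) →ₗ[ℝ] ℝ) 1 hle
      have hset' : {z | z ∈ (P ×ˢ {(1 : ℝ)}) ∪ ((-Q) ×ˢ {(-1 : ℝ)}) ∧
        (Φ : ((Fin n → ℝ) × ℝ) →ₗ[ℝ] ℝ) z = 1} = F := hset
      rw [hset', hF.convexHull_eq] at hsep
      refine isExposed_of_le Φ 1 (fun z hz => ?_) fun z => ?_
      · exact convexHull_min hle
          (convex_halfSpace_le (Φ : ((Fin n → ℝ) × ℝ) →ₗ[ℝ] ℝ).isLinear _) hz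
      · rw [← hsep]; rfl
    have k1 : IsExposed ℝ (cayleyDiff P Q) (P ×ˢ {(1 : ℝ)}) := by
      refine key 1 _ hP1 ?_ ?_
      · rintro ⟨x, t⟩ (⟨-, ht⟩ | ⟨-, ht⟩) <;> simp at ht <;> norm_num [ht]
      · ext ⟨x, t⟩
        simp only [Set.mem_ofPred_eq, Set.mem_union, Set.mem_prod, Set.mem_singleton_iff]
        constructor
        · rintro ⟨h | ⟨-, rfl⟩, h'⟩
          · exact h
          · norm_num at h'
        · rintro ⟨h, rfl⟩
          exact ⟨Or.inl ⟨h, rfl⟩, by norm_num⟩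
    have k2 : IsExposed ℝ (cayleyDiff P Q) ((-Q) ×ˢ {(-1 : ℝ)}) := by
      refine key (-1) _ hQ1 ?_ ?_
      · rintro ⟨x, t⟩ (⟨-, ht⟩ | ⟨-, ht⟩) <;> simp at ht <;> norm_num [ht]
      · ext ⟨x, t⟩
        simp only [Set.mem_ofPred_eq, Set.mem_union, Set.mem_prod, Set.mem_singleton_iff]
        constructor
        · rintro ⟨⟨-, rfl⟩ | h, h'⟩
          · norm_num at h'
          · exact h
        · rintro ⟨h, rfl⟩
          exact ⟨Or.inr ⟨h, rfl⟩, by norm_num⟩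
    rw [← e1, ← e2]
    exact Set.union_subset k1.isExtreme.extremePoints_subset_extremePoints
      k2.isExtreme.extremePoints_subset_extremePoints

/-! ### Coordinate faces of anti-blocking polytopes -/

/-- Minus the sum of the coordinates outside `J`. -/
noncomputable def negCoordSum (J : Finset (Fin n)) : StrongDual ℝ (Fin n → ℝ) :=
  -∑ j ∈ Jᶜ, ContinuousLinearMap.proj (R := ℝ) (φ := fun _ : Fin n => ℝ) j

theorem negCoordSum_apply (J : Finset (Fin n)) (x : Fin n → ℝ) :
    negCoordSum J x = -∑ j ∈ Jᶜ, x j := by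
  simp [negCoordSum]

theorem negCoordSum_nonpos (J : Finset (Fin n)) {x : Fin n → ℝ} (hx : 0 ≤ x) :
    negCoordSum J x ≤ 0 := by
  rw [negCoordSum_apply, neg_nonpos]
  exact Finset.sum_nonneg fun j _ => hx j

theorem negCoordSum_eq_zero (J : Finset (Fin n)) {x : Fin n → ℝ} (hx : 0 ≤ x) :
    negCoordSum J x = 0 ↔ ∀ j, j ∉ J → x j = 0 := by
  rw [negCoordSum_apply, neg_eq_zero, Finset.sum_eq_zero_iff_of_nonneg fun j _ => hx j]
  simp

theorem IsFullDimAntiBlocking.convex {P : Set (Fin n → ℝ)} (hP : IsFullDimAntiBlocking P) :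
    Convex ℝ P := hP.isPolytope.convex

theorem IsFullDimAntiBlocking.zero_mem {P : Set (Fin n → ℝ)} (hP : IsFullDimAntiBlocking P) :
    0 ∈ P := by
  obtain ⟨x, hx⟩ := hP.isPolytope.nonempty
  exact hP.down x hx 0 le_rfl (hP.nonneg x hx)

theorem IsFullDimAntiBlocking.vectorSpan_eq_top {P : Set (Fin n → ℝ)}
    (hP : IsFullDimAntiBlocking P) : vectorSpan ℝ P = ⊤ :=
  (vectorSpan_eq_top_iff_polyDim P).2 (by rw [hP.fullDim]; simp)

/-- By full dimension no coordinate vanishes identically on `P`; all other coordinates of a point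
with nonzero `j`-th one can be set to zero. -/
theorem IsFullDimAntiBlocking.exists_single_mem {P : Set (Fin n → ℝ)}
    (hP : IsFullDimAntiBlocking P) (j : Fin n) : ∃ ε : ℝ, 0 < ε ∧ Pi.single j ε ∈ P := by
  have : ∃ x ∈ P, x j ≠ 0 := by
    by_contra! h
    have h0 := linearMap_eq_zero_of_const hP.vectorSpan_eq_top (LinearMap.proj j) 0 h
    have := LinearMap.congr_fun h0 (Pi.single j 1)
    simp at this
  obtain ⟨x, hx, hxj⟩ := this
  have h0 := hP.nonneg x hx
  refine ⟨x j, lt_of_le_of_ne (h0 j) hxj.symm, hP.down x hx _ ?_ ?_⟩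
  · exact Pi.single_nonneg.2 (h0 j)
  · intro i
    by_cases h : i = j
    · subst h; simp
    · simpa [Pi.single_eq_of_ne h] using h0 i

theorem coordFace_subset (P : Set (Fin n → ℝ)) (J : Finset (Fin n)) : coordFace P J ⊆ P :=
  fun _ hx => hx.1

theorem mem_coordFace {P : Set (Fin n → ℝ)} {J : Finset (Fin n)} {x : Fin n → ℝ} :
    x ∈ coordFace P J ↔ x ∈ P ∧ ∀ j, j ∉ J → x j = 0 := Iff.rfl

/-- Intersecting with a coordinate face gives an exposed face. -/
theorem isExposed_inter_coordFace {P F : Set (Fin n → ℝ)} (J : Finset (Fin n))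
    (hP : ∀ x ∈ P, 0 ≤ x) (hF : F ⊆ P) : IsExposed ℝ F (F ∩ coordFace P J) := by
  refine isExposed_of_le (negCoordSum J) 0 (fun x hx => negCoordSum_nonpos J (hP x (hF hx)))
    fun x => and_congr_right fun hx => ?_
  rw [negCoordSum_eq_zero J (hP x (hF hx)), mem_coordFace]
  exact ⟨fun h => h.2, fun h => ⟨hF hx, h⟩⟩

/-- In the nonnegative orthant the coordinate subspace of `J` is where `negCoordSum J` attains its
maximum 0. -/
theorem convexHull_inter_coordFace {P s : Set (Fin n → ℝ)} (J : Finset (Fin n))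
    (hP : ∀ x ∈ P, 0 ≤ x) (hs : convexHull ℝ s ⊆ P) :
    convexHull ℝ s ∩ coordFace P J = convexHull ℝ {x | x ∈ s ∧ ∀ j, j ∉ J → x j = 0} := by
  have hs' : ∀ x ∈ s, 0 ≤ x := fun x hx => hP x (hs (subset_convexHull ℝ s hx))
  have h := convexHull_sep_eq s (negCoordSum J : (Fin n → ℝ) →ₗ[ℝ] ℝ) 0
    (fun x hx => negCoordSum_nonpos J (hs' x hx))
  have e : {x | x ∈ s ∧ (negCoordSum J : (Fin n → ℝ) →ₗ[ℝ] ℝ) x = 0} =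
      {x | x ∈ s ∧ ∀ j, j ∉ J → x j = 0} := by
    ext x
    exact and_congr_right fun hx => negCoordSum_eq_zero J (hs' x hx)
  rw [← e, ← h]
  ext x
  refine and_congr_right fun hx => ?_
  rw [mem_coordFace, ContinuousLinearMap.coe_coe, negCoordSum_eq_zero J (hP x (hs hx))]
  exact ⟨fun h => h.2, fun h => ⟨hs hx, h⟩⟩

theorem IsPolytope.inter_coordFace {P T : Set (Fin n → ℝ)} (J : Finset (Fin n))
    (hP : ∀ x ∈ P, 0 ≤ x) (hT : IsPolytope T) (hTP : T ⊆ P) (hne : (T ∩ coordFace P J).Nonempty) :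
    IsPolytope (T ∩ coordFace P J) := by
  obtain ⟨s, hs, -, rfl⟩ := hT
  rw [convexHull_inter_coordFace J hP hTP] at hne ⊢
  exact ⟨_, hs.subset fun x hx => hx.1, convexHull_nonempty_iff.1 hne, rfl⟩

theorem convex_coordFace {P : Set (Fin n → ℝ)} (hP : Convex ℝ P) (J : Finset (Fin n)) :
    Convex ℝ (coordFace P J) := by
  intro x hx y hy a b ha hb hab
  exact ⟨hP hx.1 hy.1 ha hb hab, fun j hj => by simp [hx.2 j hj, hy.2 j hj]⟩

/-- The anti-blocking property enters here: the positive and negative parts of `u - v` are dominated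
by `u` and `v`, so they may replace them. The criterion is the one for joins. -/
theorem IsFullDimAntiBlocking.mem_cayleyDiff {P₁ P₂ : Set (Fin n → ℝ)}
    (hP₁ : IsFullDimAntiBlocking P₁) (hP₂ : IsFullDimAntiBlocking P₂) {z : (Fin n → ℝ) × ℝ} :
    z ∈ cayleyDiff P₁ P₂ ↔
      ScaledMem ((1 + z.2) / 2) P₁ z.1⁺ ∧ ScaledMem ((1 - z.2) / 2) P₂ z.1⁻ := by
  refine ⟨fun hz => ?_, fun hz => mem_cayleyDiff_of_parts hP₁.convex hP₂.convex hz.1 hz.2⟩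
  obtain ⟨a, b, u, v, hab, hu, hv, rfl⟩ :=
    (AntiBlockingCayley.mem_cayleyDiff hP₁.convex hP₂.convex).1 hz
  have hu0 := hu.apply_nonneg hP₁.nonneg
  have hv0 := hv.apply_nonneg hP₂.nonneg
  have down : ∀ {P : Set (Fin n → ℝ)} {a : ℝ} {u w : Fin n → ℝ}, IsFullDimAntiBlocking P →
      ScaledMem a P u → 0 ≤ w → w ≤ u → ScaledMem a P w := by
    intro P a u w hP hu hw hwu
    rcases hu with ⟨rfl, rfl⟩ | ⟨ha, f, hf, rfl⟩
    · exact Or.inl ⟨rfl, le_antisymm hwu hw⟩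
    · refine Or.inr ⟨ha, a⁻¹ • w, hP.down f hf _ (smul_nonneg (inv_nonneg.2 ha.le) hw) ?_, ?_⟩
      · rw [inv_smul_le_iff_of_pos ha]
        exact hwu
      · rw [smul_inv_smul₀ ha.ne']
  simp only
  rw [show (1 + (a - b)) / 2 = a by linarith, show (1 - (a - b)) / 2 = b by linarith]
  refine ⟨down hP₁ hu (posPart_nonneg _) ?_, down hP₂ hv (negPart_nonneg _) ?_⟩
  · rw [posPart_def]
    exact sup_le (sub_le_self u hv0) hu0
  · rw [negPart_def, neg_sub]
    exact sup_le (sub_le_self v hu0) hv0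

/-! ### Spans of joins and Minkowski differences -/

theorem finrank_prod_real : Module.finrank ℝ ((Fin n → ℝ) × ℝ) = n + 1 := by simp

theorem polyDim_eq_succ_iff (Q : Set ((Fin n → ℝ) × ℝ)) :
    polyDim Q = n + 1 ↔ vectorSpan ℝ Q = ⊤ := by
  rw [vectorSpan_eq_top_iff_polyDim, finrank_prod_real]

theorem span_single_of_mem_vectorSpan {W : Submodule ℝ (Fin n → ℝ)}
    (h : ∀ j, ∃ ε : ℝ, ε ≠ 0 ∧ Pi.single j ε ∈ W) : W = ⊤ := by
  rw [eq_top_iff]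
  rintro x -
  rw [← Finset.univ_sum_single x]
  refine W.sum_mem fun j _ => ?_
  obtain ⟨ε, hε, hj⟩ := h j
  have := W.smul_mem (x j / ε) hj
  rwa [← Pi.single_smul, smul_eq_mul, div_mul_cancel₀ _ hε] at this

theorem mk_one_mem_generators {F₁ : Set (Fin n → ℝ)} (F₂ : Set (Fin n → ℝ)) {x : Fin n → ℝ}
    (hx : x ∈ F₁) : (x, (1 : ℝ)) ∈ (F₁ ×ˢ {(1 : ℝ)}) ∪ ((-F₂) ×ˢ {(-1 : ℝ)}) :=
  Or.inl ⟨hx, rfl⟩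

theorem mk_neg_one_mem_generators (F₁ : Set (Fin n → ℝ)) {F₂ : Set (Fin n → ℝ)} {x : Fin n → ℝ}
    (hx : x ∈ F₂) : (-x, (-1 : ℝ)) ∈ (F₁ ×ˢ {(1 : ℝ)}) ∪ ((-F₂) ×ˢ {(-1 : ℝ)}) :=
  Or.inr ⟨by simpa using hx, rfl⟩

/-- General scalars serve two purposes: `ℝ` for dimensions, `ℤ` for generating the lattice. -/
theorem mk_zero_mem_vectorSpan_cayleyDiff (R : Type*) [Ring R] [Module R ℝ]
    {F₁ F₂ : Set (Fin n → ℝ)} {x : Fin n → ℝ} (hx : x ∈ vectorSpan R F₁) :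
    (x, (0 : ℝ)) ∈ vectorSpan R ((F₁ ×ˢ {(1 : ℝ)}) ∪ ((-F₂) ×ˢ {(-1 : ℝ)})) := by
  have : vectorSpan R F₁ ≤ (vectorSpan R ((F₁ ×ˢ {(1 : ℝ)}) ∪ ((-F₂) ×ˢ {(-1 : ℝ)}))).comap
      (LinearMap.inl R (Fin n → ℝ) ℝ) := by
    rw [vectorSpan_def, Submodule.span_le]
    rintro _ ⟨y, hy, z, hz, rfl⟩
    have := vsub_mem_vectorSpan R (mk_one_mem_generators F₂ hy) (mk_one_mem_generators F₂ hz)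
    simpa using this
  exact this hx

theorem mk_zero_mem_vectorSpan_cayleyDiff' (R : Type*) [Ring R] [Module R ℝ]
    {F₁ F₂ : Set (Fin n → ℝ)} {x : Fin n → ℝ} (hx : x ∈ vectorSpan R F₂) :
    (x, (0 : ℝ)) ∈ vectorSpan R ((F₁ ×ˢ {(1 : ℝ)}) ∪ ((-F₂) ×ˢ {(-1 : ℝ)})) := by
  have : vectorSpan R F₂ ≤ (vectorSpan R ((F₁ ×ˢ {(1 : ℝ)}) ∪ ((-F₂) ×ˢ {(-1 : ℝ)}))).comap
      (LinearMap.inl R (Fin n → ℝ) ℝ) := by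
    rw [vectorSpan_def, Submodule.span_le]
    rintro _ ⟨y, hy, z, hz, rfl⟩
    have := vsub_mem_vectorSpan R (mk_neg_one_mem_generators F₁ hz)
      (mk_neg_one_mem_generators F₁ hy)
    simpa [sub_eq_add_neg, add_comm] using this
  exact this hx

/-- An edge between the levels has height 2, the smallest positive height of a difference in the odd
lattice. -/
theorem add_two_mem_vectorSpan_cayleyDiff (R : Type*) [Ring R] [Module R ℝ]
    {F₁ F₂ : Set (Fin n → ℝ)} {x y : Fin n → ℝ} (hx : x ∈ F₁) (hy : y ∈ F₂) :
    (x + y, (2 : ℝ)) ∈ vectorSpan R ((F₁ ×ˢ {(1 : ℝ)}) ∪ ((-F₂) ×ˢ {(-1 : ℝ)})) := by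
  have := vsub_mem_vectorSpan R (mk_one_mem_generators F₂ hx) (mk_neg_one_mem_generators F₁ hy)
  have e : (x, (1 : ℝ)) -ᵥ (-y, (-1 : ℝ)) = (x + y, (2 : ℝ)) := by
    simp; norm_num
  rwa [e] at this

theorem vectorSpan_cayleyDiff_eq (F₁ F₂ : Set (Fin n → ℝ)) :
    vectorSpan ℝ (cayleyDiff F₁ F₂) =
      vectorSpan ℝ ((F₁ ×ˢ {(1 : ℝ)}) ∪ ((-F₂) ×ˢ {(-1 : ℝ)})) :=
  vectorSpan_convexHull_eq _

/-- The factors supply the horizontal directions, and one edge between the levels supplies the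
remaining one. -/
theorem vectorSpan_cayleyDiff_eq_top {F₁ F₂ : Set (Fin n → ℝ)} (h₁ : F₁.Nonempty)
    (h₂ : F₂.Nonempty)
    (h : ∀ j, ∃ ε : ℝ, ε ≠ 0 ∧ (Pi.single j ε ∈ vectorSpan ℝ F₁ ∨ Pi.single j ε ∈ vectorSpan ℝ F₂)) :
    vectorSpan ℝ (cayleyDiff F₁ F₂) = ⊤ := by
  set W := vectorSpan ℝ (cayleyDiff F₁ F₂) with hW
  rw [vectorSpan_cayleyDiff_eq] at hW
  have h1 : W.comap (LinearMap.inl ℝ (Fin n → ℝ) ℝ) = ⊤ := by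
    refine span_single_of_mem_vectorSpan fun j => ?_
    obtain ⟨ε, hε, hj⟩ := h j
    refine ⟨ε, hε, ?_⟩
    rw [Submodule.mem_comap, hW, LinearMap.inl_apply]
    rcases hj with hj | hj
    exacts [mk_zero_mem_vectorSpan_cayleyDiff ℝ hj, mk_zero_mem_vectorSpan_cayleyDiff' ℝ hj]
  have h2 : ∀ x, (x, (0 : ℝ)) ∈ W := fun x => by
    have : x ∈ W.comap (LinearMap.inl ℝ (Fin n → ℝ) ℝ) := h1 ▸ Submodule.mem_top
    exact this
  obtain ⟨f, hf⟩ := h₁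
  obtain ⟨g, hg⟩ := h₂
  have h3 : (f + g, (2 : ℝ)) ∈ W := hW ▸ add_two_mem_vectorSpan_cayleyDiff ℝ hf hg
  rw [eq_top_iff]
  rintro ⟨x, t⟩ -
  have := W.add_mem (h2 (x - (t / 2) • (f + g))) (W.smul_mem (t / 2) h3)
  convert this using 1
  ext i <;> simp

theorem vectorSpan_sub_eq_top {F₁ F₂ : Set (Fin n → ℝ)} (h₁ : F₁.Nonempty) (h₂ : F₂.Nonempty)
    (h : ∀ j, ∃ ε : ℝ, ε ≠ 0 ∧ (Pi.single j ε ∈ vectorSpan ℝ F₁ ∨ Pi.single j ε ∈ vectorSpan ℝ F₂)) :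
    vectorSpan ℝ (F₁ - F₂) = ⊤ := by
  obtain ⟨f, hf⟩ := h₁
  obtain ⟨g, hg⟩ := h₂
  have k1 : vectorSpan ℝ F₁ ≤ vectorSpan ℝ (F₁ - F₂) := by
    rw [vectorSpan_def, Submodule.span_le]
    rintro _ ⟨y, hy, z, hz, rfl⟩
    have := vsub_mem_vectorSpan ℝ (Set.sub_mem_sub hy hg) (Set.sub_mem_sub hz hg)
    simpa using this
  have k2 : vectorSpan ℝ F₂ ≤ vectorSpan ℝ (F₁ - F₂) := by
    rw [vectorSpan_def, Submodule.span_le]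
    rintro _ ⟨y, hy, z, hz, rfl⟩
    have := vsub_mem_vectorSpan ℝ (Set.sub_mem_sub hf hz) (Set.sub_mem_sub hf hy)
    simpa using this
  refine span_single_of_mem_vectorSpan fun j => ?_
  obtain ⟨ε, hε, hj | hj⟩ := h j
  exacts [⟨ε, hε, k1 hj⟩, ⟨ε, hε, k2 hj⟩]

theorem IsFullDimAntiBlocking.single_mem_vectorSpan_coordFace {P : Set (Fin n → ℝ)}
    (hP : IsFullDimAntiBlocking P) {J : Finset (Fin n)} {j : Fin n} (hj : j ∈ J) :
    ∃ ε : ℝ, ε ≠ 0 ∧ Pi.single j ε ∈ vectorSpan ℝ (coordFace P J) := by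
  obtain ⟨ε, hε, h⟩ := hP.exists_single_mem j
  refine ⟨ε, hε.ne', ?_⟩
  have h1 : (Pi.single j ε : Fin n → ℝ) ∈ coordFace P J := by
    refine ⟨h, fun i hi => ?_⟩
    rw [Pi.single_apply, if_neg]
    exact fun hij => hi (hij ▸ hj)
  have h2 : (0 : Fin n → ℝ) ∈ coordFace P J := ⟨hP.zero_mem, fun i _ => rfl⟩
  simpa using vsub_mem_vectorSpan ℝ h1 h2

theorem IsFullDimAntiBlocking.coordFace_nonempty {P : Set (Fin n → ℝ)}
    (hP : IsFullDimAntiBlocking P) (J : Finset (Fin n)) : (coordFace P J).Nonempty :=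
  ⟨0, hP.zero_mem, fun _ _ => rfl⟩

theorem IsFullDimAntiBlocking.exists_single_mem_vectorSpan {P₁ P₂ : Set (Fin n → ℝ)}
    (hP₁ : IsFullDimAntiBlocking P₁) (hP₂ : IsFullDimAntiBlocking P₂) (J : Finset (Fin n))
    (j : Fin n) : ∃ ε : ℝ, ε ≠ 0 ∧ (Pi.single j ε ∈ vectorSpan ℝ (coordFace P₁ J) ∨
      Pi.single j ε ∈ vectorSpan ℝ (coordFace P₂ Jᶜ)) := by
  by_cases hj : j ∈ J
  · obtain ⟨ε, hε, h⟩ := hP₁.single_mem_vectorSpan_coordFace hj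
    exact ⟨ε, hε, Or.inl h⟩
  · obtain ⟨ε, hε, h⟩ := hP₂.single_mem_vectorSpan_coordFace (Finset.mem_compl.2 hj)
    exact ⟨ε, hε, Or.inr h⟩

theorem IsFullDimAntiBlocking.vectorSpan_join {P₁ P₂ : Set (Fin n → ℝ)}
    (hP₁ : IsFullDimAntiBlocking P₁) (hP₂ : IsFullDimAntiBlocking P₂) (J : Finset (Fin n)) :
    vectorSpan ℝ (cayleyDiff (coordFace P₁ J) (coordFace P₂ Jᶜ)) = ⊤ :=
  vectorSpan_cayleyDiff_eq_top (hP₁.coordFace_nonempty J) (hP₂.coordFace_nonempty Jᶜ)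
    (hP₁.exists_single_mem_vectorSpan hP₂ J)

theorem IsFullDimAntiBlocking.vectorSpan_cayleyDiff {P₁ P₂ : Set (Fin n → ℝ)}
    (hP₁ : IsFullDimAntiBlocking P₁) (hP₂ : IsFullDimAntiBlocking P₂) :
    vectorSpan ℝ (cayleyDiff P₁ P₂) = ⊤ :=
  top_le_iff.1 (hP₁.vectorSpan_join hP₂ ∅ ▸ vectorSpan_mono ℝ
    (cayleyDiff_mono (coordFace_subset _ _) (coordFace_subset _ _)))

/-! ### Gluing two subdivisions -/

theorem IsSubdivision.subset {E : Type*} [AddCommGroup E] [Module ℝ E] [TopologicalSpace E]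
    {P : Set E} {S : Set (Set E)} (hS : IsSubdivision P S) {T : Set E} (hT : T ∈ S) : T ⊆ P :=
  hS.cover ▸ Set.subset_sUnion_of_mem hT

theorem IsSubdivision.isExposed_inter {E : Type*} [AddCommGroup E] [Module ℝ E]
    [TopologicalSpace E] {P : Set E} {S : Set (Set E)} (hS : IsSubdivision P S) {T T' : Set E}
    (hT : T ∈ S) (hT' : T' ∈ S) : IsExposed ℝ T (T ∩ T') := by
  by_cases h : T = T'
  · subst h
    rw [Set.inter_self]
  · exact hS.face_left T hT T' hT' h

theorem joinPair_inter_coordFace {P₁ P₂ : Set (Fin n → ℝ)} (h₁ : ∀ x ∈ P₁, 0 ≤ x)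
    (h₂ : ∀ x ∈ P₂, 0 ≤ x) (J : Finset (Fin n)) (T₁ T₂ : Set (Fin n → ℝ)) :
    JoinPair J (T₁ ∩ coordFace P₁ J) (T₂ ∩ coordFace P₂ Jᶜ) :=
  ⟨fun x hx => h₁ x hx.2.1, fun x hx => h₂ x hx.2.1, fun x hx => hx.2.2,
    fun x hx j hj => hx.2.2 j (by simpa using hj)⟩

theorem IsSubdivision.isExposed_inter_restrict {P : Set (Fin n → ℝ)} {S : Set (Set (Fin n → ℝ))}
    (hS : IsSubdivision P S) (hP : ∀ x ∈ P, 0 ≤ x) {T T' : Set (Fin n → ℝ)}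
    (hT : T ∈ S) (hT' : T' ∈ S) (J K : Finset (Fin n)) :
    IsExposed ℝ (T ∩ coordFace P J) ((T ∩ coordFace P J) ∩ (T' ∩ coordFace P K)) := by
  have h1 := (hS.isExposed_inter hT hT').inter_of_subset
    (Set.inter_subset_left : T ∩ coordFace P J ⊆ T)
  have h2 := isExposed_inter_coordFace K hP
    (Set.inter_subset_right.trans (coordFace_subset P J) : T ∩ coordFace P J ⊆ P)
  have e : (T ∩ coordFace P J) ∩ (T' ∩ coordFace P K) =
      (T ∩ coordFace P J ∩ (T ∩ T')) ∩ (T ∩ coordFace P J ∩ coordFace P K) := by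
    ext x
    simp only [Set.mem_inter_iff]
    tauto
  rw [e]
  exact h1.inter h2

theorem IsSubdivision.nonempty_of_nonempty {P : Set (Fin n → ℝ)} {S : Set (Set (Fin n → ℝ))}
    (hS : IsSubdivision P S) (h : P.Nonempty) : S.Nonempty := by
  obtain ⟨x, hx⟩ := h
  rw [← hS.cover] at hx
  obtain ⟨T, hT, -⟩ := hx
  exact ⟨T, hT⟩

/-- The intersection is the join of intersections, which are faces of the factors. No dimension is
assumed, so lower-dimensional and empty members are included. -/
theorem isExposed_inter_joinCells {P₁ P₂ : Set (Fin n → ℝ)} {S₁ S₂ : Set (Set (Fin n → ℝ))}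
    (hP₁ : IsFullDimAntiBlocking P₁) (hP₂ : IsFullDimAntiBlocking P₂)
    (hS₁ : IsSubdivision P₁ S₁) (hS₂ : IsSubdivision P₂ S₂) {Q R : Set ((Fin n → ℝ) × ℝ)}
    (hQ : Q ∈ joinCells P₁ P₂ S₁ S₂) (hR : R ∈ joinCells P₁ P₂ S₁ S₂) :
    IsExposed ℝ Q (Q ∩ R) := by
  obtain ⟨J, _, ⟨T₁, hT₁, rfl⟩, _, ⟨T₂, hT₂, rfl⟩, rfl⟩ := hQ
  obtain ⟨K, _, ⟨U₁, hU₁, rfl⟩, _, ⟨U₂, hU₂, rfl⟩, rfl⟩ := hR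
  have hJ := joinPair_inter_coordFace hP₁.nonneg hP₂.nonneg J T₁ T₂
  have hK := joinPair_inter_coordFace hP₁.nonneg hP₂.nonneg K U₁ U₂
  rw [hJ.cayleyDiff_inter hK
    ((hS₁.isPolytope _ hT₁).convex.inter (convex_coordFace hP₁.convex _))
    ((hS₂.isPolytope _ hT₂).convex.inter (convex_coordFace hP₂.convex _))
    ((hS₁.isPolytope _ hU₁).convex.inter (convex_coordFace hP₁.convex _))
    ((hS₂.isPolytope _ hU₂).convex.inter (convex_coordFace hP₂.convex _))]
  exact hJ.isExposed (hS₁.isExposed_inter_restrict hP₁.nonneg hT₁ hU₁ J K)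
    (hS₂.isExposed_inter_restrict hP₂.nonneg hT₂ hU₂ Jᶜ Kᶜ)

theorem joinCells_finite {P₁ P₂ : Set (Fin n → ℝ)} {S₁ S₂ : Set (Set (Fin n → ℝ))}
    (hS₁ : S₁.Finite) (hS₂ : S₂.Finite) : (joinCells P₁ P₂ S₁ S₂).Finite := by
  refine ((Set.finite_univ (α := Finset (Fin n))).prod (hS₁.prod hS₂)).image
    (fun p => cayleyDiff (p.2.1 ∩ coordFace P₁ p.1) (p.2.2 ∩ coordFace P₂ p.1ᶜ)) |>.subset ?_
  rintro _ ⟨J, _, ⟨T₁, hT₁, rfl⟩, _, ⟨T₂, hT₂, rfl⟩, rfl⟩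
  exact ⟨(J, T₁, T₂), ⟨trivial, hT₁, hT₂⟩, rfl⟩

theorem joinCells_subset {P₁ P₂ : Set (Fin n → ℝ)} {S₁ S₂ : Set (Set (Fin n → ℝ))}
    {Q : Set ((Fin n → ℝ) × ℝ)} (hQ : Q ∈ joinCells P₁ P₂ S₁ S₂) : Q ⊆ cayleyDiff P₁ P₂ := by
  obtain ⟨J, _, ⟨T₁, -, rfl⟩, _, ⟨T₂, -, rfl⟩, rfl⟩ := hQ
  exact cayleyDiff_mono (Set.inter_subset_right.trans (coordFace_subset _ _))
    (Set.inter_subset_right.trans (coordFace_subset _ _))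

/-- A join with an empty summand is not full-dimensional. -/
theorem nonempty_of_vectorSpan_cayleyDiff {F₁ F₂ : Set (Fin n → ℝ)}
    (h : vectorSpan ℝ (cayleyDiff F₁ F₂) = ⊤) : F₁.Nonempty ∧ F₂.Nonempty := by
  have key : ∀ c : ℝ, ¬ ∀ z ∈ (F₁ ×ˢ {(1 : ℝ)}) ∪ ((-F₂) ×ˢ {(-1 : ℝ)}), z.2 = c := by
    intro c hc
    rw [vectorSpan_cayleyDiff_eq] at h
    have := linearMap_eq_zero_of_const h (LinearMap.snd ℝ (Fin n → ℝ) ℝ) c hc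
    have := LinearMap.congr_fun this (0, 1)
    simp at this
  constructor
  · by_contra hne
    rw [Set.not_nonempty_iff_eq_empty] at hne
    subst hne
    exact key (-1) fun z hz => by simpa using And.right (by simpa using hz)
  · by_contra hne
    rw [Set.not_nonempty_iff_eq_empty] at hne
    subst hne
    exact key 1 fun z hz => by simpa using And.right (by simpa using hz)

theorem IsFullDimAntiBlocking.isPolytope_cayleyDiff_of_mem {P₁ P₂ : Set (Fin n → ℝ)}
    {S₁ S₂ : Set (Set (Fin n → ℝ))}
    (hP₁ : IsFullDimAntiBlocking P₁) (hP₂ : IsFullDimAntiBlocking P₂)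
    (hS₁ : IsSubdivision P₁ S₁) (hS₂ : IsSubdivision P₂ S₂) {Q : Set ((Fin n → ℝ) × ℝ)}
    (hQ : Q ∈ joinCells P₁ P₂ S₁ S₂) (hne : Q.Nonempty) : IsPolytope Q := by
  obtain ⟨J, _, ⟨T₁, hT₁, rfl⟩, _, ⟨T₂, hT₂, rfl⟩, rfl⟩ := hQ
  obtain ⟨s₁, hs₁, -, rfl⟩ := hS₁.isPolytope _ hT₁
  obtain ⟨s₂, hs₂, -, rfl⟩ := hS₂.isPolytope _ hT₂
  rw [convexHull_inter_coordFace J hP₁.nonneg (hS₁.subset hT₁),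
    convexHull_inter_coordFace Jᶜ hP₂.nonneg (hS₂.subset hT₂), cayleyDiff_convexHull] at hne ⊢
  exact ⟨_, ((hs₁.subset fun x hx => hx.1).prod (Set.finite_singleton _)).union
    ((hs₂.subset fun x hx => hx.1).neg.prod (Set.finite_singleton _)),
    convexHull_nonempty_iff.1 hne, rfl⟩

theorem IsSubdivision.exists_scaledMem {P : Set (Fin n → ℝ)} {S : Set (Set (Fin n → ℝ))}
    (hS : IsSubdivision P S) (hne : P.Nonempty) {a : ℝ} {u : Fin n → ℝ} (hu : ScaledMem a P u)
    {J : Finset (Fin n)} (hJ : ∀ j, j ∉ J → u j = 0) :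
    ∃ T ∈ S, ScaledMem a (T ∩ coordFace P J) u := by
  rcases hu with hu | ⟨ha, f, hf, rfl⟩
  · obtain ⟨T, hT⟩ := hS.nonempty_of_nonempty hne
    exact ⟨T, hT, Or.inl hu⟩
  · have hf' := hf
    rw [← hS.cover] at hf'
    obtain ⟨T, hT, hfT⟩ := hf'
    refine ⟨T, hT, Or.inr ⟨ha, f, ⟨hfT, hf, fun j hj => ?_⟩, rfl⟩⟩
    have := hJ j hj
    simpa [ha.ne'] using this

theorem cayleyDiff_subset_sUnion_joinCells {P₁ P₂ : Set (Fin n → ℝ)}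
    {S₁ S₂ : Set (Set (Fin n → ℝ))}
    (hP₁ : IsFullDimAntiBlocking P₁) (hP₂ : IsFullDimAntiBlocking P₂)
    (hS₁ : IsSubdivision P₁ S₁) (hS₂ : IsSubdivision P₂ S₂) :
    cayleyDiff P₁ P₂ ⊆ ⋃₀ joinCells P₁ P₂ S₁ S₂ := by
  intro z hz
  obtain ⟨h1, h2⟩ := (hP₁.mem_cayleyDiff hP₂).1 hz
  classical
  -- The positive part is supported on this set and the negative part off it; coordinates equal to
  -- zero fit on either side.
  let J : Finset (Fin n) := Finset.univ.filter fun j => 0 < z.1 j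
  obtain ⟨T₁, hT₁, hz₁⟩ := hS₁.exists_scaledMem hP₁.isPolytope.nonempty h1 (J := J) fun j hj => by
    rw [Pi.posPart_apply]
    exact posPart_of_nonpos (by simpa [J] using hj)
  obtain ⟨T₂, hT₂, hz₂⟩ := hS₂.exists_scaledMem hP₂.isPolytope.nonempty h2 (J := Jᶜ) fun j hj => by
    rw [Pi.negPart_apply]
    have : 0 < z.1 j := by simpa [J] using hj
    exact negPart_of_nonneg this.le
  exact ⟨_, ⟨J, _, ⟨T₁, hT₁, rfl⟩, _, ⟨T₂, hT₂, rfl⟩, rfl⟩, mem_cayleyDiff_of_parts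
    ((hS₁.isPolytope _ hT₁).convex.inter (convex_coordFace hP₁.convex _))
    ((hS₂.isPolytope _ hT₂).convex.inter (convex_coordFace hP₂.convex _)) hz₁ hz₂⟩

theorem mem_gluedCells {P₁ P₂ : Set (Fin n → ℝ)} {S₁ S₂ : Set (Set (Fin n → ℝ))}
    {Q : Set ((Fin n → ℝ) × ℝ)} :
    Q ∈ gluedCells P₁ P₂ S₁ S₂ ↔ Q ∈ joinCells P₁ P₂ S₁ S₂ ∧ vectorSpan ℝ Q = ⊤ := by
  rw [← polyDim_eq_succ_iff]
  rfl

theorem cayleyDiff_subset_sUnion_gluedCells {P₁ P₂ : Set (Fin n → ℝ)}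
    {S₁ S₂ : Set (Set (Fin n → ℝ))}
    (hP₁ : IsFullDimAntiBlocking P₁) (hP₂ : IsFullDimAntiBlocking P₂)
    (hS₁ : IsSubdivision P₁ S₁) (hS₂ : IsSubdivision P₂ S₂) :
    cayleyDiff P₁ P₂ ⊆ ⋃₀ gluedCells P₁ P₂ S₁ S₂ := by
  have hne : (cayleyDiff P₁ P₂).Nonempty :=
    (cayleyDiff_isPolytope hP₁.isPolytope hP₂.isPolytope).nonempty
  have h := subset_sUnion_fullDim (convex_cayleyDiff P₁ P₂)
    (interior_nonempty_of_vectorSpan_eq_top (convex_cayleyDiff P₁ P₂) hne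
      (hP₁.vectorSpan_cayleyDiff hP₂))
    (joinCells_finite hS₁.finite hS₂.finite)
    (fun Q hQ => ?_) (cayleyDiff_subset_sUnion_joinCells hP₁ hP₂ hS₁ hS₂)
  · convert h using 2
    ext Q
    exact mem_gluedCells
  · rcases Q.eq_empty_or_nonempty with rfl | hQne
    · exact isClosed_empty
    · exact (hP₁.isPolytope_cayleyDiff_of_mem hP₂ hS₁ hS₂ hQ hQne).isCompact.isClosed

theorem isSubdivision_gluedCells {P₁ P₂ : Set (Fin n → ℝ)}
    {S₁ S₂ : Set (Set (Fin n → ℝ))}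
    (hP₁ : IsFullDimAntiBlocking P₁) (hP₂ : IsFullDimAntiBlocking P₂)
    (hS₁ : IsSubdivision P₁ S₁) (hS₂ : IsSubdivision P₂ S₂) :
    IsSubdivision (cayleyDiff P₁ P₂) (gluedCells P₁ P₂ S₁ S₂) where
  finite := (joinCells_finite hS₁.finite hS₂.finite).subset fun Q hQ => hQ.1
  isPolytope Q hQ := by
    have hQ' := hQ
    obtain ⟨⟨J, F₁, -, F₂, -, rfl⟩, hdim⟩ := mem_gluedCells.1 hQ'
    obtain ⟨⟨x, hx⟩, -⟩ := nonempty_of_vectorSpan_cayleyDiff hdim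
    exact hP₁.isPolytope_cayleyDiff_of_mem hP₂ hS₁ hS₂ hQ.1
      ⟨_, subset_convexHull ℝ _ (mk_one_mem_generators F₂ hx)⟩
  dim_eq Q hQ := hQ.2.trans ((polyDim_eq_succ_iff _).2 (hP₁.vectorSpan_cayleyDiff hP₂)).symm
  cover := (Set.sUnion_subset fun Q hQ => joinCells_subset hQ.1).antisymm
    (cayleyDiff_subset_sUnion_gluedCells hP₁ hP₂ hS₁ hS₂)
  face_left Q hQ R hR _ := isExposed_inter_joinCells hP₁ hP₂ hS₁ hS₂ hQ.1 hR.1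
  face_right Q hQ R hR _ := by
    rw [Set.inter_comm]
    exact isExposed_inter_joinCells hP₁ hP₂ hS₁ hS₂ hR.1 hQ.1

/-- Choose a point of `F` in no proper exposed face. A glued cell containing it meets `F` in an
exposed face of `F`, hence contains `F`; then `F` is its own intersection with that cell, and so a
face of it. -/
theorem exists_gluedCells_isExposed {P₁ P₂ : Set (Fin n → ℝ)} {S₁ S₂ : Set (Set (Fin n → ℝ))}
    (hP₁ : IsFullDimAntiBlocking P₁) (hP₂ : IsFullDimAntiBlocking P₂)
    (hS₁ : IsSubdivision P₁ S₁) (hS₂ : IsSubdivision P₂ S₂) {F : Set ((Fin n → ℝ) × ℝ)}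
    (hF : F ∈ joinCells P₁ P₂ S₁ S₂) :
    ∃ Q ∈ gluedCells P₁ P₂ S₁ S₂, IsExposed ℝ Q F := by
  have hcov := cayleyDiff_subset_sUnion_gluedCells hP₁ hP₂ hS₁ hS₂
  rcases F.eq_empty_or_nonempty with rfl | hne
  · obtain ⟨z, hz⟩ := (cayleyDiff_isPolytope hP₁.isPolytope hP₂.isPolytope).nonempty
    obtain ⟨Q, hQ, -⟩ := hcov hz
    exact ⟨Q, hQ, isExposed_empty⟩
  · obtain ⟨z, hz, hface⟩ :=
      (hP₁.isPolytope_cayleyDiff_of_mem hP₂ hS₁ hS₂ hF hne).exists_mem_of_face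
    obtain ⟨Q, hQ, hzQ⟩ := hcov (joinCells_subset hF hz)
    have h1 := hface _ (isExposed_inter_joinCells hP₁ hP₂ hS₁ hS₂ hF hQ.1) ⟨hz, hzQ⟩
    have h2 := isExposed_inter_joinCells hP₁ hP₂ hS₁ hS₂ hQ.1 hF
    rw [Set.inter_eq_right.2 (h1.trans Set.inter_subset_right)] at h2
    exact ⟨Q, hQ, h2⟩

/-! ### Regularity of the glued subdivision -/

section Regular

variable {E : Type*} [NormedAddCommGroup E] [NormedSpace ℝ E]

/-- Subtracting the two minimality conditions at a generator cancels `ω`. What is left is a linear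
inequality, which passes to the convex hull. -/
theorem sub_le_of_mem_lowerCell {A : Set E} {ω : E → ℝ} {c c' : E →ₗ[ℝ] ℝ} {a₀ a₁ x : E}
    (ha₀ : a₀ ∈ A) (ha₁ : ∀ b ∈ A, ω a₁ + c' a₁ ≤ ω b + c' b) (hx : x ∈ lowerCell A ω c) :
    (c - c') x ≤ (ω a₀ + c a₀) - (ω a₁ + c' a₁) := by
  refine convexHull_min (t := {x | (c - c') x ≤ (ω a₀ + c a₀) - (ω a₁ + c' a₁)}) ?_
    (convex_halfSpace_le (c - c').isLinear _) hx
  rintro a ⟨haA, ha⟩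
  have h1 := ha a₀ ha₀
  have h2 := ha₁ a haA
  simp only [Set.mem_ofPred_eq, LinearMap.sub_apply]
  linarith

/-- Lower cells of the same weight that overlap in a full-dimensional set agree. -/
theorem lowerCell_eq_of_vectorSpan_inter {A : Set E} {ω : E → ℝ} {c c' : E →ₗ[ℝ] ℝ}
    (hne : (lowerCell A ω c ∩ lowerCell A ω c').Nonempty)
    (h : vectorSpan ℝ (lowerCell A ω c ∩ lowerCell A ω c') = ⊤) :
    lowerCell A ω c = lowerCell A ω c' := by
  obtain ⟨x, hx, hx'⟩ := hne
  obtain ⟨a₀, h0A, h0⟩ := convexHull_nonempty_iff.1 ⟨x, hx⟩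
  obtain ⟨a₁, h1A, h1⟩ := convexHull_nonempty_iff.1 ⟨x, hx'⟩
  -- The bound, applied in both directions, makes `c - c'` constant on the overlap.
  have key := linearMap_eq_zero_of_const h (c - c') ((ω a₀ + c a₀) - (ω a₁ + c' a₁)) fun y hy => by
    have k1 := sub_le_of_mem_lowerCell h0A h1 hy.1
    have k2 := sub_le_of_mem_lowerCell h1A h0 hy.2
    simp only [LinearMap.sub_apply] at k1 k2 ⊢
    linarith
  rw [sub_eq_zero.1 key]

theorem lowerCell_nonempty {A : Set E} (hA : A.Finite) (hne : A.Nonempty) (ω : E → ℝ)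
    (c : E →ₗ[ℝ] ℝ) : (lowerCell A ω c).Nonempty := by
  obtain ⟨a, ha, h⟩ := Set.exists_min_image A (fun a => ω a + c a) hA hne
  exact ⟨a, subset_convexHull ℝ _ ⟨ha, h⟩⟩

/-- Full-dimensional lower cells that cover are all of the full-dimensional lower cells. -/
theorem isRegularSubdivision_of_cover [FiniteDimensional ℝ E] {A : Set E} (hA : A.Finite)
    (hne : A.Nonempty) (hdim : vectorSpan ℝ (convexHull ℝ A) = ⊤) {S : Set (Set E)} (hS : S.Finite)
    (hcov : convexHull ℝ A ⊆ ⋃₀ S) (ω : E → ℝ)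
    (h : ∀ Q ∈ S, vectorSpan ℝ Q = ⊤ ∧ ∃ c : E →ₗ[ℝ] ℝ, Q = lowerCell A ω c) :
    IsRegularSubdivision A S := by
  have hd : ∀ Q : Set E, polyDim Q = polyDim (convexHull ℝ A) ↔ vectorSpan ℝ Q = ⊤ := fun Q => by
    rw [(vectorSpan_eq_top_iff_polyDim _).1 hdim, vectorSpan_eq_top_iff_polyDim]
  refine ⟨ω, Set.Subset.antisymm (fun Q hQ => ⟨(hd Q).2 (h Q hQ).1, (h Q hQ).2⟩) ?_⟩
  rintro Q ⟨hQ, c, rfl⟩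
  rw [hd] at hQ
  obtain ⟨R, hR, hne', hspan⟩ := exists_vectorSpan_inter_eq_top
    (interior_nonempty_of_vectorSpan_eq_top (convex_lowerCell A ω c)
      (lowerCell_nonempty hA hne ω c) hQ) hS ((lowerCell_subset A ω c).trans hcov)
  obtain ⟨-, c', rfl⟩ := h R hR
  rwa [lowerCell_eq_of_vectorSpan_inter hne' hspan]

theorem setOf_minimal_eq {α : Type*} {A : Set α} {f : α → ℝ} {m : ℝ} (hm : ∀ a ∈ A, m ≤ f a)
    {a₀ : α} (ha₀ : a₀ ∈ A) (h : f a₀ = m) :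
    {a | a ∈ A ∧ ∀ b ∈ A, f a ≤ f b} = {a | a ∈ A ∧ f a = m} := by
  ext a
  refine and_congr_right fun ha => ⟨fun h' => le_antisymm (h ▸ h' a₀ ha₀) (hm a ha), fun h' b hb => ?_⟩
  rw [h']
  exact hm b hb

end Regular

/-- The sum of the coordinates. -/
noncomputable def coordSum (n : ℕ) : (Fin n → ℝ) →ₗ[ℝ] ℝ := ∑ j, LinearMap.proj j

theorem coordSum_single (j : Fin n) (ε : ℝ) : coordSum n (Pi.single j ε) = ε := by
  simp [coordSum]

theorem linearMap_apply_eq_sum (l : (Fin n → ℝ) →ₗ[ℝ] ℝ) (x : Fin n → ℝ) :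
    l x = ∑ j, x j * l (Pi.single j 1) := by
  conv_lhs => rw [← Finset.univ_sum_single x]
  rw [map_sum]
  refine Finset.sum_congr rfl fun j _ => ?_
  rw [← smul_eq_mul, ← map_smul, ← Pi.single_smul, smul_eq_mul, mul_one]

theorem linearMap_nonneg {l : (Fin n → ℝ) →ₗ[ℝ] ℝ} (hl : ∀ j, 0 < l (Pi.single j 1))
    {x : Fin n → ℝ} (hx : 0 ≤ x) : 0 ≤ l x := by
  rw [linearMap_apply_eq_sum]
  exact Finset.sum_nonneg fun j _ => mul_nonneg (hx j) (hl j).le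

theorem linearMap_eq_zero_iff {l : (Fin n → ℝ) →ₗ[ℝ] ℝ} (hl : ∀ j, 0 < l (Pi.single j 1))
    {x : Fin n → ℝ} (hx : 0 ≤ x) : l x = 0 ↔ x = 0 := by
  rw [linearMap_apply_eq_sum,
    Finset.sum_eq_zero_iff_of_nonneg fun j _ => mul_nonneg (hx j) (hl j).le]
  simp only [Finset.mem_univ, true_imp_iff, mul_eq_zero, (hl _).ne', or_false]
  exact funext_iff.symm

theorem coordProj_nonneg (J : Finset (Fin n)) {x : Fin n → ℝ} (hx : 0 ≤ x) :
    0 ≤ coordProj J x := fun j => by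
  rw [coordProj_apply]
  split_ifs
  exacts [hx j, le_rfl]

theorem coordProj_eq_zero_iff {J : Finset (Fin n)} {x : Fin n → ℝ} :
    coordProj J x = 0 ↔ ∀ j, j ∈ J → x j = 0 := by
  refine ⟨fun h j hj => ?_, coordProj_eq_zero⟩
  have := congrFun h j
  rwa [coordProj_apply, if_pos hj] at this

/-- The weight on the Cayley sum that glues two weights. -/
noncomputable def gluedWeight (M : ℝ) (ω₁ ω₂ : (Fin n → ℝ) → ℝ) (z : (Fin n → ℝ) × ℝ) : ℝ :=
  open Classical in
  if z.2 = 1 then M * coordSum n z.1 + ω₁ z.1 else M * coordSum n (-z.1) + ω₂ (-z.1)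

/-- The join of coordinate faces of lower cells is a lower cell for the glued weight. -/
theorem exists_cayleyDiff_eq_lowerCell {P₁ P₂ A₁ A₂ : Set (Fin n → ℝ)}
    (hP₁ : ∀ x ∈ P₁, 0 ≤ x) (hP₂ : ∀ x ∈ P₂, 0 ≤ x) (hA₁ : convexHull ℝ A₁ = P₁)
    (hA₂ : convexHull ℝ A₂ = P₂) (ω₁ ω₂ : (Fin n → ℝ) → ℝ) (c₁ c₂ : (Fin n → ℝ) →ₗ[ℝ] ℝ) {M : ℝ}
    (h₁ : ∀ j, c₁ (Pi.single j 1) < M) (h₂ : ∀ j, c₂ (Pi.single j 1) < M) (J : Finset (Fin n))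
    (hne₁ : (lowerCell A₁ ω₁ c₁ ∩ coordFace P₁ J).Nonempty)
    (hne₂ : (lowerCell A₂ ω₂ c₂ ∩ coordFace P₂ Jᶜ).Nonempty) :
    ∃ c : ((Fin n → ℝ) × ℝ) →ₗ[ℝ] ℝ,
      cayleyDiff (lowerCell A₁ ω₁ c₁ ∩ coordFace P₁ J) (lowerCell A₂ ω₂ c₂ ∩ coordFace P₂ Jᶜ) =
        lowerCell ((A₁ ×ˢ {(1 : ℝ)}) ∪ ((-A₂) ×ˢ {(-1 : ℝ)})) (gluedWeight M ω₁ ω₂) c := by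
  have hA₁0 : ∀ a ∈ A₁, 0 ≤ a := fun a ha => hP₁ a (hA₁ ▸ subset_convexHull ℝ A₁ ha)
  have hA₂0 : ∀ a ∈ A₂, 0 ≤ a := fun a ha => hP₂ a (hA₂ ▸ subset_convexHull ℝ A₂ ha)
  have e₁ : lowerCell A₁ ω₁ c₁ ∩ coordFace P₁ J = _ :=
    convexHull_inter_coordFace J hP₁ (hA₁ ▸ lowerCell_subset A₁ ω₁ c₁)
  have e₂ : lowerCell A₂ ω₂ c₂ ∩ coordFace P₂ Jᶜ = _ :=
    convexHull_inter_coordFace Jᶜ hP₂ (hA₂ ▸ lowerCell_subset A₂ ω₂ c₂)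
  rw [e₁] at hne₁
  rw [e₂] at hne₂
  obtain ⟨a₀, ⟨ha₀, hamin⟩, ha₀J⟩ := convexHull_nonempty_iff.1 hne₁
  obtain ⟨b₀, ⟨hb₀, hbmin⟩, hb₀J⟩ := convexHull_nonempty_iff.1 hne₂
  set m₁ := ω₁ a₀ + c₁ a₀ with hm₁
  set m₂ := ω₂ b₀ + c₂ b₀ with hm₂
  -- The price of coordinates on the wrong side: outside `J` for the first factor, inside `J` for
  -- the second. The bounds on `M` make it positive on every unit vector.
  let D : (Fin n → ℝ) →ₗ[ℝ] ℝ := (2 * M) • coordSum n - c₁ - c₂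
  have hD : ∀ j, 0 < D (Pi.single j 1) := by
    intro j
    simp only [D, LinearMap.sub_apply, LinearMap.smul_apply, coordSum_single, smul_eq_mul]
    linarith [h₁ j, h₂ j]
  let π (K : Finset (Fin n)) : (Fin n → ℝ) →ₗ[ℝ] (Fin n → ℝ) := coordProj K
  -- On each factor's own coordinates the added multiple of `coordSum` is removed again; on the
  -- others it is doubled. The last slope brings both minima to `(m₁ + m₂) / 2`.
  let c : ((Fin n → ℝ) × ℝ) →ₗ[ℝ] ℝ :=
    ((c₁ - M • coordSum n) ∘ₗ π J - (c₂ - M • coordSum n) ∘ₗ π Jᶜ) ∘ₗ LinearMap.fst ℝ _ ℝ +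
      ((m₂ - m₁) / 2) • LinearMap.snd ℝ _ ℝ
  have hsplit : ∀ (l : (Fin n → ℝ) →ₗ[ℝ] ℝ) x, l x = l (coordProj J x) + l (coordProj Jᶜ x) := by
    intro l x
    rw [← map_add, coordProj_add_compl]
  have v₁ : ∀ a, gluedWeight M ω₁ ω₂ (a, 1) + c (a, 1) =
      ω₁ a + c₁ a + D (coordProj Jᶜ a) + (m₂ - m₁) / 2 := by
    intro a
    have s1 := hsplit c₁ a
    have s2 := hsplit (coordSum n) a
    simp only [gluedWeight, c, D, π, LinearMap.add_apply, LinearMap.sub_apply, LinearMap.comp_apply,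
      LinearMap.smul_apply, LinearMap.fst_apply, LinearMap.snd_apply, smul_eq_mul, if_true,
      ContinuousLinearMap.coe_coe]
    rw [s1, s2]
    ring
  have v₂ : ∀ b, gluedWeight M ω₁ ω₂ (-b, -1) + c (-b, -1) =
      ω₂ b + c₂ b + D (coordProj J b) - (m₂ - m₁) / 2 := by
    intro b
    have s1 := hsplit c₂ b
    have s2 := hsplit (coordSum n) b
    have hn : ¬ ((-1 : ℝ) = 1) := by norm_num
    simp only [gluedWeight, c, D, π, LinearMap.add_apply, LinearMap.sub_apply, LinearMap.comp_apply,
      LinearMap.smul_apply, LinearMap.fst_apply, LinearMap.snd_apply, smul_eq_mul, if_neg hn,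
      ContinuousLinearMap.coe_coe, map_neg, neg_neg]
    rw [s1, s2]
    ring
  have w₁ : ∀ a ∈ A₁, 0 ≤ D (coordProj Jᶜ a) := fun a ha =>
    linearMap_nonneg hD (coordProj_nonneg _ (hA₁0 a ha))
  have w₂ : ∀ b ∈ A₂, 0 ≤ D (coordProj J b) := fun b hb =>
    linearMap_nonneg hD (coordProj_nonneg _ (hA₂0 b hb))
  have z₁ : ∀ a ∈ A₁, D (coordProj Jᶜ a) = 0 ↔ ∀ j, j ∉ J → a j = 0 := fun a ha => by
    rw [linearMap_eq_zero_iff hD (coordProj_nonneg _ (hA₁0 a ha)), coordProj_eq_zero_iff]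
    simp
  have z₂ : ∀ b ∈ A₂, D (coordProj J b) = 0 ↔ ∀ j, j ∉ Jᶜ → b j = 0 := fun b hb => by
    rw [linearMap_eq_zero_iff hD (coordProj_nonneg _ (hA₂0 b hb)), coordProj_eq_zero_iff]
    simp
  refine ⟨c, ?_⟩
  rw [e₁, e₂, cayleyDiff_convexHull, lowerCell]
  congr 1
  rw [setOf_minimal_eq (f := fun z => gluedWeight M ω₁ ω₂ z + c z) (m := (m₁ + m₂) / 2)
    (a₀ := (a₀, 1)) ?_ (mk_one_mem_generators A₂ ha₀) ?_]
  · ext ⟨x, t⟩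
    simp only [Set.mem_union, Set.mem_prod, Set.mem_singleton_iff, Set.mem_neg, Set.mem_ofPred_eq]
    constructor
    · rintro (⟨⟨⟨hx, hmin⟩, hJ⟩, rfl⟩ | ⟨⟨⟨hx, hmin⟩, hJ⟩, rfl⟩)
      · refine ⟨Or.inl ⟨hx, rfl⟩, ?_⟩
        rw [v₁, (z₁ x hx).2 hJ]
        linarith [hmin a₀ ha₀, hamin x hx]
      · refine ⟨Or.inr ⟨hx, rfl⟩, ?_⟩
        have := v₂ (-x)
        rw [neg_neg] at this
        rw [this, (z₂ _ hx).2 hJ]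
        linarith [hmin b₀ hb₀, hbmin _ hx]
    · rintro ⟨⟨hx, rfl⟩ | ⟨hx, rfl⟩, he⟩
      · rw [v₁] at he
        have k1 := hamin x hx
        have k2 := w₁ x hx
        refine Or.inl ⟨⟨⟨hx, fun b hb => ?_⟩, (z₁ x hx).1 (by linarith)⟩, rfl⟩
        linarith [hamin b hb]
      · have := v₂ (-x)
        rw [neg_neg] at this
        rw [this] at he
        have k1 := hbmin _ hx
        have k2 := w₂ _ hx
        refine Or.inr ⟨⟨⟨hx, fun b hb => ?_⟩, (z₂ _ hx).1 (by linarith)⟩, rfl⟩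
        linarith [hbmin b hb]
  · rintro ⟨x, t⟩ (⟨hx, ht⟩ | ⟨hx, ht⟩)
    · obtain rfl : t = 1 := ht
      rw [v₁]
      linarith [hamin x hx, w₁ x hx]
    · obtain rfl : t = -1 := ht
      have := v₂ (-x)
      rw [neg_neg] at this
      rw [this]
      linarith [hbmin _ hx, w₂ _ hx]
  · rw [v₁, (z₁ a₀ ha₀).2 ha₀J]
    linarith

/-- A single weight must serve all cells, so one `M` has to exceed the coefficients of all the
linear forms that select them. -/
theorem exists_forall_single_lt {S : Set (Set (Fin n → ℝ))} (hS : S.Finite)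
    (c : Set (Fin n → ℝ) → ((Fin n → ℝ) →ₗ[ℝ] ℝ)) :
    ∃ B : ℝ, ∀ T ∈ S, ∀ j, c T (Pi.single j 1) < B := by
  obtain ⟨B, hB⟩ := ((hS.prod (Set.finite_univ (α := Fin n))).image
    fun p => c p.1 (Pi.single p.2 1)).bddAbove
  refine ⟨B + 1, fun T hT j => ?_⟩
  have : c T (Pi.single j 1) ≤ B := hB ⟨(T, j), ⟨hT, trivial⟩, rfl⟩
  linarith

theorem isRegularSubdivision_gluedCells {P₁ P₂ A₁ A₂ : Set (Fin n → ℝ)}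
    {S₁ S₂ : Set (Set (Fin n → ℝ))}
    (hP₁ : IsFullDimAntiBlocking P₁) (hP₂ : IsFullDimAntiBlocking P₂)
    (hS₁ : IsSubdivision P₁ S₁) (hS₂ : IsSubdivision P₂ S₂)
    (hf₁ : A₁.Finite) (hf₂ : A₂.Finite) (hA₁ : convexHull ℝ A₁ = P₁) (hA₂ : convexHull ℝ A₂ = P₂)
    (hr₁ : IsRegularSubdivision A₁ S₁) (hr₂ : IsRegularSubdivision A₂ S₂) :
    IsRegularSubdivision ((A₁ ×ˢ {(1 : ℝ)}) ∪ ((-A₂) ×ˢ {(-1 : ℝ)}))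
      (gluedCells P₁ P₂ S₁ S₂) := by
  obtain ⟨ω₁, hω₁⟩ := hr₁
  obtain ⟨ω₂, hω₂⟩ := hr₂
  have k₁ : ∀ T ∈ S₁, ∃ c : (Fin n → ℝ) →ₗ[ℝ] ℝ, T = lowerCell A₁ ω₁ c := fun T hT => by
    rw [hω₁] at hT
    exact hT.2
  have k₂ : ∀ T ∈ S₂, ∃ c : (Fin n → ℝ) →ₗ[ℝ] ℝ, T = lowerCell A₂ ω₂ c := fun T hT => by
    rw [hω₂] at hT
    exact hT.2
  choose! c₁ hc₁ using k₁
  choose! c₂ hc₂ using k₂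
  obtain ⟨B₁, hB₁⟩ := exists_forall_single_lt hS₁.finite c₁
  obtain ⟨B₂, hB₂⟩ := exists_forall_single_lt hS₂.finite c₂
  have hconv : convexHull ℝ ((A₁ ×ˢ {(1 : ℝ)}) ∪ ((-A₂) ×ˢ {(-1 : ℝ)})) = cayleyDiff P₁ P₂ := by
    rw [← hA₁, ← hA₂, cayleyDiff_convexHull]
  have hne : A₁.Nonempty := convexHull_nonempty_iff.1 (hA₁ ▸ hP₁.isPolytope.nonempty)
  refine isRegularSubdivision_of_cover
    ((hf₁.prod (Set.finite_singleton _)).union (hf₂.neg.prod (Set.finite_singleton _)))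
    (hne.prod (Set.singleton_nonempty _)).inl (hconv ▸ hP₁.vectorSpan_cayleyDiff hP₂)
    (isSubdivision_gluedCells hP₁ hP₂ hS₁ hS₂).finite
    (hconv ▸ cayleyDiff_subset_sUnion_gluedCells hP₁ hP₂ hS₁ hS₂)
    (gluedWeight (max B₁ B₂) ω₁ ω₂) fun Q hQ => ?_
  obtain ⟨⟨J, _, ⟨T₁, hT₁, rfl⟩, _, ⟨T₂, hT₂, rfl⟩, rfl⟩, hdim⟩ := mem_gluedCells.1 hQ
  obtain ⟨hne₁, hne₂⟩ := nonempty_of_vectorSpan_cayleyDiff hdim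
  have b₁ : ∀ j, c₁ T₁ (Pi.single j 1) < max B₁ B₂ := fun j =>
    (hB₁ T₁ hT₁ j).trans_le (le_max_left _ _)
  have b₂ : ∀ j, c₂ T₂ (Pi.single j 1) < max B₁ B₂ := fun j =>
    (hB₂ T₂ hT₂ j).trans_le (le_max_right _ _)
  refine ⟨hdim, ?_⟩
  have := exists_cayleyDiff_eq_lowerCell hP₁.nonneg hP₂.nonneg hA₁ hA₂ ω₁ ω₂ (c₁ T₁) (c₂ T₂) b₁ b₂ J
  rw [← hc₁ T₁ hT₁, ← hc₂ T₂ hT₂] at this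
  exact this hne₁ hne₂

theorem isRegularSubdivision_vertices_gluedCells {P₁ P₂ : Set (Fin n → ℝ)}
    {S₁ S₂ : Set (Set (Fin n → ℝ))}
    (hP₁ : IsFullDimAntiBlocking P₁) (hP₂ : IsFullDimAntiBlocking P₂)
    (hS₁ : IsSubdivision P₁ S₁) (hS₂ : IsSubdivision P₂ S₂)
    (hr₁ : IsRegularSubdivision (vertices P₁) S₁) (hr₂ : IsRegularSubdivision (vertices P₂) S₂) :
    IsRegularSubdivision (vertices (cayleyDiff P₁ P₂)) (gluedCells P₁ P₂ S₁ S₂) := by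
  rw [vertices_cayleyDiff hP₁.convex hP₂.convex]
  exact isRegularSubdivision_gluedCells hP₁ hP₂ hS₁ hS₂ hP₁.isPolytope.vertices_finite
    hP₂.isPolytope.vertices_finite hP₁.isPolytope.convexHull_vertices
    hP₂.isPolytope.convexHull_vertices hr₁ hr₂

/-! ### The canonical subdivision into joins and the canonical mixed subdivision -/

theorem IsPolytope.isSubdivision_singleton {E : Type*} [AddCommGroup E] [Module ℝ E]
    [TopologicalSpace E] {P : Set E} (hP : IsPolytope P) : IsSubdivision P {P} where
  finite := Set.finite_singleton P
  isPolytope := by rintro _ rfl; exact hP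
  dim_eq := by rintro _ rfl; rfl
  cover := Set.sUnion_singleton P
  face_left := by rintro _ rfl _ rfl h; exact absurd rfl h
  face_right := by rintro _ rfl _ rfl h; exact absurd rfl h

/-- Every join of coordinate faces is full-dimensional, so the dimension filter removes nothing. The
canonical joins thus become a special case of gluing. -/
theorem gluedCells_singleton {P₁ P₂ : Set (Fin n → ℝ)}
    (hP₁ : IsFullDimAntiBlocking P₁) (hP₂ : IsFullDimAntiBlocking P₂) :
    gluedCells P₁ P₂ {P₁} {P₂} =
      Set.range fun J : Finset (Fin n) => cayleyDiff (coordFace P₁ J) (coordFace P₂ Jᶜ) := by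
  have e : ∀ (P : Set (Fin n → ℝ)) J, P ∩ coordFace P J = coordFace P J := fun P J =>
    Set.inter_eq_right.2 (coordFace_subset P J)
  ext Q
  rw [mem_gluedCells]
  constructor
  · rintro ⟨⟨J, _, ⟨_, rfl, rfl⟩, _, ⟨_, rfl, rfl⟩, rfl⟩, -⟩
    exact ⟨J, by simp only [e]⟩
  · rintro ⟨J, rfl⟩
    exact ⟨⟨J, _, ⟨P₁, rfl, rfl⟩, _, ⟨P₂, rfl, rfl⟩, by simp only [e]⟩, hP₁.vectorSpan_join hP₂ J⟩

/-- For linear weights, a lower cell is the face minimizing a linear form. -/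
theorem lowerCell_linear {E : Type*} [NormedAddCommGroup E] [NormedSpace ℝ E] {P : Set E}
    (hP : IsPolytope P) (l c : E →ₗ[ℝ] ℝ) :
    lowerCell (vertices P) l c = {x | x ∈ P ∧ ∀ y ∈ P, (l + c) x ≤ (l + c) y} := by
  have hne : (vertices P).Nonempty :=
    convexHull_nonempty_iff.1 (hP.convexHull_vertices.symm ▸ hP.nonempty)
  obtain ⟨a₀, ha₀, hmin⟩ := Set.exists_min_image _ (l + c) hP.vertices_finite hne
  have hminP : ∀ x ∈ P, (l + c) a₀ ≤ (l + c) x := by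
    intro x hx
    rw [← hP.convexHull_vertices] at hx
    exact convexHull_min hmin (convex_halfSpace_ge (l + c).isLinear _) hx
  have h1 : {x | x ∈ P ∧ ∀ y ∈ P, (l + c) x ≤ (l + c) y} =
      {x | x ∈ P ∧ (l + c) x = (l + c) a₀} :=
    setOf_minimal_eq hminP (extremePoints_subset ha₀) rfl
  have h2 : {a | a ∈ vertices P ∧ ∀ b ∈ vertices P, l a + c a ≤ l b + c b} =
      {a | a ∈ vertices P ∧ l a + c a = (l + c) a₀} := setOf_minimal_eq hmin ha₀ rfl
  have h3 := convexHull_sep_eq (vertices P) (-(l + c)) (-(l + c) a₀) fun x hx =>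
    neg_le_neg (hmin x hx)
  simp only [LinearMap.neg_apply, neg_inj] at h3
  rw [hP.convexHull_vertices] at h3
  rw [lowerCell, h2, h1, h3]
  rfl

theorem IsFullDimAntiBlocking.isRegularSubdivision_singleton {P : Set (Fin n → ℝ)}
    (hP : IsFullDimAntiBlocking P) : IsRegularSubdivision (vertices P) {P} := by
  have hc := hP.isPolytope.convexHull_vertices
  refine isRegularSubdivision_of_cover hP.isPolytope.vertices_finite
    (convexHull_nonempty_iff.1 (hc.symm ▸ hP.isPolytope.nonempty)) (hc.symm ▸ hP.vectorSpan_eq_top)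
    (Set.finite_singleton P) (by rw [hc, Set.sUnion_singleton]) (0 : (Fin n → ℝ) →ₗ[ℝ] ℝ) ?_
  rintro _ rfl
  refine ⟨hP.vectorSpan_eq_top, 0, ?_⟩
  rw [lowerCell_linear hP.isPolytope]
  simp

theorem JoinPair.mem_sub {J : Finset (Fin n)} {F₁ F₂ : Set (Fin n → ℝ)} (h : JoinPair J F₁ F₂)
    {x : Fin n → ℝ} : x ∈ F₁ - F₂ ↔ x⁺ ∈ F₁ ∧ x⁻ ∈ F₂ := by
  constructor
  · rintro ⟨u, hu, v, hv, rfl⟩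
    have hp := posPart_negPart_sub (h.nonneg_left u hu) (h.nonneg_right v hv) fun j => by
      by_cases hj : j ∈ J
      · exact Or.inr (h.supp_right v hv j hj)
      · exact Or.inl (h.supp_left u hu j hj)
    rw [hp.1, hp.2]
    exact ⟨hu, hv⟩
  · rintro ⟨h1, h2⟩
    exact ⟨_, h1, _, h2, posPart_sub_negPart x⟩

/-- The combined functional takes the value `l₁ x⁺ + l₂ x⁻`, and equality in a sum of two bounds
forces equality in each. -/
theorem JoinPair.isExposed_sub {J : Finset (Fin n)} {F₁ F₂ G₁ G₂ : Set (Fin n → ℝ)}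
    (h : JoinPair J F₁ F₂) (h₁ : IsExposed ℝ F₁ G₁) (h₂ : IsExposed ℝ F₂ G₂) :
    IsExposed ℝ (F₁ - F₂) (G₁ - G₂) := by
  obtain ⟨l₁, c₁, hl₁, hG₁⟩ := h₁.exists_le
  obtain ⟨l₂, c₂, hl₂, hG₂⟩ := h₂.exists_le
  have hG : JoinPair J G₁ G₂ :=
    ⟨fun x hx => h.1 x ((hG₁ x).1 hx).1, fun x hx => h.2 x ((hG₂ x).1 hx).1,
      fun x hx => h.3 x ((hG₁ x).1 hx).1, fun x hx => h.4 x ((hG₂ x).1 hx).1⟩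
  have key : ∀ x ∈ F₁ - F₂, (l₁.comp (coordProj J) - l₂.comp (coordProj Jᶜ)) x =
      l₁ x⁺ + l₂ x⁻ := by
    intro x hx
    obtain ⟨hu, hv⟩ := h.mem_sub.1 hx
    have e1 : coordProj J x⁺ = x⁺ := coordProj_eq_self (h.supp_left _ hu)
    have e2 : coordProj J x⁻ = 0 := coordProj_eq_zero (h.supp_right _ hv)
    have e3 : coordProj Jᶜ x⁺ = 0 :=
      coordProj_eq_zero fun j hj => h.supp_left _ hu j (Finset.mem_compl.1 hj)
    have e4 : coordProj Jᶜ x⁻ = x⁻ :=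
      coordProj_eq_self fun j hj => h.supp_right _ hv j (by simpa using hj)
    have s1 := map_sub (coordProj J) x⁺ x⁻
    have s2 := map_sub (coordProj Jᶜ) x⁺ x⁻
    rw [posPart_sub_negPart, e1, e2, sub_zero] at s1
    rw [posPart_sub_negPart, e3, e4, zero_sub] at s2
    simp [s1, s2]
  refine isExposed_of_le (l₁.comp (coordProj J) - l₂.comp (coordProj Jᶜ)) (c₁ + c₂) (fun x hx => ?_) fun x => ?_
  · obtain ⟨hu, hv⟩ := h.mem_sub.1 hx
    rw [key x hx]
    exact add_le_add (hl₁ _ hu) (hl₂ _ hv)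
  · rw [hG.mem_sub, hG₁, hG₂]
    constructor
    · rintro ⟨⟨hu, hu'⟩, hv, hv'⟩
      have hx := h.mem_sub.2 ⟨hu, hv⟩
      exact ⟨hx, by rw [key x hx, hu', hv']⟩
    · rintro ⟨hx, hxc⟩
      obtain ⟨hu, hv⟩ := h.mem_sub.1 hx
      rw [key x hx] at hxc
      have k1 := hl₁ _ hu
      have k2 := hl₂ _ hv
      exact ⟨⟨hu, by linarith⟩, hv, by linarith⟩

theorem joinPair_coordFace {P₁ P₂ : Set (Fin n → ℝ)} (h₁ : ∀ x ∈ P₁, 0 ≤ x)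
    (h₂ : ∀ x ∈ P₂, 0 ≤ x) (J : Finset (Fin n)) : JoinPair J (coordFace P₁ J) (coordFace P₂ Jᶜ) :=
  ⟨fun x hx => h₁ x hx.1, fun x hx => h₂ x hx.1, fun x hx => hx.2,
    fun x hx j hj => hx.2 j (by simpa using hj)⟩

theorem polyDim_eq_iff (Q : Set (Fin n → ℝ)) : polyDim Q = n ↔ vectorSpan ℝ Q = ⊤ := by
  rw [vectorSpan_eq_top_iff_polyDim, Module.finrank_fin_fun]

theorem IsFullDimAntiBlocking.vectorSpan_coordFace_sub {P₁ P₂ : Set (Fin n → ℝ)}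
    (hP₁ : IsFullDimAntiBlocking P₁) (hP₂ : IsFullDimAntiBlocking P₂) (J : Finset (Fin n)) :
    vectorSpan ℝ (coordFace P₁ J - coordFace P₂ Jᶜ) = ⊤ :=
  vectorSpan_sub_eq_top (hP₁.coordFace_nonempty J) (hP₂.coordFace_nonempty Jᶜ)
    (hP₁.exists_single_mem_vectorSpan hP₂ J)

theorem IsFullDimAntiBlocking.vectorSpan_sub {P₁ P₂ : Set (Fin n → ℝ)}
    (hP₁ : IsFullDimAntiBlocking P₁) (hP₂ : IsFullDimAntiBlocking P₂) :
    vectorSpan ℝ (P₁ - P₂) = ⊤ :=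
  top_le_iff.1 (hP₁.vectorSpan_coordFace_sub hP₂ ∅ ▸ vectorSpan_mono ℝ
    (Set.sub_subset_sub (coordFace_subset _ _) (coordFace_subset _ _)))

theorem IsFullDimAntiBlocking.isPolytope_coordFace {P : Set (Fin n → ℝ)}
    (hP : IsFullDimAntiBlocking P) (J : Finset (Fin n)) : IsPolytope (coordFace P J) := by
  have e : P ∩ coordFace P J = coordFace P J := Set.inter_eq_right.2 (coordFace_subset P J)
  have := hP.isPolytope.inter_coordFace J hP.nonneg subset_rfl
  rw [e] at this
  exact this (hP.coordFace_nonempty J)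

theorem isSubdivision_sub {P₁ P₂ : Set (Fin n → ℝ)}
    (hP₁ : IsFullDimAntiBlocking P₁) (hP₂ : IsFullDimAntiBlocking P₂) :
    IsSubdivision (P₁ - P₂)
      (Set.range fun J : Finset (Fin n) => coordFace P₁ J - coordFace P₂ Jᶜ) := by
  have hface : ∀ J K : Finset (Fin n), IsExposed ℝ (coordFace P₁ J - coordFace P₂ Jᶜ)
      ((coordFace P₁ J - coordFace P₂ Jᶜ) ∩ (coordFace P₁ K - coordFace P₂ Kᶜ)) := by
    intro J K
    have hJ := joinPair_coordFace hP₁.nonneg hP₂.nonneg J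
    have hK := joinPair_coordFace hP₁.nonneg hP₂.nonneg K
    have e : (coordFace P₁ J - coordFace P₂ Jᶜ) ∩ (coordFace P₁ K - coordFace P₂ Kᶜ) =
        (coordFace P₁ J ∩ coordFace P₁ K) - (coordFace P₂ Jᶜ ∩ coordFace P₂ Kᶜ) := by
      ext x
      rw [Set.mem_inter_iff, hJ.mem_sub, hK.mem_sub, hJ.inter.mem_sub, Set.mem_inter_iff,
        Set.mem_inter_iff]
      tauto
    rw [e]
    exact hJ.isExposed_sub (isExposed_inter_coordFace K hP₁.nonneg (coordFace_subset _ _))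
      (isExposed_inter_coordFace Kᶜ hP₂.nonneg (coordFace_subset _ _))
  refine ⟨Set.finite_range _, ?_, ?_, ?_, ?_, ?_⟩
  · rintro _ ⟨J, rfl⟩
    exact (hP₁.isPolytope_coordFace J).sub (hP₂.isPolytope_coordFace Jᶜ)
  · rintro _ ⟨J, rfl⟩
    exact ((polyDim_eq_iff _).2 (hP₁.vectorSpan_coordFace_sub hP₂ J)).trans
      ((polyDim_eq_iff _).2 (hP₁.vectorSpan_sub hP₂)).symm
  · apply Set.Subset.antisymm
    · rintro x ⟨_, ⟨J, rfl⟩, hx⟩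
      exact Set.sub_subset_sub (coordFace_subset _ _) (coordFace_subset _ _) hx
    · rintro _ ⟨u, hu, v, hv, rfl⟩
      classical
      -- The positive coordinates choose the cell; the anti-blocking property keeps both parts of `u
      -- - v` in the polytopes.
      refine ⟨_, ⟨Finset.univ.filter fun j => 0 < (u - v) j, rfl⟩, _, ?_, _, ?_,
        posPart_sub_negPart (u - v)⟩
      · refine ⟨hP₁.down u hu _ (posPart_nonneg _) ?_, fun j hj => ?_⟩
        · rw [posPart_def]
          exact sup_le (sub_le_self u (hP₂.nonneg v hv)) (hP₁.nonneg u hu)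
        · rw [Pi.posPart_apply]
          exact posPart_of_nonpos (by simpa using hj)
      · refine ⟨hP₂.down v hv _ (negPart_nonneg _) ?_, fun j hj => ?_⟩
        · rw [negPart_def, neg_sub]
          exact sup_le (sub_le_self v (hP₁.nonneg u hu)) (hP₂.nonneg v hv)
        · rw [Pi.negPart_apply]
          have : 0 < (u - v) j := by simpa using hj
          exact negPart_of_nonneg this.le
  · rintro _ ⟨J, rfl⟩ _ ⟨K, rfl⟩ -
    exact hface J K
  · rintro _ ⟨J, rfl⟩ _ ⟨K, rfl⟩ -
    rw [Set.inter_comm]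
    exact hface K J

theorem IsFullDimAntiBlocking.isVertexInduced_coordFace {P : Set (Fin n → ℝ)}
    (hP : IsFullDimAntiBlocking P) (J : Finset (Fin n)) : IsVertexInduced P (coordFace P J) := by
  have h := convexHull_inter_coordFace (s := vertices P) J hP.nonneg
    hP.isPolytope.convexHull_vertices.subset
  rw [hP.isPolytope.convexHull_vertices, Set.inter_eq_right.2 (coordFace_subset P J)] at h
  exact ⟨_, fun x hx => hx.1, h⟩

theorem IsFullDimAntiBlocking.polyDim_coordFace {P : Set (Fin n → ℝ)}
    (hP : IsFullDimAntiBlocking P) (J : Finset (Fin n)) : polyDim (coordFace P J) = J.card := by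
  have hli : LinearIndependent ℝ (fun j : J => (Pi.single (j : Fin n) 1 : Fin n → ℝ)) := by
    have := (Pi.basisFun ℝ (Fin n)).linearIndependent.comp (Subtype.val : J → Fin n)
      Subtype.val_injective
    convert this with j
    simp
  have : vectorSpan ℝ (coordFace P J) =
      Submodule.span ℝ (Set.range fun j : J => (Pi.single (j : Fin n) 1 : Fin n → ℝ)) := by
    apply le_antisymm
    · rw [vectorSpan_def, Submodule.span_le]
      rintro _ ⟨x, hx, y, hy, rfl⟩
      simp only [vsub_eq_sub, SetLike.mem_coe]
      rw [← Finset.univ_sum_single (x - y)]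
      refine Submodule.sum_mem _ fun j _ => ?_
      by_cases hj : j ∈ J
      · have e : (Pi.single j ((x - y) j) : Fin n → ℝ) = (x - y) j • Pi.single j 1 := by
          rw [← Pi.single_smul, smul_eq_mul, mul_one]
        rw [e]
        exact Submodule.smul_mem _ _ (Submodule.subset_span ⟨⟨j, hj⟩, rfl⟩)
      · rw [Pi.sub_apply, hx.2 j hj, hy.2 j hj, sub_zero, Pi.single_zero]
        exact Submodule.zero_mem _
    · rw [Submodule.span_le]
      rintro _ ⟨⟨j, hj⟩, rfl⟩
      obtain ⟨ε, hε, h⟩ := hP.single_mem_vectorSpan_coordFace hj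
      have := Submodule.smul_mem _ ε⁻¹ h
      rwa [← Pi.single_smul, smul_eq_mul, inv_mul_cancel₀ hε] at this
  rw [polyDim, this, finrank_span_eq_card hli, Fintype.card_coe]

theorem isExactMixed_coordFace {P₁ P₂ : Set (Fin n → ℝ)}
    (hP₁ : IsFullDimAntiBlocking P₁) (hP₂ : IsFullDimAntiBlocking P₂) :
    IsExactMixed (Set.range fun J : Finset (Fin n) => (coordFace P₁ J, coordFace P₂ Jᶜ)) := by
  rintro _ ⟨J, rfl⟩
  simp only
  rw [(polyDim_eq_iff _).2 (hP₁.vectorSpan_coordFace_sub hP₂ J), hP₁.polyDim_coordFace,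
    hP₂.polyDim_coordFace, Finset.card_add_card_compl, Fintype.card_fin]

/-- A minimizer of a linear form over an anti-blocking set vanishes where the form is positive. -/
theorem IsFullDimAntiBlocking.apply_eq_zero_of_minimal {P : Set (Fin n → ℝ)}
    (hP : IsFullDimAntiBlocking P) (d : (Fin n → ℝ) →ₗ[ℝ] ℝ) {x : Fin n → ℝ}
    (hx : x ∈ P) (hmin : ∀ y ∈ P, d x ≤ d y) {j : Fin n} (hj : 0 < d (Pi.single j 1)) :
    x j = 0 := by
  have h0 := hP.nonneg x hx
  -- Deleting the `j`-th coordinate stays inside `P` and would decrease `d` if that coordinate were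
  -- positive.
  have hmem : x - Pi.single j (x j) ∈ P := by
    refine hP.down x hx _ (sub_nonneg.2 fun i => ?_)
      (sub_le_self x (Pi.single_nonneg.2 (h0 j)))
    by_cases h : i = j
    · subst h; simp
    · simpa [Pi.single_eq_of_ne h] using h0 i
  have h1 := hmin _ hmem
  have e : (Pi.single j (x j) : Fin n → ℝ) = x j • Pi.single j 1 := by
    rw [← Pi.single_smul, smul_eq_mul, mul_one]
  rw [map_sub, e, map_smul, smul_eq_mul] at h1
  refine le_antisymm ?_ (h0 j)
  by_contra! hcon
  linarith [mul_pos hcon hj]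

/-- If `d` is minimal on `F ⊆ ℝᴶ` and vanishes on `ℝᴶ`, the minimal face contains `P|_J`. -/
theorem coordFace_eq_of_minimal {P F : Set (Fin n → ℝ)} {J : Finset (Fin n)}
    {d : (Fin n → ℝ) →ₗ[ℝ] ℝ} (hF : F = {x | x ∈ P ∧ ∀ y ∈ P, d x ≤ d y}) (hne : F.Nonempty)
    (hJ : ∀ x ∈ F, ∀ j, j ∉ J → x j = 0) (hd : ∀ x, d (coordProj J x) = 0) :
    F = coordFace P J := by
  have hd' : ∀ x : Fin n → ℝ, (∀ j, j ∉ J → x j = 0) → d x = 0 := fun x hx => by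
    rw [← coordProj_eq_self hx, hd]
  obtain ⟨x₀, hx₀⟩ := hne
  have hx₀' := hx₀
  rw [hF] at hx₀'
  apply Set.Subset.antisymm
  · intro x hx
    have hx' := hx
    rw [hF] at hx'
    exact ⟨hx'.1, hJ x hx⟩
  · intro x hx
    rw [hF]
    refine ⟨hx.1, fun y hy => ?_⟩
    rw [hd' x hx.2, ← hd' x₀ (hJ x₀ hx₀)]
    exact hx₀'.2 y hy

theorem IsFullDimAntiBlocking.minimal_eq_coordFace {P : Set (Fin n → ℝ)}
    (hP : IsFullDimAntiBlocking P) (J : Finset (Fin n)) (d : (Fin n → ℝ) →ₗ[ℝ] ℝ)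
    (hd : ∀ x, d x = 2 * coordSum n (coordProj Jᶜ x)) :
    {x | x ∈ P ∧ ∀ y ∈ P, d x ≤ d y} = coordFace P J := by
  have hpos : ∀ j, 0 < coordSum n (Pi.single j 1) := fun j => by rw [coordSum_single]; exact one_pos
  have h0 : ∀ x ∈ P, 0 ≤ d x := fun x hx => by
    rw [hd]
    have := linearMap_nonneg hpos (coordProj_nonneg Jᶜ (hP.nonneg x hx))
    linarith
  rw [setOf_minimal_eq h0 hP.zero_mem (map_zero d)]
  ext x
  refine and_congr_right fun hx => ?_
  rw [hd, mul_eq_zero, or_iff_right (by norm_num : (2 : ℝ) ≠ 0),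
    linearMap_eq_zero_iff hpos (coordProj_nonneg Jᶜ (hP.nonneg x hx)), coordProj_eq_zero_iff]
  simp

theorem isRegularMixed_coordFace {P₁ P₂ : Set (Fin n → ℝ)}
    (hP₁ : IsFullDimAntiBlocking P₁) (hP₂ : IsFullDimAntiBlocking P₂) :
    IsRegularMixed P₁ P₂
      (Set.range fun J : Finset (Fin n) => (coordFace P₁ J, coordFace P₂ Jᶜ)) := by
  have hdim : polyDim (P₁ - P₂) = n := (polyDim_eq_iff _).2 (hP₁.vectorSpan_sub hP₂)
  -- For linear weights the cells are the faces minimizing `coordSum + c` and `coordSum - c`. These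
  -- forms add up to `2 * coordSum`, so at each coordinate at least one of them is positive.
  refine ⟨coordSum n, coordSum n, ?_⟩
  ext ⟨Q₁, Q₂⟩
  simp only [Set.mem_range, Set.mem_ofPred_eq, Prod.mk.injEq, hdim, polyDim_eq_iff,
    lowerCell_linear hP₁.isPolytope, lowerCell_linear hP₂.isPolytope]
  constructor
  · rintro ⟨J, rfl, rfl⟩
    refine ⟨hP₁.vectorSpan_coordFace_sub hP₂ J,
      coordSum n ∘ₗ ((coordProj Jᶜ : (Fin n → ℝ) →ₗ[ℝ] (Fin n → ℝ)) - coordProj J), ?_, ?_⟩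
    · refine (hP₁.minimal_eq_coordFace J _ fun x => ?_).symm
      have := congrArg (coordSum n) (coordProj_add_compl J x)
      rw [map_add] at this
      simp only [LinearMap.add_apply, LinearMap.comp_apply, LinearMap.sub_apply,
        ContinuousLinearMap.coe_coe, map_sub]
      linarith
    · refine (hP₂.minimal_eq_coordFace Jᶜ _ fun x => ?_).symm
      have := congrArg (coordSum n) (coordProj_add_compl J x)
      rw [map_add] at this
      rw [compl_compl]
      simp only [LinearMap.add_apply, LinearMap.comp_apply, LinearMap.sub_apply,
        ContinuousLinearMap.coe_coe, map_sub, LinearMap.neg_apply]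
      linarith
  · rintro ⟨hspan, c, h₁, h₂⟩
    classical
    set d := coordSum n + c with hd
    set e := coordSum n + -c with he
    have hQ₁ : ∀ x ∈ Q₁, x ∈ P₁ ∧ ∀ y ∈ P₁, d x ≤ d y := fun x hx => by rwa [h₁] at hx
    have hQ₂ : ∀ x ∈ Q₂, x ∈ P₂ ∧ ∀ y ∈ P₂, e x ≤ e y := fun x hx => by rwa [h₂] at hx
    -- Minimizers of `d` vanish outside this set. On it `e` is at least 2, so minimizers of `e`
    -- vanish there.
    let J : Finset (Fin n) := Finset.univ.filter fun j => d (Pi.single j 1) ≤ 0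
    have hJ₁ : ∀ x ∈ Q₁, ∀ j, j ∉ J → x j = 0 := fun x hx j hj =>
      hP₁.apply_eq_zero_of_minimal d (hQ₁ x hx).1 (hQ₁ x hx).2 (by simpa [J] using hj)
    have hJ₂ : ∀ x ∈ Q₂, ∀ j, j ∉ Jᶜ → x j = 0 := fun x hx j hj => by
      refine hP₂.apply_eq_zero_of_minimal e (hQ₂ x hx).1 (hQ₂ x hx).2 ?_
      have h1 : d (Pi.single j 1) ≤ 0 := by simpa [J] using hj
      rw [hd, LinearMap.add_apply, coordSum_single] at h1
      rw [he, LinearMap.add_apply, coordSum_single, LinearMap.neg_apply]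
      linarith
    have hne : Q₁.Nonempty ∧ Q₂.Nonempty := by
      rw [h₁, h₂, hd, he, ← lowerCell_linear hP₁.isPolytope, ← lowerCell_linear hP₂.isPolytope]
      have hv : ∀ {P : Set (Fin n → ℝ)}, IsPolytope P → (vertices P).Nonempty := fun hP =>
        convexHull_nonempty_iff.1 (hP.convexHull_vertices.symm ▸ hP.nonempty)
      exact ⟨lowerCell_nonempty hP₁.isPolytope.vertices_finite (hv hP₁.isPolytope) _ _,
        lowerCell_nonempty hP₂.isPolytope.vertices_finite (hv hP₂.isPolytope) _ _⟩
    obtain ⟨⟨q₁, hq₁⟩, ⟨q₂, hq₂⟩⟩ := hne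
    -- Projection to `ℝᴶ` kills `Q₂`, and `d` is constant on `Q₁`. Full dimension of `Q₁ - Q₂`
    -- therefore forces `d` to vanish on `ℝᴶ`, so negative coefficients on `J` are impossible.
    have k₁ := linearMap_eq_zero_of_const hspan
      (d ∘ₗ (coordProj J : (Fin n → ℝ) →ₗ[ℝ] (Fin n → ℝ))) (d q₁) (by
        rintro _ ⟨x, hx, y, hy, rfl⟩
        have e1 : coordProj J x = x := coordProj_eq_self (hJ₁ x hx)
        have e2 : coordProj J y = 0 :=
          coordProj_eq_zero fun j hj => hJ₂ y hy j (by simpa using hj)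
        simp only [LinearMap.comp_apply, ContinuousLinearMap.coe_coe, map_sub, e1, e2, map_zero,
          sub_zero]
        exact le_antisymm ((hQ₁ x hx).2 _ (hQ₁ q₁ hq₁).1) ((hQ₁ q₁ hq₁).2 _ (hQ₁ x hx).1))
    have k₂ := linearMap_eq_zero_of_const hspan
      (e ∘ₗ (coordProj Jᶜ : (Fin n → ℝ) →ₗ[ℝ] (Fin n → ℝ))) (-e q₂) (by
        rintro _ ⟨x, hx, y, hy, rfl⟩
        have e1 : coordProj Jᶜ y = y := coordProj_eq_self (hJ₂ y hy)
        have e2 : coordProj Jᶜ x = 0 :=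
          coordProj_eq_zero fun j hj => hJ₁ x hx j (Finset.mem_compl.1 hj)
        simp only [LinearMap.comp_apply, ContinuousLinearMap.coe_coe, map_sub, e1, e2, map_zero,
          zero_sub, neg_inj]
        exact le_antisymm ((hQ₂ y hy).2 _ (hQ₂ q₂ hq₂).1) ((hQ₂ q₂ hq₂).2 _ (hQ₂ y hy).1))
    exact ⟨J, (coordFace_eq_of_minimal h₁ ⟨q₁, hq₁⟩ hJ₁ fun x => LinearMap.congr_fun k₁ x).symm,
      (coordFace_eq_of_minimal h₂ ⟨q₂, hq₂⟩ hJ₂ fun x => LinearMap.congr_fun k₂ x).symm⟩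

theorem isMixedSubdivision_coordFace {P₁ P₂ : Set (Fin n → ℝ)}
    (hP₁ : IsFullDimAntiBlocking P₁) (hP₂ : IsFullDimAntiBlocking P₂) :
    IsMixedSubdivision P₁ P₂
      (Set.range fun J : Finset (Fin n) => (coordFace P₁ J, coordFace P₂ Jᶜ)) := by
  constructor
  · rw [← Set.range_comp]
    exact isSubdivision_sub hP₁ hP₂
  · rintro _ ⟨J, rfl⟩
    exact ⟨hP₁.isVertexInduced_coordFace J, hP₂.isVertexInduced_coordFace Jᶜ⟩

theorem isSubdivision_joins {P₁ P₂ : Set (Fin n → ℝ)}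
    (hP₁ : IsFullDimAntiBlocking P₁) (hP₂ : IsFullDimAntiBlocking P₂) :
    IsSubdivision (cayleyDiff P₁ P₂)
        (Set.range fun J : Finset (Fin n) => cayleyDiff (coordFace P₁ J) (coordFace P₂ Jᶜ)) ∧
      IsRegularSubdivision (vertices (cayleyDiff P₁ P₂))
        (Set.range fun J : Finset (Fin n) => cayleyDiff (coordFace P₁ J) (coordFace P₂ Jᶜ)) := by
  rw [← gluedCells_singleton hP₁ hP₂]
  exact ⟨isSubdivision_gluedCells hP₁ hP₂ hP₁.isPolytope.isSubdivision_singleton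
      hP₂.isPolytope.isSubdivision_singleton,
    isRegularSubdivision_vertices_gluedCells hP₁ hP₂ hP₁.isPolytope.isSubdivision_singleton
      hP₂.isPolytope.isSubdivision_singleton hP₁.isRegularSubdivision_singleton
      hP₂.isRegularSubdivision_singleton⟩

/-! ### Gluing triangulations -/

theorem mem_vertices_inter_coordFace {P T : Set (Fin n → ℝ)} (hP : ∀ x ∈ P, 0 ≤ x) (hT : T ⊆ P)
    {J : Finset (Fin n)} {x : Fin n → ℝ} :
    x ∈ vertices (T ∩ coordFace P J) ↔ x ∈ vertices T ∧ ∀ j, j ∉ J → x j = 0 := by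
  constructor
  · intro hx
    exact ⟨(isExposed_inter_coordFace J hP hT).isExtreme.extremePoints_subset_extremePoints hx,
      (extremePoints_subset hx).2.2⟩
  · rintro ⟨hx, hJ⟩
    have hxT : x ∈ T := extremePoints_subset hx
    exact inter_extremePoints_subset_extremePoints_of_subset Set.inter_subset_left
      ⟨⟨hxT, hT hxT, hJ⟩, hx⟩

theorem mem_vertices_join {P₁ P₂ T₁ T₂ : Set (Fin n → ℝ)}
    (hP₁ : IsFullDimAntiBlocking P₁) (hP₂ : IsFullDimAntiBlocking P₂)
    (hT₁ : T₁ ⊆ P₁) (hT₂ : T₂ ⊆ P₂) (hc₁ : Convex ℝ T₁) (hc₂ : Convex ℝ T₂)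
    {J : Finset (Fin n)} {z : (Fin n → ℝ) × ℝ} :
    z ∈ vertices (cayleyDiff (T₁ ∩ coordFace P₁ J) (T₂ ∩ coordFace P₂ Jᶜ)) ↔
      ((z.1 ∈ vertices T₁ ∧ ∀ j, j ∉ J → z.1 j = 0) ∧ z.2 = 1) ∨
      ((-z.1 ∈ vertices T₂ ∧ ∀ j, j ∈ J → z.1 j = 0) ∧ z.2 = -1) := by
  rw [vertices_cayleyDiff (hc₁.inter (convex_coordFace hP₁.convex _))
    (hc₂.inter (convex_coordFace hP₂.convex _))]
  simp only [Set.mem_union, Set.mem_prod, Set.mem_singleton_iff, Set.mem_neg,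
    mem_vertices_inter_coordFace hP₁.nonneg hT₁, mem_vertices_inter_coordFace hP₂.nonneg hT₂,
    Finset.mem_compl, not_not, Pi.neg_apply, neg_eq_zero]

/-- Affinely independent sets in complementary coordinate subspaces have affinely independent
join. -/
theorem affineIndependent_join {J : Finset (Fin n)} {s₁ s₂ : Set (Fin n → ℝ)} (hf₁ : s₁.Finite)
    (hf₂ : s₂.Finite) (hJ₁ : ∀ x ∈ s₁, ∀ j, j ∉ J → x j = 0) (hJ₂ : ∀ x ∈ s₂, ∀ j, j ∈ J → x j = 0)
    (h₁ : AffineIndependent ℝ ((↑) : s₁ → Fin n → ℝ))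
    (h₂ : AffineIndependent ℝ ((↑) : s₂ → Fin n → ℝ)) :
    AffineIndependent ℝ ((↑) : ↥((s₁ ×ˢ {(1 : ℝ)}) ∪ ((-s₂) ×ˢ {(-1 : ℝ)})) → (Fin n → ℝ) × ℝ) := by
  have := hf₁.fintype
  have := hf₂.fintype
  let p : s₁ ⊕ s₂ → (Fin n → ℝ) × ℝ := Sum.elim (fun v => (v, 1)) fun w => (-w, -1)
  have hrange : Set.range p = (s₁ ×ˢ {(1 : ℝ)}) ∪ ((-s₂) ×ˢ {(-1 : ℝ)}) := by
    ext ⟨x, t⟩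
    constructor
    · rintro ⟨⟨v, hv⟩ | ⟨w, hw⟩, h⟩
      · exact h ▸ mk_one_mem_generators s₂ hv
      · exact h ▸ mk_neg_one_mem_generators s₁ hw
    · rintro (⟨hx, ht⟩ | ⟨hx, ht⟩)
      · exact ⟨Sum.inl ⟨x, hx⟩, Prod.ext rfl (Eq.symm ht)⟩
      · exact ⟨Sum.inr ⟨-x, hx⟩, Prod.ext (neg_neg x) (Eq.symm ht)⟩
  suffices AffineIndependent ℝ p by
    have := this.range
    rwa [hrange] at this
  rw [affineIndependent_iff_of_fintype] at h₁ h₂ ⊢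
  intro w hw hwp
  rw [Finset.weightedVSub_eq_linear_combination _ hw] at hwp
  rw [Fintype.sum_sum_type] at hw hwp
  have hw2 := congrArg Prod.snd hwp
  have hw1 := congrArg Prod.fst hwp
  simp only [Prod.snd_add, Prod.snd_sum, Prod.snd_zero, p, Sum.elim_inl, Sum.elim_inr,
    Prod.smul_snd, smul_eq_mul, mul_one, mul_neg, Finset.sum_neg_distrib] at hw2
  simp only [Prod.fst_add, Prod.fst_sum, Prod.fst_zero, p, Sum.elim_inl, Sum.elim_inr,
    Prod.smul_fst, smul_neg, Finset.sum_neg_distrib] at hw1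
  -- The two level sums have sum zero, and by the last coordinate also difference zero.
  have a1 : ∑ i, w (Sum.inl i) = 0 := by linarith
  have a2 : ∑ i, w (Sum.inr i) = 0 := by linarith
  have e : ∑ i, w (Sum.inl i) • (i : Fin n → ℝ) = ∑ i, w (Sum.inr i) • (i : Fin n → ℝ) :=
    add_neg_eq_zero.1 hw1
  -- The common value lies in both of two complementary coordinate subspaces.
  have b1 : ∑ i, w (Sum.inl i) • (i : Fin n → ℝ) = 0 := by
    ext j
    by_cases hj : j ∈ J
    · rw [e, Finset.sum_apply]
      exact Finset.sum_eq_zero fun i _ => by simp [hJ₂ i i.2 j hj]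
    · rw [Finset.sum_apply]
      exact Finset.sum_eq_zero fun i _ => by simp [hJ₁ i i.2 j hj]
  have b2 := e.symm.trans b1
  rintro (i | i)
  · refine h₁ (fun i => w (Sum.inl i)) a1 ?_ i
    rw [Finset.weightedVSub_eq_linear_combination _ a1, b1]
  · refine h₂ (fun i => w (Sum.inr i)) a2 ?_ i
    rw [Finset.weightedVSub_eq_linear_combination _ a2, b2]

/-- The join of the coordinate faces of two simplices, in terms of its generators. -/
theorem cayleyDiff_simplex_faces {P₁ P₂ s₁ s₂ : Set (Fin n → ℝ)} (J : Finset (Fin n))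
    (hP₁ : ∀ x ∈ P₁, 0 ≤ x) (hP₂ : ∀ x ∈ P₂, 0 ≤ x)
    (h₁ : convexHull ℝ s₁ ⊆ P₁) (h₂ : convexHull ℝ s₂ ⊆ P₂) :
    cayleyDiff (convexHull ℝ s₁ ∩ coordFace P₁ J) (convexHull ℝ s₂ ∩ coordFace P₂ Jᶜ) =
      convexHull ℝ (({x | x ∈ s₁ ∧ ∀ j, j ∉ J → x j = 0} ×ˢ {(1 : ℝ)}) ∪
        ((-{x | x ∈ s₂ ∧ ∀ j, j ∉ Jᶜ → x j = 0}) ×ˢ {(-1 : ℝ)})) := by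
  rw [convexHull_inter_coordFace J hP₁ h₁, convexHull_inter_coordFace Jᶜ hP₂ h₂,
    cayleyDiff_convexHull]

theorem affineIndependent_join_faces {s₁ s₂ : Set (Fin n → ℝ)} (J : Finset (Fin n))
    (hf₁ : s₁.Finite) (hf₂ : s₂.Finite) (h₁ : AffineIndependent ℝ ((↑) : s₁ → Fin n → ℝ))
    (h₂ : AffineIndependent ℝ ((↑) : s₂ → Fin n → ℝ)) :
    AffineIndependent ℝ ((↑) : ↥(({x | x ∈ s₁ ∧ ∀ j, j ∉ J → x j = 0} ×ˢ {(1 : ℝ)}) ∪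
        ((-{x | x ∈ s₂ ∧ ∀ j, j ∉ Jᶜ → x j = 0}) ×ˢ {(-1 : ℝ)})) → (Fin n → ℝ) × ℝ) :=
  affineIndependent_join (J := J) (hf₁.subset fun x hx => hx.1) (hf₂.subset fun x hx => hx.1)
    (fun x hx => hx.2) (fun x hx j hj => hx.2 j (by simpa using hj))
    (h₁.mono fun x hx => hx.1) (h₂.mono fun x hx => hx.1)

theorem isTriangulation_gluedCells {P₁ P₂ : Set (Fin n → ℝ)} {S₁ S₂ : Set (Set (Fin n → ℝ))}
    (hP₁ : IsFullDimAntiBlocking P₁) (hP₂ : IsFullDimAntiBlocking P₂)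
    (hS₁ : IsTriangulation P₁ S₁) (hS₂ : IsTriangulation P₂ S₂) :
    IsTriangulation (cayleyDiff P₁ P₂) (gluedCells P₁ P₂ S₁ S₂) where
  toIsSubdivision :=
    isSubdivision_gluedCells hP₁ hP₂ hS₁.toIsSubdivision hS₂.toIsSubdivision
  isSimplex := by
    intro Q hQ
    have hne := ((isSubdivision_gluedCells hP₁ hP₂ hS₁.toIsSubdivision
      hS₂.toIsSubdivision).isPolytope Q hQ).nonempty
    obtain ⟨J, _, ⟨T₁, hT₁, rfl⟩, _, ⟨T₂, hT₂, rfl⟩, rfl⟩ := hQ.1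
    obtain ⟨s₁, hf₁, -, hi₁, rfl⟩ := hS₁.isSimplex T₁ hT₁
    obtain ⟨s₂, hf₂, -, hi₂, rfl⟩ := hS₂.isSimplex T₂ hT₂
    rw [cayleyDiff_simplex_faces J hP₁.nonneg hP₂.nonneg (hS₁.subset hT₁) (hS₂.subset hT₂)]
      at hne ⊢
    exact ⟨_, ((hf₁.subset fun x hx => hx.1).prod (Set.finite_singleton _)).union
      ((hf₂.subset fun x hx => hx.1).neg.prod (Set.finite_singleton _)),
      convexHull_nonempty_iff.1 hne, affineIndependent_join_faces J hf₁ hf₂ hi₁ hi₂, rfl⟩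
  no_new_vertices := by
    intro Q hQ z hz
    obtain ⟨J, _, ⟨T₁, hT₁, rfl⟩, _, ⟨T₂, hT₂, rfl⟩, rfl⟩ := hQ.1
    rw [mem_vertices_join hP₁ hP₂ (hS₁.subset hT₁) (hS₂.subset hT₂) (hS₁.isPolytope _ hT₁).convex
      (hS₂.isPolytope _ hT₂).convex] at hz
    rw [vertices_cayleyDiff hP₁.convex hP₂.convex]
    rcases hz with ⟨⟨h, -⟩, ht⟩ | ⟨⟨h, -⟩, ht⟩
    · exact Or.inl ⟨hS₁.no_new_vertices T₁ hT₁ h, ht⟩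
    · exact Or.inr ⟨hS₂.no_new_vertices T₂ hT₂ h, ht⟩

/-! ### Flagness -/

/-- In a flag triangulation, pairwise adjacent vertices span a face. -/
theorem IsFlagTriangulation.isFaceOf {E : Type*} [AddCommGroup E] [Module ℝ E]
    [TopologicalSpace E] {P : Set E} {S : Set (Set E)} (h : IsFlagTriangulation P S) (σ : Finset E)
    (hσ : ∀ v ∈ σ, ∀ w ∈ σ, ∃ T ∈ S, v ∈ vertices T ∧ w ∈ vertices T) : IsFaceOf S σ := by
  classical
  induction σ using Finset.strongInduction with
  | H σ ih =>
    by_contra hcon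
    have hcard := h.2 σ (fun v hv => by
        obtain ⟨T, hT, hvT, -⟩ := hσ v hv v hv
        exact ⟨T, hT, hvT⟩) hcon
      fun τ hτ => ih τ hτ fun v hv w hw => hσ v (hτ.1 hv) w (hτ.1 hw)
    obtain ⟨v, w, -, rfl⟩ := Finset.card_eq_two.1 hcard
    obtain ⟨T, hT, hv, hw⟩ := hσ v (by simp) w (by simp)
    refine hcon ⟨T, hT, fun x hx => ?_⟩
    have : x = v ∨ x = w := by simpa using hx
    rcases this with rfl | rfl
    exacts [hv, hw]

theorem isFlagTriangulation_gluedCells {P₁ P₂ : Set (Fin n → ℝ)}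
    {S₁ S₂ : Set (Set (Fin n → ℝ))}
    (hP₁ : IsFullDimAntiBlocking P₁) (hP₂ : IsFullDimAntiBlocking P₂)
    (hS₁ : IsFlagTriangulation P₁ S₁) (hS₂ : IsFlagTriangulation P₂ S₂) :
    IsFlagTriangulation (cayleyDiff P₁ P₂) (gluedCells P₁ P₂ S₁ S₂) := by
  classical
  refine ⟨isTriangulation_gluedCells hP₁ hP₂ hS₁.1 hS₂.1, fun σ hvert hnot hsub => ?_⟩
  by_contra hcard
  -- As `σ` does not have two elements, every pair in it is a proper subset and hence a face.
  have hpair : ∀ v ∈ σ, ∀ w ∈ σ, ∃ Q ∈ gluedCells P₁ P₂ S₁ S₂, v ∈ vertices Q ∧ w ∈ vertices Q := by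
    intro v hv w hw
    by_cases hvw : v = w
    · subst hvw
      obtain ⟨Q, hQ, hvQ⟩ := hvert v hv
      exact ⟨Q, hQ, hvQ, hvQ⟩
    · have hss : ({v, w} : Finset _) ⊂ σ := by
        refine Finset.ssubset_iff_subset_ne.2 ⟨?_, ?_⟩
        · intro x hx
          simp only [Finset.mem_insert, Finset.mem_singleton] at hx
          rcases hx with rfl | rfl <;> assumption
        · rintro rfl
          exact hcard (Finset.card_pair hvw)
      obtain ⟨Q, hQ, h⟩ := hsub _ hss
      exact ⟨Q, hQ, h (by simp), h (by simp)⟩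
  have hpair' : ∀ v ∈ σ, ∀ w ∈ σ, ∃ J : Finset (Fin n), ∃ T₁ ∈ S₁, ∃ T₂ ∈ S₂, ∀ z, z = v ∨ z = w →
      ((z.1 ∈ vertices T₁ ∧ ∀ j, j ∉ J → z.1 j = 0) ∧ z.2 = 1) ∨
      ((-z.1 ∈ vertices T₂ ∧ ∀ j, j ∈ J → z.1 j = 0) ∧ z.2 = -1) := by
    intro v hv w hw
    obtain ⟨Q, hQ, hvQ, hwQ⟩ := hpair v hv w hw
    obtain ⟨J, _, ⟨T₁, hT₁, rfl⟩, _, ⟨T₂, hT₂, rfl⟩, rfl⟩ := hQ.1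
    rw [mem_vertices_join hP₁ hP₂ (hS₁.1.subset hT₁) (hS₂.1.subset hT₂)
      (hS₁.1.isPolytope _ hT₁).convex (hS₂.1.isPolytope _ hT₂).convex] at hvQ hwQ
    refine ⟨J, T₁, hT₁, T₂, hT₂, ?_⟩
    rintro z (rfl | rfl)
    exacts [hvQ, hwQ]
  have hne : (1 : ℝ) ≠ -1 := by norm_num
  let σ₁ : Finset (Fin n → ℝ) := (σ.filter fun z => z.2 = 1).image Prod.fst
  let σ₂ : Finset (Fin n → ℝ) := (σ.filter fun z => z.2 = -1).image fun z => -z.1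
  have hσ₁ : ∀ v, v ∈ σ₁ ↔ (v, (1 : ℝ)) ∈ σ := by
    intro v
    simp only [σ₁, Finset.mem_image, Finset.mem_filter]
    constructor
    · rintro ⟨⟨x, t⟩, ⟨h, rfl⟩, rfl⟩
      exact h
    · exact fun h => ⟨_, ⟨h, rfl⟩, rfl⟩
  have hσ₂ : ∀ v, v ∈ σ₂ ↔ (-v, (-1 : ℝ)) ∈ σ := by
    intro v
    simp only [σ₂, Finset.mem_image, Finset.mem_filter]
    constructor
    · rintro ⟨⟨x, t⟩, ⟨h, rfl⟩, rfl⟩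
      simpa using h
    · exact fun h => ⟨_, ⟨h, rfl⟩, neg_neg v⟩
  obtain ⟨T₁, hT₁, hσT₁⟩ := hS₁.isFaceOf σ₁ fun v hv w hw => by
    obtain ⟨J, T₁, hT₁, T₂, hT₂, h⟩ := hpair' _ ((hσ₁ v).1 hv) _ ((hσ₁ w).1 hw)
    refine ⟨T₁, hT₁, ?_, ?_⟩
    · rcases h _ (Or.inl rfl) with h | h
      exacts [h.1.1, absurd h.2 hne]
    · rcases h _ (Or.inr rfl) with h | h
      exacts [h.1.1, absurd h.2 hne]
  obtain ⟨T₂, hT₂, hσT₂⟩ := hS₂.isFaceOf σ₂ fun v hv w hw => by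
    obtain ⟨J, T₁, hT₁, T₂, hT₂, h⟩ := hpair' _ ((hσ₂ v).1 hv) _ ((hσ₂ w).1 hw)
    refine ⟨T₂, hT₂, ?_, ?_⟩
    · rcases h _ (Or.inl rfl) with h | h
      exacts [absurd h.2.symm hne, by simpa using h.1.1]
    · rcases h _ (Or.inr rfl) with h | h
      exacts [absurd h.2.symm hne, by simpa using h.1.1]
  have hcross : ∀ v ∈ σ₁, ∀ w ∈ σ₂, ∀ j, v j = 0 ∨ w j = 0 := by
    intro v hv w hw j
    obtain ⟨J, T₁, hT₁, T₂, hT₂, h⟩ := hpair' _ ((hσ₁ v).1 hv) _ ((hσ₂ w).1 hw)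
    by_cases hj : j ∈ J
    · rcases h _ (Or.inr rfl) with h | h
      exacts [absurd h.2.symm hne, Or.inr (by simpa using h.1.2 j hj)]
    · rcases h _ (Or.inl rfl) with h | h
      exacts [Or.inl (h.1.2 j hj), absurd h.2 hne]
  -- The union of the supports in `σ₁`; by `hcross` all of `σ₂` vanishes on it.
  let J : Finset (Fin n) := Finset.univ.filter fun j => ∃ v ∈ σ₁, v j ≠ 0
  have hF : cayleyDiff (T₁ ∩ coordFace P₁ J) (T₂ ∩ coordFace P₂ Jᶜ) ∈ joinCells P₁ P₂ S₁ S₂ :=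
    ⟨J, _, ⟨T₁, hT₁, rfl⟩, _, ⟨T₂, hT₂, rfl⟩, rfl⟩
  -- The join containing `σ` may have lower dimension, so a maximal cell with this join as a face is
  -- taken.
  obtain ⟨Q, hQ, hexp⟩ := exists_gluedCells_isExposed hP₁ hP₂ hS₁.1.toIsSubdivision
    hS₂.1.toIsSubdivision hF
  refine hnot ⟨Q, hQ, fun z hz => hexp.isExtreme.extremePoints_subset_extremePoints ?_⟩
  refine (mem_vertices_join hP₁ hP₂ (hS₁.1.subset hT₁) (hS₂.1.subset hT₂)
      (hS₁.1.isPolytope _ hT₁).convex (hS₂.1.isPolytope _ hT₂).convex).2 ?_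
  obtain ⟨x, t⟩ := z
  obtain ⟨_, U₁, -, U₂, -, h⟩ := hpair' _ hz _ hz
  rcases h _ (Or.inl rfl) with ⟨-, ht⟩ | ⟨-, ht⟩
  · obtain rfl : t = 1 := ht
    have hx : x ∈ σ₁ := (hσ₁ x).2 hz
    refine Or.inl ⟨⟨hσT₁ hx, fun j hj => ?_⟩, rfl⟩
    by_contra h0
    exact hj (Finset.mem_filter.2 ⟨Finset.mem_univ j, x, hx, h0⟩)
  · obtain rfl : t = -1 := ht
    have hx : -x ∈ σ₂ := (hσ₂ (-x)).2 (by simpa using hz)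
    refine Or.inr ⟨⟨hσT₂ hx, fun j hj => ?_⟩, rfl⟩
    obtain ⟨-, v, hv, hvj⟩ := Finset.mem_filter.1 hj
    simpa using (hcross v hv _ hx j).resolve_left hvj

/-! ### Unimodular simplices: minimal volume and generation of the lattice -/

theorem vectorSpan_int_vadd_insert {E ι : Type*} [AddCommGroup E] (p : E) (e : ι → E) :
    vectorSpan ℤ (p +ᵥ insert 0 (Set.range e)) = Submodule.span ℤ (Set.range e) := by
  have hp : p ∈ p +ᵥ insert 0 (Set.range e) :=
    Set.mem_vadd_set.2 ⟨0, Set.mem_insert _ _, add_zero p⟩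
  rw [vectorSpan_eq_span_vsub_set_right ℤ hp]
  have : (fun x => x -ᵥ p) '' (p +ᵥ insert 0 (Set.range e)) = insert 0 (Set.range e) := by
    rw [← Set.image_vadd, Set.image_image]
    simp
  rw [this, Submodule.span_insert_zero]

section Lattice

variable {E : Type*} [NormedAddCommGroup E] [NormedSpace ℝ E]

theorem IsSimplex.isPolytope {T : Set E} (hT : IsSimplex T) : IsPolytope T := by
  obtain ⟨s, hf, hne, -, rfl⟩ := hT
  exact ⟨s, hf, hne, rfl⟩

theorem IsSimplex.affineIndependent_vertices {T : Set E} (hT : IsSimplex T) :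
    AffineIndependent ℝ ((↑) : vertices T → E) := by
  obtain ⟨s, -, -, hi, rfl⟩ := hT
  exact hi.mono extremePoints_convexHull_subset

theorem IsPolytope.vertices_nonempty {P : Set E} (hP : IsPolytope P) : (vertices P).Nonempty :=
  convexHull_nonempty_iff.1 (hP.convexHull_vertices.symm ▸ hP.nonempty)

/-- The edge vectors of a full-dimensional simplex at one of its vertices. -/
theorem IsSimplex.exists_basis [FiniteDimensional ℝ E] {T : Set E} (hT : IsSimplex T)
    (hdim : vectorSpan ℝ T = ⊤) :
    ∃ (p : E) (b : Module.Basis (Fin (Module.finrank ℝ E)) ℝ E),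
      vertices T = p +ᵥ insert 0 (Set.range b) := by
  obtain ⟨p, hp⟩ := hT.isPolytope.vertices_nonempty
  have hi := (affineIndependent_set_iff_linearIndependent_vsub ℝ hp).1 hT.affineIndependent_vertices
  set B := (fun x => x -ᵥ p) '' (vertices T \ {p}) with hB
  have hspan : Submodule.span ℝ B = ⊤ := by
    rw [hB, ← vectorSpan_eq_span_vsub_set_right_ne ℝ hp, ← vectorSpan_convexHull_eq,
      hT.isPolytope.convexHull_vertices, hdim]
  let b₀ : Module.Basis B ℝ E := Module.Basis.mk hi (by simp [hspan])
  have hfin : Finite B := (hT.isPolytope.vertices_finite.subset Set.sdiff_subset).image _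
  have := Fintype.ofFinite B
  have hcard : Fintype.card B = Module.finrank ℝ E := (Module.finrank_eq_card_basis b₀).symm
  let b := b₀.reindex (Fintype.equivFinOfCardEq hcard)
  have hb : Set.range b = B := by
    rw [Module.Basis.range_reindex, Module.Basis.coe_mk, Subtype.range_coe]
  refine ⟨p, b, ?_⟩
  rw [hb]
  ext x
  rw [Set.mem_vadd_set_iff_neg_vadd_mem, Set.mem_insert_iff, vadd_eq_add, neg_add_eq_zero]
  constructor
  · intro hx
    by_cases hxp : p = x
    · exact Or.inl hxp
    · exact Or.inr ⟨x, ⟨hx, fun h => hxp h.symm⟩, sub_eq_neg_add x p⟩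
  · rintro (rfl | ⟨y, hy, hyx⟩)
    · exact hp
    · have hyx' : y - p = -p + x := hyx
      rw [neg_add_eq_sub, sub_left_inj] at hyx'
      exact hyx' ▸ hy.1

/-- Vectors in the lattice of a basis have an integral coordinate matrix. -/
theorem exists_intMatrix {N : ℕ} (b : Module.Basis (Fin N) ℝ E) (e : Fin N → E)
    (he : ∀ i, e i ∈ Submodule.span ℤ (Set.range b)) :
    ∃ A : Matrix (Fin N) (Fin N) ℤ, (∀ i, ∑ j, A j i • b j = e i) ∧
      LinearMap.det (b.constr ℝ e) = (A.det : ℝ) := by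
  have h : ∀ i, ∃ c : Fin N → ℤ, ∑ j, c j • b j = e i := fun i =>
    (Submodule.mem_span_range_iff_exists_fun ℤ).1 (he i)
  choose c hc using h
  refine ⟨Matrix.of fun j i => c i j, hc, ?_⟩
  rw [← LinearMap.det_toMatrix b, Int.cast_det]
  congr 1
  ext j i
  rw [LinearMap.toMatrix_apply, Module.Basis.constr_basis, ← hc i, map_sum, Finsupp.finsetSum_apply,
    Finset.sum_eq_single j]
  · rw [map_zsmul]
    simp
  · intro k _ hk
    rw [map_zsmul]
    simp [hk]
  · simp

theorem image_constr_simplex {N : ℕ} (b : Module.Basis (Fin N) ℝ E) (e : Fin N → E) :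
    b.constr ℝ e '' convexHull ℝ (insert 0 (Set.range b)) =
      convexHull ℝ (insert 0 (Set.range e)) := by
  rw [LinearMap.image_convexHull, Set.image_insert_eq, map_zero, ← Set.range_comp]
  congr 3
  ext i
  simp

theorem det_constr_ne_zero {N : ℕ} (b e : Module.Basis (Fin N) ℝ E) :
    LinearMap.det (b.constr ℝ e) ≠ 0 := by
  have h : b.constr ℝ e = (b.equiv e (Equiv.refl _) : E →ₗ[ℝ] E) :=
    b.ext fun i => by simp
  rw [h]
  exact (LinearEquiv.isUnit_det' _).ne_zero

theorem isSimplex_basis {N : ℕ} (b : Module.Basis (Fin N) ℝ E) :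
    IsSimplex (convexHull ℝ (insert 0 (Set.range b))) ∧
      vectorSpan ℝ (convexHull ℝ (insert 0 (Set.range b))) = ⊤ := by
  have h0 : (0 : E) ∈ insert 0 (Set.range b) := Set.mem_insert _ _
  have h0' : (0 : E) ∉ Set.range b := by
    rintro ⟨i, hi⟩
    exact b.ne_zero i hi
  have e : (fun x => x -ᵥ (0 : E)) '' (insert 0 (Set.range b) \ {0}) = Set.range b := by
    rw [Set.insert_sdiff_of_mem _ (Set.mem_singleton _), Set.sdiff_singleton_eq_self h0']
    simp
  constructor
  · refine ⟨_, (Set.finite_range b).insert 0, ⟨0, h0⟩, ?_, rfl⟩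
    rw [affineIndependent_set_iff_linearIndependent_vsub ℝ h0, e]
    exact b.linearIndependent.linearIndepOn_id
  · rw [vectorSpan_convexHull_eq, vectorSpan_eq_span_vsub_set_right_ne ℝ h0, e, b.span_eq]

variable [FiniteDimensional ℝ E] [MeasureTheory.MeasureSpace E] [BorelSpace E]
  [(MeasureTheory.volume : MeasureTheory.Measure E).IsAddHaarMeasure]

theorem IsPolytope.volume_eq {T : Set E} (hT : IsPolytope T) {p : E} {ι : Type*} {e : ι → E}
    (h : vertices T = p +ᵥ insert 0 (Set.range e)) :
    MeasureTheory.volume T = MeasureTheory.volume (convexHull ℝ (insert 0 (Set.range e))) := by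
  rw [← hT.convexHull_vertices, h, convexHull_vadd, MeasureTheory.measure_vadd]

theorem volume_constr_simplex {N : ℕ} (b : Module.Basis (Fin N) ℝ E) (e : Fin N → E) :
    MeasureTheory.volume (convexHull ℝ (insert 0 (Set.range e))) =
      ENNReal.ofReal |LinearMap.det (b.constr ℝ e)| *
        MeasureTheory.volume (convexHull ℝ (insert 0 (Set.range b))) := by
  rw [← image_constr_simplex b e, MeasureTheory.Measure.addHaar_image_linearMap]

/-- A simplex whose edges generate all differences of the lattice has minimal volume. -/
theorem isUnimodularSimplex_of_generates {L T : Set E} (hT : IsFullSimplexIn L T)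
    (h : ∀ x ∈ L, ∀ y ∈ L, x - y ∈ vectorSpan ℤ (vertices T)) : IsUnimodularSimplex L T := by
  refine ⟨hT, fun T' hT' => ?_⟩
  obtain ⟨p, b, hb⟩ := hT.1.exists_basis ((vectorSpan_eq_top_iff_polyDim _).2 hT.2.1)
  obtain ⟨q, e, he⟩ := hT'.1.exists_basis ((vectorSpan_eq_top_iff_polyDim _).2 hT'.2.1)
  rw [hb, vectorSpan_int_vadd_insert] at h
  have hq : q ∈ L := hT'.2.2 (he ▸ Set.mem_vadd_set.2 ⟨0, Set.mem_insert _ _, add_zero q⟩)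
  obtain ⟨A, -, hA⟩ := exists_intMatrix b e fun i => by
    have hi : q + e i ∈ L :=
      hT'.2.2 (he ▸ Set.mem_vadd_set.2 ⟨e i, Set.mem_insert_of_mem _ ⟨i, rfl⟩, rfl⟩)
    simpa using h _ hi _ hq
  have hne : A.det ≠ 0 := fun h0 => det_constr_ne_zero b e (by rw [hA, h0, Int.cast_zero])
  -- The volume ratio of the two simplices is the absolute value of a nonzero integer.
  have h1 : (1 : ℝ) ≤ |LinearMap.det (b.constr ℝ e)| := by
    rw [hA, ← Int.cast_abs]
    exact_mod_cast Int.one_le_abs hne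
  rw [hT.1.isPolytope.volume_eq hb, hT'.1.isPolytope.volume_eq he, volume_constr_simplex b e]
  calc MeasureTheory.volume (convexHull ℝ (insert 0 (Set.range b)))
      = 1 * MeasureTheory.volume (convexHull ℝ (insert 0 (Set.range b))) := (one_mul _).symm
    _ ≤ _ := by
      gcongr
      rwa [← ENNReal.ofReal_one, ENNReal.ofReal_le_ofReal_iff (abs_nonneg _)]

/-- The edges of a unimodular simplex generate the lattice. -/
theorem IsUnimodularSimplex.le_vectorSpan {Λ : Submodule ℤ E} [DiscreteTopology Λ] [IsZLattice ℝ Λ]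
    {T : Set E} (hT : IsUnimodularSimplex (Λ : Set E) T) : Λ ≤ vectorSpan ℤ (vertices T) := by
  have := ZLattice.module_free ℝ Λ
  have := ZLattice.module_finite ℝ Λ
  let b₀ := Module.finBasisOfFinrankEq ℤ Λ (ZLattice.rank ℝ Λ)
  let b := b₀.ofZLatticeBasis ℝ Λ
  have hspan : Submodule.span ℤ (Set.range b) = Λ := b₀.ofZLatticeBasis_span ℝ Λ
  obtain ⟨p, e, he⟩ := hT.1.1.exists_basis ((vectorSpan_eq_top_iff_polyDim _).2 hT.1.2.1)
  rw [he, vectorSpan_int_vadd_insert]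
  have hp : p ∈ Λ := hT.1.2.2 (he ▸ Set.mem_vadd_set.2 ⟨0, Set.mem_insert _ _, add_zero p⟩)
  obtain ⟨A, hAe, hA⟩ := exists_intMatrix b e fun i => by
    have hi : p + e i ∈ Λ :=
      hT.1.2.2 (he ▸ Set.mem_vadd_set.2 ⟨e i, Set.mem_insert_of_mem _ ⟨i, rfl⟩, rfl⟩)
    rw [hspan]
    simpa using Λ.sub_mem hi hp
  obtain ⟨hs, hd⟩ := isSimplex_basis b
  have hfull : IsFullSimplexIn (Λ : Set E) (convexHull ℝ (insert 0 (Set.range b))) := by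
    refine ⟨hs, (vectorSpan_eq_top_iff_polyDim _).1 hd,
      extremePoints_convexHull_subset.trans (Set.insert_subset Λ.zero_mem ?_)⟩
    rintro _ ⟨i, rfl⟩
    rw [← hspan]
    exact Submodule.subset_span ⟨i, rfl⟩
  have hvol := hT.2 _ hfull
  have hpos : 0 < MeasureTheory.volume (convexHull ℝ (insert 0 (Set.range b))) :=
    (isOpen_interior.measure_pos _ (interior_nonempty_of_vectorSpan_eq_top
      (convex_convexHull ℝ _) hs.isPolytope.nonempty hd)).trans_le
      (MeasureTheory.measure_mono interior_subset)
  have htop : MeasureTheory.volume (convexHull ℝ (insert 0 (Set.range b))) ≠ ⊤ :=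
    hs.isPolytope.isCompact.measure_lt_top.ne
  rw [hT.1.1.isPolytope.volume_eq he, volume_constr_simplex b e] at hvol
  -- The simplex on a lattice basis competes for minimal volume; its volume is positive and finite,
  -- so it can be cancelled.
  have hle : ENNReal.ofReal |LinearMap.det (b.constr ℝ e)| ≤ 1 := by
    by_contra! hcon
    exact absurd (ENNReal.mul_lt_mul_left hpos.ne' htop hcon) (by simpa using hvol)
  have hdet : |A.det| = 1 := by
    have hne : A.det ≠ 0 := fun h0 => det_constr_ne_zero b e (by rw [hA, h0, Int.cast_zero])
    rw [hA, ← Int.cast_abs, ENNReal.ofReal_le_one] at hle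
    exact le_antisymm (by exact_mod_cast hle) (Int.one_le_abs hne)
  have hunit : IsUnit A.det := Int.isUnit_iff_abs_eq.2 hdet
  rw [← hspan, Submodule.span_le]
  rintro _ ⟨k, rfl⟩
  -- The determinant is a unit, so the integral inverse matrix expresses the lattice basis through
  -- the edges.
  have hk : b k = ∑ i, A⁻¹ i k • e i := by
    have h1 : ∀ j, ∑ i, A j i * A⁻¹ i k = (1 : Matrix (Fin _) (Fin _) ℤ) j k := fun j => by
      rw [← Matrix.mul_nonsing_inv A hunit, Matrix.mul_apply]
    calc b k = ∑ j, (1 : Matrix (Fin _) (Fin _) ℤ) j k • b j := by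
          simp [Matrix.one_apply]
      _ = ∑ j, ∑ i, (A j i * A⁻¹ i k) • b j := by
          refine Finset.sum_congr rfl fun j _ => ?_
          rw [← h1, Finset.sum_smul]
      _ = ∑ i, A⁻¹ i k • ∑ j, A j i • b j := by
          rw [Finset.sum_comm]
          refine Finset.sum_congr rfl fun i _ => ?_
          rw [Finset.smul_sum]
          refine Finset.sum_congr rfl fun j _ => ?_
          rw [smul_smul, mul_comm]
      _ = _ := by simp only [hAe]
  rw [SetLike.mem_coe, hk]
  exact Submodule.sum_mem _ fun i _ => Submodule.smul_mem _ _ (Submodule.subset_span ⟨i, rfl⟩)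

end Lattice

/-! ### Unimodularity of the glued triangulation -/

/-- An integral combination of the edges of a simplex that is a real combination of the edges of a
face is an integral combination of these. -/
theorem mem_vectorSpan_int_of_subset {E : Type*} [AddCommGroup E] [Module ℝ E] {s s' : Set E}
    (hs : AffineIndependent ℝ ((↑) : s → E)) (hss : s' ⊆ s) {x : E} (hx : x ∈ vectorSpan ℤ s)
    (hx' : x ∈ vectorSpan ℝ s') : x ∈ vectorSpan ℤ s' := by
  rcases s'.eq_empty_or_nonempty with rfl | ⟨p, hp⟩
  · rw [vectorSpan_empty, Submodule.mem_bot] at hx'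
    exact hx' ▸ Submodule.zero_mem _
  rw [affineIndependent_set_iff_linearIndependent_vsub ℝ (hss hp)] at hs
  rw [vectorSpan_eq_span_vsub_set_right_ne _ (hss hp)] at hx
  rw [vectorSpan_eq_span_vsub_set_right_ne _ hp] at hx' ⊢
  set B := (fun x => x -ᵥ p) '' (s \ {p})
  set B' := (fun x => x -ᵥ p) '' (s' \ {p})
  have hBB : B' ⊆ B := Set.image_mono (Set.sdiff_subset_sdiff_left hss)
  have hun : B = B' ∪ (B \ B') := (Set.union_sdiff_cancel hBB).symm
  rw [hun, Submodule.span_union] at hx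
  obtain ⟨y, hy, z, hz, rfl⟩ := Submodule.mem_sup.1 hx
  have hyR : y ∈ Submodule.span ℝ B' := Submodule.span_subset_span ℤ ℝ B' hy
  have hzR : z ∈ Submodule.span ℝ (B \ B') := Submodule.span_subset_span ℤ ℝ _ hz
  have hzR' : z ∈ Submodule.span ℝ B' := by
    simpa using Submodule.sub_mem _ hx' hyR
  -- The part `z` carried by the edges outside the face lies in both real spans, hence vanishes by
  -- linear independence.
  have hdisj : Disjoint (Submodule.span ℝ B') (Submodule.span ℝ (B \ B')) := by
    have h := hs.disjoint_span_image
      (s := {i : B | (i : E) ∈ B'}) (t := {i : B | (i : E) ∉ B'})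
      (Set.disjoint_left.2 fun i h h' => h' h)
    have e₁ : (fun v : B => (v : E)) '' {i : B | (i : E) ∈ B'} = B' := by
      ext v
      exact ⟨fun ⟨i, hi, h⟩ => h ▸ hi, fun hv => ⟨⟨v, hBB hv⟩, hv, rfl⟩⟩
    have e₂ : (fun v : B => (v : E)) '' {i : B | (i : E) ∉ B'} = B \ B' := by
      ext v
      exact ⟨fun ⟨i, hi, h⟩ => h ▸ ⟨i.2, hi⟩, fun hv => ⟨⟨v, hv.1⟩, hv.2, rfl⟩⟩
    rw [e₁, e₂] at h
    exact h
  rw [Submodule.disjoint_def.1 hdisj z hzR' hzR, add_zero]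
  exact hy

/-- Only differences of points matter, so a common offset `c` cancels. -/
theorem vectorSpan_le_comap {R : Type*} [Ring R] {E F : Type*} [AddCommGroup E] [Module R E]
    [AddCommGroup F] [Module R F] {s : Set E} (g : E →ₗ[R] F) (W : Submodule R F) (c : F)
    (h : ∀ x ∈ s, g x - c ∈ W) : vectorSpan R s ≤ W.comap g := by
  rw [vectorSpan_def, Submodule.span_le]
  rintro _ ⟨x, hx, y, hy, rfl⟩
  have := W.sub_mem (h x hx) (h y hy)
  rw [sub_sub_sub_cancel_right] at this
  simpa using this

/-- The factors of a full-dimensional join span complementary coordinate subspaces. -/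
theorem mem_vectorSpan_of_join {J : Finset (Fin n)} {s₁ s₂ : Set (Fin n → ℝ)}
    (hJ₁ : ∀ x ∈ s₁, ∀ j, j ∉ J → x j = 0) (hJ₂ : ∀ x ∈ s₂, ∀ j, j ∈ J → x j = 0)
    (hspan : vectorSpan ℝ ((s₁ ×ˢ {(1 : ℝ)}) ∪ ((-s₂) ×ˢ {(-1 : ℝ)})) = ⊤)
    (hne₁ : s₁.Nonempty) (hne₂ : s₂.Nonempty) (x : Fin n → ℝ) :
    coordProj J x ∈ vectorSpan ℝ s₁ ∧ coordProj Jᶜ x ∈ vectorSpan ℝ s₂ := by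
  obtain ⟨f, hf⟩ := hne₁
  obtain ⟨g, hg⟩ := hne₂
  let π (K : Finset (Fin n)) : (Fin n → ℝ) →ₗ[ℝ] (Fin n → ℝ) := coordProj K
  constructor
  -- The map `(v, t) ↦ π J v - (t / 2) • f` sends the upper level to `v - f / 2` and the lower one
  -- to `f / 2`. Modulo the span of `s₁` both are the offset `f / 2`, and at height 0 the map is the
  -- projection.
  · have := vectorSpan_le_comap (π J ∘ₗ LinearMap.fst ℝ _ ℝ -
      (LinearMap.snd ℝ (Fin n → ℝ) ℝ).smulRight ((1 / 2 : ℝ) • f)) (vectorSpan ℝ s₁)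
      ((1 / 2 : ℝ) • f) (s := (s₁ ×ˢ {(1 : ℝ)}) ∪ ((-s₂) ×ˢ {(-1 : ℝ)})) (by
        rintro ⟨v, t⟩ (⟨hv, ht⟩ | ⟨hv, ht⟩)
        · obtain rfl : t = 1 := ht
          have e : coordProj J v = v := coordProj_eq_self (hJ₁ v hv)
          have h2 := vsub_mem_vectorSpan ℝ hv hf
          convert h2 using 1
          simp only [π, LinearMap.sub_apply, LinearMap.comp_apply, LinearMap.fst_apply,
            LinearMap.smulRight_apply, LinearMap.snd_apply, ContinuousLinearMap.coe_coe, e,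
            vsub_eq_sub]
          module
        · obtain rfl : t = -1 := ht
          have e : coordProj J v = 0 := coordProj_eq_zero fun j hj => by
            simpa using hJ₂ (-v) hv j hj
          convert Submodule.zero_mem _ using 1
          simp only [π, LinearMap.sub_apply, LinearMap.comp_apply, LinearMap.fst_apply,
            LinearMap.smulRight_apply, LinearMap.snd_apply, ContinuousLinearMap.coe_coe, e]
          module)
    rw [hspan] at this
    have hx := this (Submodule.mem_top : (x, (0 : ℝ)) ∈ ⊤)
    simpa [π] using hx
  · have := vectorSpan_le_comap (-(π Jᶜ ∘ₗ LinearMap.fst ℝ _ ℝ) -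
      (LinearMap.snd ℝ (Fin n → ℝ) ℝ).smulRight (-(1 / 2 : ℝ) • g)) (vectorSpan ℝ s₂)
      ((1 / 2 : ℝ) • g) (s := (s₁ ×ˢ {(1 : ℝ)}) ∪ ((-s₂) ×ˢ {(-1 : ℝ)})) (by
        rintro ⟨v, t⟩ (⟨hv, ht⟩ | ⟨hv, ht⟩)
        · obtain rfl : t = 1 := ht
          have e : coordProj Jᶜ v = 0 :=
            coordProj_eq_zero fun j hj => hJ₁ v hv j (Finset.mem_compl.1 hj)
          convert Submodule.zero_mem _ using 1
          simp only [π, LinearMap.sub_apply, LinearMap.comp_apply, LinearMap.fst_apply,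
            LinearMap.smulRight_apply, LinearMap.snd_apply, ContinuousLinearMap.coe_coe, e,
            LinearMap.neg_apply]
          module
        · obtain rfl : t = -1 := ht
          have e : coordProj Jᶜ v = v := coordProj_eq_self fun j hj => by
            simpa using hJ₂ (-v) hv j (by simpa using hj)
          have h2 := vsub_mem_vectorSpan ℝ (Set.mem_neg.1 hv) hg
          convert h2 using 1
          simp only [π, LinearMap.sub_apply, LinearMap.comp_apply, LinearMap.fst_apply,
            LinearMap.smulRight_apply, LinearMap.snd_apply, ContinuousLinearMap.coe_coe, e,
            vsub_eq_sub, LinearMap.neg_apply]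
          module)
    rw [hspan] at this
    have hx := this (Submodule.mem_top : (x, (0 : ℝ)) ∈ ⊤)
    simpa [π] using hx

theorem IsCoordinateLattice.coordProj_mem {Λ : Submodule ℤ (Fin n → ℝ)}
    (h : IsCoordinateLattice Λ) (J : Finset (Fin n)) {x : Fin n → ℝ} (hx : x ∈ Λ) :
    coordProj J x ∈ Λ := by
  rw [← Finset.univ_sum_single (coordProj J x)]
  refine Λ.sum_mem fun j _ => ?_
  rw [coordProj_apply]
  split_ifs
  · exact h x hx j
  · rw [Pi.single_zero]
    exact Λ.zero_mem

theorem isUnimodularTriangulation_gluedCells {P₁ P₂ : Set (Fin n → ℝ)}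
    {S₁ S₂ : Set (Set (Fin n → ℝ))}
    (hP₁ : IsFullDimAntiBlocking P₁) (hP₂ : IsFullDimAntiBlocking P₂)
    (Λ : Submodule ℤ (Fin n → ℝ)) [DiscreteTopology Λ] [IsZLattice ℝ Λ]
    (hΛ : IsCoordinateLattice Λ)
    (hS₁ : IsUnimodularTriangulation (Λ : Set (Fin n → ℝ)) P₁ S₁)
    (hS₂ : IsUnimodularTriangulation (Λ : Set (Fin n → ℝ)) P₂ S₂) :
    IsUnimodularTriangulation (oddLift Λ) (cayleyDiff P₁ P₂) (gluedCells P₁ P₂ S₁ S₂) := by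
  have htri := isTriangulation_gluedCells hP₁ hP₂ hS₁.1 hS₂.1
  refine ⟨htri, fun Q hQ => ?_⟩
  have : (MeasureTheory.volume : MeasureTheory.Measure ((Fin n → ℝ) × ℝ)).IsAddHaarMeasure := by
    rw [MeasureTheory.Measure.volume_eq_prod]
    infer_instance
  have hsimp := htri.isSimplex Q hQ
  obtain ⟨⟨J, _, ⟨T₁, hT₁, rfl⟩, _, ⟨T₂, hT₂, rfl⟩, rfl⟩, hdim⟩ := mem_gluedCells.1 hQ
  have hp₁ := hS₁.1.isPolytope _ hT₁
  have hp₂ := hS₂.1.isPolytope _ hT₂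
  have hV := vertices_cayleyDiff (hp₁.convex.inter (convex_coordFace hP₁.convex J))
    (hp₂.convex.inter (convex_coordFace hP₂.convex Jᶜ))
  set s₁ := vertices (T₁ ∩ coordFace P₁ J) with hs₁
  set s₂ := vertices (T₂ ∩ coordFace P₂ Jᶜ) with hs₂
  have m₁ : ∀ x, x ∈ s₁ ↔ x ∈ vertices T₁ ∧ ∀ j, j ∉ J → x j = 0 := fun x =>
    mem_vertices_inter_coordFace hP₁.nonneg (hS₁.1.subset hT₁)
  have m₂ : ∀ x, x ∈ s₂ ↔ x ∈ vertices T₂ ∧ ∀ j, j ∉ Jᶜ → x j = 0 := fun x =>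
    mem_vertices_inter_coordFace hP₂.nonneg (hS₂.1.subset hT₂)
  obtain ⟨hn₁, hn₂⟩ := nonempty_of_vectorSpan_cayleyDiff hdim
  have hne₁ : s₁.Nonempty :=
    (hp₁.inter_coordFace J hP₁.nonneg (hS₁.1.subset hT₁) hn₁).vertices_nonempty
  have hne₂ : s₂.Nonempty :=
    (hp₂.inter_coordFace Jᶜ hP₂.nonneg (hS₂.1.subset hT₂) hn₂).vertices_nonempty
  have hspan : vectorSpan ℝ ((s₁ ×ˢ {(1 : ℝ)}) ∪ ((-s₂) ×ˢ {(-1 : ℝ)})) = ⊤ := by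
    rw [← hV, ← vectorSpan_convexHull_eq, hsimp.isPolytope.convexHull_vertices, hdim]
  have hu₁ := hS₁.2 T₁ hT₁
  have hu₂ := hS₂.2 T₂ hT₂
  -- Both coordinate projections of `x` stay in `Λ`, as it is a coordinate lattice. Each is an
  -- integral combination of edges of `T₁` or `T₂` and lies in the real span of the corresponding
  -- face, hence is integral over that face.
  have hgen : ∀ x ∈ Λ, (x, (0 : ℝ)) ∈ vectorSpan ℤ ((s₁ ×ˢ {(1 : ℝ)}) ∪ ((-s₂) ×ˢ {(-1 : ℝ)})) := by
    intro x hx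
    obtain ⟨r₁, r₂⟩ := mem_vectorSpan_of_join (J := J) (fun x hx => ((m₁ x).1 hx).2)
      (fun x hx j hj => ((m₂ x).1 hx).2 j (by simpa using hj)) hspan hne₁ hne₂ x
    have z₁ := mem_vectorSpan_int_of_subset hu₁.1.1.affineIndependent_vertices
      (fun x hx => ((m₁ x).1 hx).1) (hu₁.le_vectorSpan (hΛ.coordProj_mem J hx)) r₁
    have z₂ := mem_vectorSpan_int_of_subset hu₂.1.1.affineIndependent_vertices
      (fun x hx => ((m₂ x).1 hx).1) (hu₂.le_vectorSpan (hΛ.coordProj_mem Jᶜ hx)) r₂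
    have := Submodule.add_mem _ (mk_zero_mem_vectorSpan_cayleyDiff ℤ (F₂ := s₂) z₁)
      (mk_zero_mem_vectorSpan_cayleyDiff' ℤ (F₁ := s₁) z₂)
    rw [Prod.mk_add_mk, coordProj_add_compl, add_zero] at this
    exact this
  refine isUnimodularSimplex_of_generates ⟨hsimp, ?_, ?_⟩ ?_
  · exact (vectorSpan_eq_top_iff_polyDim _).1 hdim
  · rw [hV]
    rintro ⟨x, t⟩ (⟨hx, ht⟩ | ⟨hx, ht⟩)
    · exact ⟨hu₁.1.2.2 ((m₁ x).1 hx).1, 0, by simpa using ht⟩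
    · refine ⟨by simpa using hu₂.1.2.2 ((m₂ (-x)).1 hx).1, -1, ?_⟩
      rw [show t = -1 from ht]
      norm_num
  · rw [hV]
    rintro ⟨x, t⟩ ⟨hx, k, hk⟩ ⟨y, u⟩ ⟨hy, l, hl⟩
    obtain ⟨f, hf⟩ := hne₁
    obtain ⟨g, hg⟩ := hne₂
    have hfΛ : f ∈ Λ := hu₁.1.2.2 ((m₁ f).1 hf).1
    have hgΛ : g ∈ Λ := hu₂.1.2.2 ((m₂ g).1 hg).1
    -- A difference has height `2 * (k - l)`. Removing `k - l` copies of the edge `(f + g, 2)`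
    -- leaves a horizontal lattice vector.
    have h1 := hgen (x - y - (k - l) • (f + g))
      (Λ.sub_mem (Λ.sub_mem hx hy) (Λ.smul_mem _ (Λ.add_mem hfΛ hgΛ)))
    have h2 := Submodule.smul_mem _ (k - l) (add_two_mem_vectorSpan_cayleyDiff ℤ hf hg)
    have h3 := Submodule.add_mem _ h1 h2
    convert h3 using 1
    simp only at hk hl
    rw [Prod.smul_mk, Prod.mk_add_mk, Prod.mk_sub_mk, sub_add_cancel, hk, hl]
    simp only [zsmul_eq_mul, Int.cast_sub, zero_add]
    congr 1
    ring

end AntiBlockingCayley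

theorem mainTheorem7 {n : ℕ} (P₁ P₂ : Set (Fin n → ℝ))
    (hP₁ : IsFullDimAntiBlocking P₁) (hP₂ : IsFullDimAntiBlocking P₂) :
    -- the canonical mixed subdivision of `P₁ - P₂`
    (IsMixedSubdivision P₁ P₂
        (Set.range fun J : Finset (Fin n) => (coordFace P₁ J, coordFace P₂ Jᶜ)) ∧
      IsExactMixed (Set.range fun J : Finset (Fin n) => (coordFace P₁ J, coordFace P₂ Jᶜ)) ∧
      IsRegularMixed P₁ P₂
        (Set.range fun J : Finset (Fin n) => (coordFace P₁ J, coordFace P₂ Jᶜ))) ∧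
    -- the canonical subdivision of the Cayley sum into joins
    (IsSubdivision (cayleyDiff P₁ P₂)
        (Set.range fun J : Finset (Fin n) => cayleyDiff (coordFace P₁ J) (coordFace P₂ Jᶜ)) ∧
      IsRegularSubdivision (vertices (cayleyDiff P₁ P₂))
        (Set.range fun J : Finset (Fin n) => cayleyDiff (coordFace P₁ J) (coordFace P₂ Jᶜ))) ∧
    -- gluing subdivisions of `P₁` and `P₂`
    (∀ S₁ S₂ : Set (Set (Fin n → ℝ)), IsSubdivision P₁ S₁ → IsSubdivision P₂ S₂ →
      (IsSubdivision (cayleyDiff P₁ P₂) (gluedCells P₁ P₂ S₁ S₂) ∧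
        (∀ F ∈ joinCells P₁ P₂ S₁ S₂, ∃ Q ∈ gluedCells P₁ P₂ S₁ S₂, IsExposed ℝ Q F)) ∧
      -- regularity, for weights on the vertices
      (IsRegularSubdivision (vertices P₁) S₁ → IsRegularSubdivision (vertices P₂) S₂ →
        IsRegularSubdivision (vertices (cayleyDiff P₁ P₂)) (gluedCells P₁ P₂ S₁ S₂)) ∧
      -- regularity, for weights on larger finite point sets
      (∀ A₁ A₂ : Set (Fin n → ℝ), A₁.Finite → A₂.Finite →
        convexHull ℝ A₁ = P₁ → convexHull ℝ A₂ = P₂ → IsRegularSubdivision A₁ S₁ → IsRegularSubdivision A₂ S₂ →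
        IsRegularSubdivision ((A₁ ×ˢ {(1 : ℝ)}) ∪ ((-A₂) ×ˢ {(-1 : ℝ)})) (gluedCells P₁ P₂ S₁ S₂)) ∧
      -- triangulations
      (IsTriangulation P₁ S₁ → IsTriangulation P₂ S₂ →
        IsTriangulation (cayleyDiff P₁ P₂) (gluedCells P₁ P₂ S₁ S₂)) ∧
      -- unimodularity
      (∀ (Λ : Submodule ℤ (Fin n → ℝ)) [DiscreteTopology Λ] [IsZLattice ℝ Λ],
        IsCoordinateLattice Λ →
        IsUnimodularTriangulation (Λ : Set (Fin n → ℝ)) P₁ S₁ →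
        IsUnimodularTriangulation (Λ : Set (Fin n → ℝ)) P₂ S₂ →
        IsUnimodularTriangulation (oddLift Λ) (cayleyDiff P₁ P₂) (gluedCells P₁ P₂ S₁ S₂)) ∧
      -- flagness
      (IsFlagTriangulation P₁ S₁ → IsFlagTriangulation P₂ S₂ →
        IsFlagTriangulation (cayleyDiff P₁ P₂) (gluedCells P₁ P₂ S₁ S₂))) :=
  ⟨⟨isMixedSubdivision_coordFace hP₁ hP₂, isExactMixed_coordFace hP₁ hP₂,
      isRegularMixed_coordFace hP₁ hP₂⟩,
    isSubdivision_joins hP₁ hP₂,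
    fun _ _ hS₁ hS₂ =>
      ⟨⟨isSubdivision_gluedCells hP₁ hP₂ hS₁ hS₂,
          fun _ hF => exists_gluedCells_isExposed hP₁ hP₂ hS₁ hS₂ hF⟩,
        isRegularSubdivision_vertices_gluedCells hP₁ hP₂ hS₁ hS₂,
        fun _ _ hf₁ hf₂ hA₁ hA₂ =>
          isRegularSubdivision_gluedCells hP₁ hP₂ hS₁ hS₂ hf₁ hf₂ hA₁ hA₂,
        isTriangulation_gluedCells hP₁ hP₂,
        fun Λ _ _ hΛ => isUnimodularTriangulation_gluedCells hP₁ hP₂ Λ hΛ,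
        isFlagTriangulation_gluedCells hP₁ hP₂⟩⟩
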